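/- **Setting.** Let $\theta\in\mathbb R^d$, $\gamma\in\mathbb R^p$, $\sigma^2\ge 0$, let $\Sigma_X\in\mathbb R^{d\times d}$ be positive definite and $\Sigma_W\in\mathbb R^{p\times p}$ positive semidefinite with $\gamma^\top\Sigma_W\gamma>0$. Let $(X_i,W_i,\epsilon_i)_{i\ge1}$ be i.i.d., where $X_i\sim\mathcal N(0,\Sigma_X)$, $W_i\sim\mathcal N(0,\Sigma_W)$, $\epsilon_i\sim\mathcal N(0,\sigma^2)$ are independent, and put $$Y_i=W_i^\top\gamma+X_i^\top\theta+\epsilon_i,\qquad \hat Y_i=W_i^\top\gamma ,\qquad \ell_\vartheta(x,y)=(y-x^\top\vartheta)^2 .$$ The target is the minimizer of $\mathbb E[\ell_\vartheta(X,Y)]$. There are $n$ labeled points $(X_i,Y_i,\hat Y_i)$, $i\le n$, and $N=N_n\ge1$ unlabeled points $(X_i,\hat Y_i)$, $n<i\le n+N$, with $n/N\to r$ for some $r\in[0,\infty)$. For an imputed loss $g_\vartheta(x,\hat y)$, the estimator with imputed loss $g$ is $$\hat\theta_g=\arg\min_\vartheta\ \frac1n\sum_{i\le n}\ell_\vartheta(X_i,Y_i)-\Big(\frac1n\sum_{i\le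 n}g_\vartheta(X_i,\hat Y_i)-\frac1N\sum_{n<i\le n+N}g_\vartheta(X_i,\hat Y_i)\Big)$$ (with any fixed value, say $0$, where there is no unique minimizer). The asymptotic covariance of estimators $\hat\theta_n$ is the matrix $\Sigma$ with $\sqrt n(\hat\theta_n-\theta)\to\mathcal N(0,\Sigma)$ in distribution. The following estimators are considered. * *XY-only*: $g=0$. * *PPI*: $g=\ell$. * *PPI++* (with optimal power tuning): $g=\hat\lambda_n\ell$, where the random numbers $\hat\lambda_n$ converge in probability to a minimizer $\lambda^\star$ of $\lambda\mapsto\mathrm{Tr}(\Sigma_\lambda)$, $\Sigma_\lambda$ being the asymptotic covariance of the estimator with imputed loss $\lambda\ell$. * *RePPI*: the labeled data are split into three folds $D_1,D_2,D_3$ whose sizes differ by at most one. On $D_1$ compute the XY-only estimator $\hat\theta_0$; from $D_2$ and $\hat\theta_0$ learn, by any (possibly randomized) measurable method whose randomness is independent of the data, a function $\hat s(x,\hat y)$; with sample covariances over $D_3$ put $\hat M=\widehat{\mathrm{Cov}}(\nabla\ell_{\hat\theta_0}(X,Y),\hat s(X,\hat Y))\,\widehat{\mathrm{Cov}}(\hat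 s(X,\hat Y))^{-1}$; let $\hat\theta^1$ be the estimator with imputed loss $\frac{1}{1+n/N}\vartheta^\top\hat M\hat s(x,\hat y)$ computed on $D_3$ and the unlabeled data. Repeat with $(D_3,D_1,D_2)$ and $(D_2,D_3,D_1)$ in place of $(D_1,D_2,D_3)$ to get $\hat\theta^2,\hat\theta^3$. The RePPI estimator is $\sum_{k=1}^3\frac{|D_k|}{n}\hat\theta^k$. It is assumed that in each of the three rounds $\hat s$ is consistent: $\mathbb E\|\hat s(X,\hat Y)-s^\star(X,\hat Y)\|^2\to0$ in probability, where the expectation is over an independent copy of $(X,\hat Y)$ and $s^\star(X,\hat Y)=\mathbb E[\nabla\ell_\theta(X,Y)\mid X,\hat Y]$. **Proposition.** The target exists, is unique, and equals $\theta$. The asymptotic covariances $\Sigma^{\mathrm{XY}}$, $\Sigma^{\mathrm{PPI}}$, $\Sigma_\lambda$ ($\lambda\in\mathbb R$), $\Sigma^{\mathrm{PPI++}}$, $\Sigma^{\mathrm{RePPI}}$ and a minimizer $\lambda^\star$ exist, and $$\mathrm{Tr}(\Sigma^{\mathrm{XY}})=(\sigma^2+\gamma^\top\Sigma_W\gamma)\,\mathrm{Tr}(\Sigma_X^{-1}),$$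 $$\mathrm{Tr}(\Sigma^{\mathrm{PPI}})=\big(\sigma^2+(1+r)\theta^\top\Sigma_X\theta+r\gamma^\top\Sigma_W\gamma\big)\mathrm{Tr}(\Sigma_X^{-1})+(1+r)\|\theta\|^2,$$ $$\mathrm{Tr}(\Sigma^{\mathrm{PPI++}})=\Big(\sigma^2+\Big(\frac r{1+r}+\frac1{1+r}\cdot\frac{b}{b+\gamma^\top\Sigma_W\gamma}\Big)\gamma^\top\Sigma_W\gamma\Big)\mathrm{Tr}(\Sigma_X^{-1}),\qquad b=\frac{\|\theta\|^2}{\mathrm{Tr}(\Sigma_X^{-1})}+\theta^\top\Sigma_X\theta,$$ $$\mathrm{Tr}(\Sigma^{\mathrm{RePPI}})=\Big(\sigma^2+\frac r{1+r}\gamma^\top\Sigma_W\gamma\Big)\mathrm{Tr}(\Sigma_X^{-1}).$$ In particular, $\mathrm{Tr}(\Sigma^{\mathrm{RePPI}})\le\mathrm{Tr}(\Sigma^{\mathrm{PPI++}})\le\min\{\mathrm{Tr}(\Sigma^{\mathrm{XY}}),\mathrm{Tr}(\Sigma^{\mathrm{PPI}})\}$. -/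

import Mathlib

open MeasureTheory ProbabilityTheory Filter Topology
open scoped NNReal ENNReal Matrix

noncomputable section

namespace RePPI

/-- The Euclidean space `ℝ^d`. -/
abbrev Vec (d : ℕ) : Type := EuclideanSpace ℝ (Fin d)

/-- The quadratic form `vᵀ S v`. -/
def quadForm {d : ℕ} (S : Matrix (Fin d) (Fin d) ℝ) (v : Vec d) : ℝ :=
  v.ofLp ⬝ᵥ (S *ᵥ v.ofLp)

/-- A family of losses `ℓ ϑ x y`, indexed by a parameter `ϑ ∈ ℝ^d`. -/
abbrev Loss (d : ℕ) : Type := Vec d → Vec d → ℝ → ℝ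

/-- The squared loss `ℓ_ϑ(x, y) = (y - xᵀϑ)²`. -/
def sqLoss (d : ℕ) : Loss d := fun ϑ x y => (y - inner ℝ x ϑ) ^ 2

/-- The gradient `∇ℓ_ϑ(x, y)` with respect to the parameter `ϑ`. -/
def lossGrad {d : ℕ} (l : Loss d) (ϑ x : Vec d) (y : ℝ) : Vec d :=
  gradient (fun t => l t x y) ϑ

open Classical in
/-- The minimizer of `F`. It is the unique minimizer where there is one; the value in the
other cases is a convention. -/
def argmin {d : ℕ} (F : Vec d → ℝ) : Vec d :=
  if h : ∃! ϑ : Vec d, ∀ t, F ϑ ≤ F t then h.choose else 0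

/-- The objective of the prediction-powered estimator with imputed loss `g`, where `L` is the set
of (indices of) labeled data points, `U` is the set of unlabeled ones, and `yh i` is the prediction
at the `i`-th point. -/
def ppiObjective {d : ℕ} (L U : Finset ℕ) (l g : Loss d) (x : ℕ → Vec d) (y yh : ℕ → ℝ)
    (ϑ : Vec d) : ℝ :=
  (L.card : ℝ)⁻¹ * ∑ i ∈ L, l ϑ (x i) (y i)
    - ((L.card : ℝ)⁻¹ * ∑ i ∈ L, g ϑ (x i) (yh i)
      - (U.card : ℝ)⁻¹ * ∑ i ∈ U, g ϑ (x i) (yh i))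

/-- The prediction-powered estimator with imputed loss `g`. -/
def ppiEstimator {d : ℕ} (L U : Finset ℕ) (l g : Loss d) (x : ℕ → Vec d) (y yh : ℕ → ℝ) : Vec d :=
  argmin (ppiObjective L U l g x y yh)

/-- The XY-only estimator: the empirical risk minimizer on the labeled data `L`. -/
def xyEstimator {d : ℕ} (L : Finset ℕ) (l : Loss d) (x : ℕ → Vec d) (y : ℕ → ℝ) : Vec d :=
  argmin fun ϑ => (L.card : ℝ)⁻¹ * ∑ i ∈ L, l ϑ (x i) (y i)

/-- Among the data points `0, …, n + N - 1`, the first `n` are labeled. -/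
def labeled (n : ℕ) : Finset ℕ := Finset.range n

/-- Among the data points `0, …, n + N - 1`, the last `N` are unlabeled. -/
def unlabeled (n N : ℕ) : Finset ℕ := Finset.Ico n (n + N)

/-- The sample mean of the vectors `u i`, `i ∈ D`. -/
def sampleMean {d : ℕ} (D : Finset ℕ) (u : ℕ → Vec d) : Vec d :=
  (D.card : ℝ)⁻¹ • ∑ i ∈ D, u i

/-- The sample cross-covariance matrix of `(u i, v i)`, `i ∈ D`. -/
def sampleCov {d : ℕ} (D : Finset ℕ) (u v : ℕ → Vec d) : Matrix (Fin d) (Fin d) ℝ :=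
  Matrix.of fun a b =>
    (D.card : ℝ)⁻¹ * ∑ i ∈ D, (u i a - sampleMean D u a) * (v i b - sampleMean D v b)

/-! ### Recalibrated prediction-powered inference -/

/-- The `k`-th of the three folds of the labeled data, when `fold n i` is the number of the fold
that contains the `i`-th of `n` labeled points. -/
def foldSet (fold : ℕ → ℕ → Fin 3) (n : ℕ) (k : Fin 3) : Finset ℕ :=
  (labeled n).filter fun i => fold n i = k

/-- A black-box regression method. From the training points `(X_i, Y_i, Ŷ_i)`, `i ∈ D`, an initial
estimate of the parameter, and a random seed `u` (the internal randomness of the method) it makes a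
function of `(x, ŷ)`, meant as an estimate of `E[∇ℓ(X, Y) ∣ X, Ŷ]` at the initial estimate. It may
also depend on the number `n` of labeled points and the round `k` of cross-fitting. -/
abbrev Learner (d : ℕ) (𝒰 : Type*) : Type _ :=
  (n : ℕ) → (k : Fin 3) → (D : Finset ℕ) → 𝒰 → Vec d → (D → Vec d × ℝ × ℝ) → Vec d × ℝ → Vec d

/-- Joint measurability of a learner in the seed, the initial estimate, the training data and the
point at which the learnt function is evaluated. -/
def MeasurableLearner {d : ℕ} {𝒰 : Type*} [MeasurableSpace 𝒰] (A : Learner d 𝒰) : Prop :=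
  ∀ (n : ℕ) (k : Fin 3) (D : Finset ℕ), Measurable fun q : 𝒰 × Vec d × (D → Vec d × ℝ × ℝ) × (Vec d × ℝ) =>
    A n k D q.1 q.2.1 q.2.2.1 q.2.2.2

/-- The three rounds of cross-fitting (`k = 0, 1, 2`) use the folds in the orders `(0, 1, 2)`,
`(2, 0, 1)`, `(1, 2, 0)`. The first of them, `-k` modulo `3`, gives the initial estimator. -/
def initEstimator {d : ℕ} (l : Loss d) (fold : ℕ → ℕ → Fin 3) (n : ℕ) (k : Fin 3)
    (x : ℕ → Vec d) (y : ℕ → ℝ) : Vec d :=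
  xyEstimator (foldSet fold n (-k)) l x y

/-- The function `ŝ` of round `k`, learnt on the second fold of that round, `1 - k` modulo `3`. -/
def fittedScore {d : ℕ} {𝒰 : Type*} (l : Loss d) (A : Learner d 𝒰) (fold : ℕ → ℕ → Fin 3)
    (n : ℕ) (k : Fin 3) (u : 𝒰) (x : ℕ → Vec d) (y yh : ℕ → ℝ) : Vec d × ℝ → Vec d :=
  A n k (foldSet fold n (1 - k)) u (initEstimator l fold n k x y) fun i => (x i, y i, yh i)

/-- The matrix `M̂ = Ĉov(∇ℓ_{ϑ₀}(X, Y), ŝ(X, Ŷ)) Ĉov(ŝ(X, Ŷ))⁻¹`, with sample covariances over the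
points in `D`. -/
def tuningMatrix {d : ℕ} (l : Loss d) (D : Finset ℕ) (ϑ₀ : Vec d) (s : Vec d × ℝ → Vec d)
    (x : ℕ → Vec d) (y yh : ℕ → ℝ) : Matrix (Fin d) (Fin d) ℝ :=
  sampleCov D (fun i => lossGrad l ϑ₀ (x i) (y i)) (fun i => s (x i, yh i))
    * (sampleCov D (fun i => s (x i, yh i)) (fun i => s (x i, yh i)))⁻¹

/-- The linear imputed loss `g_ϑ(x, ŷ) = (1 + n/N)⁻¹ ϑᵀ M s(x, ŷ)`. -/
def linearImputedLoss {d : ℕ} (n N : ℕ) (M : Matrix (Fin d) (Fin d) ℝ) (s : Vec d × ℝ → Vec d) :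
    Loss d :=
  fun ϑ x yh => (1 + (n : ℝ) / N)⁻¹ * (ϑ.ofLp ⬝ᵥ (M *ᵥ (s (x, yh)).ofLp))

/-- The estimator of round `k`, computed on the third fold of that round, `2 - k` modulo `3`, and on
the unlabeled data. -/
def foldEstimator {d : ℕ} {𝒰 : Type*} (l : Loss d) (A : Learner d 𝒰) (fold : ℕ → ℕ → Fin 3)
    (n N : ℕ) (k : Fin 3) (u : 𝒰) (x : ℕ → Vec d) (y yh : ℕ → ℝ) : Vec d :=
  ppiEstimator (foldSet fold n (2 - k)) (unlabeled n N) l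
    (linearImputedLoss n N
      (tuningMatrix l (foldSet fold n (2 - k)) (initEstimator l fold n k x y)
        (fittedScore l A fold n k u x y yh) x y yh)
      (fittedScore l A fold n k u x y yh))
    x y yh

/-- The recalibrated prediction-powered estimator with three-fold cross-fitting. -/
def reppiEstimator {d : ℕ} {𝒰 : Type*} (l : Loss d) (A : Learner d 𝒰) (fold : ℕ → ℕ → Fin 3)
    (n N : ℕ) (u : 𝒰) (x : ℕ → Vec d) (y yh : ℕ → ℝ) : Vec d :=
  ∑ k : Fin 3, (((foldSet fold n k).card : ℝ) / n) • foldEstimator l A fold n N k u x y yh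

/-! ### Asymptotic covariance -/

/-- `S` is the asymptotic covariance matrix of the estimators `est n` of `ϑ`, where `n` is the
number of labeled points: `√n (est n - ϑ)` converges in distribution to `N(0, S)`. -/
def IsAsympCov {Ω : Type*} [MeasurableSpace Ω] (P : Measure Ω) [IsProbabilityMeasure P] {d : ℕ}
    (est : ℕ → Ω → Vec d) (ϑ : Vec d) (S : Matrix (Fin d) (Fin d) ℝ) : Prop :=
  S.PosSemidef ∧
    TendstoInDistribution (fun (n : ℕ) ω => √(n : ℝ) • (est n ω - ϑ)) atTop
      (id : Vec d → Vec d) (fun _ => P) (multivariateGaussian 0 S)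

end RePPI

end

/-! Each estimator of the statement minimizes a function ϑ ↦ ⟨ϑ, A ϑ⟩ - 2⟨b, ϑ⟩ + c, where the
random symmetric matrix A tends to `SX` in probability and b - A θ is of order n^(-1/2). Where A is
positive definite the minimizer minus θ is A⁻¹ (b - A θ), so √n (est - θ) = SX⁻¹ √n (b - A θ) +
o_P(1); this is `negligible_quadMin_sub`, and it replaces any general theory of M-estimation.

In all cases b - A θ equals, up to o_P(n^(-1/2)), mean_L(resid) - λ (mean_L(imputed) -
mean_U(imputed)), where resid = (Y - ⟨X, θ⟩) X and imputed = (Ŷ - κ⟨X, θ⟩) X. Power tuning has κ = 1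
and λ = lim λ̂; it contains XY-only (λ = 0) and PPI (λ = 1). RePPI has κ = 0 and λ = 1/(1 + r). So
one two-sample central limit theorem (`IsIID.tendstoInDistribution_two_sample`) serves all of them,
through `isAsympCov_of_linearization`. Gaussian fourth moments make the limiting variance explicit
(`variance_inner_mul_linear`), and the result is `asympCov`.

The work for RePPI is to remove the learnt function. By `condExp_lossGrad`, s⋆ = -2 Ŷ X. In each
round ŝ is computed from a seed and two folds, hence independently of the third fold D and of the
unlabeled data. A difference of two averages does not see the mean of the summand, so, given the
learning data, replacing ŝ by s⋆ costs a second moment of at most (1/|D| + 1/N) E‖ŝ - s⋆‖², which is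
o_P(1/n) (`IsIID.negligible_avg_sub_avg_of_indepFun`). Moreover M̂ → 1: the covariance of the
gradient with s⋆ and the covariance of s⋆ are both 4 (γᵀ SW γ) SX (`matTendsto_tuningMatrix`). The
weighted sum over the rounds then restores the average over all labeled data.

The traces are algebra. For κ = 1 the trace is a quadratic polynomial in λ, and completing the
square gives the optimal tuning and the comparison with λ = 0 and λ = 1. For κ = 0 every term
containing θ drops out, and λ = 1/(1 + r) is the minimizer of (1 - λ)² + r λ², with value r/(1 + r);
what PPI++ has in excess of this is a nonnegative summand. -/

noncomputable section

namespace RePPI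

/-! ### Convergence and boundedness in probability -/

section InProbability

variable {Ω : Type*} [MeasurableSpace Ω] {P : Measure Ω}
variable {F G H : Type*} [SeminormedAddCommGroup F] [SeminormedAddCommGroup G]
  [SeminormedAddCommGroup H]

/-- The sequence `f` is bounded in probability (tight). -/
def BoundedInProb (P : Measure Ω) (f : ℕ → Ω → F) : Prop :=
  ∀ ε : ℝ≥0∞, 0 < ε → ∃ M : ℝ, 0 < M ∧ ∀ᶠ n in atTop, P {ω | M ≤ ‖f n ω‖} ≤ ε

/-- The sequence `f` converges to zero in probability. -/
def Negligible (P : Measure Ω) (f : ℕ → Ω → F) : Prop :=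
  ∀ δ : ℝ, 0 < δ → Tendsto (fun n => P {ω | δ ≤ ‖f n ω‖}) atTop (𝓝 0)

lemma negligible_iff_tendstoInMeasure {f : ℕ → Ω → F} :
    Negligible P f ↔ TendstoInMeasure P f atTop 0 := by
  rw [tendstoInMeasure_iff_norm]
  simp [Negligible]

lemma negligible_sub_const_iff {f : ℕ → Ω → F} {c : F} :
    Negligible P (fun n ω => f n ω - c) ↔ TendstoInMeasure P f atTop fun _ => c := by
  rw [tendstoInMeasure_iff_norm]
  rfl

lemma negligible_of_eventually_forall {f : ℕ → Ω → F}
    (h : ∀ δ : ℝ, 0 < δ → ∀ ε : ℝ≥0∞, 0 < ε → ∀ᶠ n in atTop, P {ω | δ ≤ ‖f n ω‖} ≤ ε) :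
    Negligible P f :=
  fun δ hδ => ENNReal.tendsto_nhds_zero.2 fun ε hε => h δ hδ ε hε

lemma Negligible.eventually_le {f : ℕ → Ω → F} (hf : Negligible P f) {δ : ℝ} (hδ : 0 < δ)
    {ε : ℝ≥0∞} (hε : 0 < ε) : ∀ᶠ n in atTop, P {ω | δ ≤ ‖f n ω‖} ≤ ε :=
  ENNReal.tendsto_nhds_zero.1 (hf δ hδ) ε hε

lemma Negligible.mono {f : ℕ → Ω → F} {g : ℕ → Ω → G} (hg : Negligible P g)
    (h : ∀ᶠ n in atTop, ∀ ω, ‖f n ω‖ ≤ ‖g n ω‖) : Negligible P f := by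
  refine negligible_of_eventually_forall fun δ hδ ε hε => ?_
  filter_upwards [h, hg.eventually_le hδ hε] with n hn hg
  exact (measure_mono fun ω hω => le_trans hω (hn ω)).trans hg

lemma Negligible.congr {f g : ℕ → Ω → F} (hg : Negligible P g)
    (h : ∀ᶠ n in atTop, ∀ ω, f n ω = g n ω) : Negligible P f :=
  hg.mono (h.mono fun _ hn ω => (congrArg norm (hn ω)).le)

/-- It is enough to control a sequence on events of probability tending to one. -/
lemma Negligible.of_eq_on {f g : ℕ → Ω → F} (hg : Negligible P g) {B : ℕ → Set Ω}
    (hB : Tendsto (fun n => P (B n)) atTop (𝓝 0))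
    (h : ∀ᶠ n in atTop, ∀ ω, ω ∉ B n → f n ω = g n ω) : Negligible P f := by
  intro δ hδ
  have h2 : Tendsto (fun n => P (B n) + P {ω | δ ≤ ‖g n ω‖}) atTop (𝓝 0) := by
    simpa using hB.add (hg δ hδ)
  refine tendsto_of_tendsto_of_tendsto_of_le_of_le' tendsto_const_nhds h2
    (Eventually.of_forall fun _ => zero_le) ?_
  filter_upwards [h] with n hn
  refine (measure_mono ?_).trans (measure_union_le _ _)
  intro ω hω
  by_cases hb : ω ∈ B n
  · exact Or.inl hb
  · right
    simpa [← hn ω hb] using hω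

lemma Negligible.add {f g : ℕ → Ω → F} (hf : Negligible P f) (hg : Negligible P g) :
    Negligible P (fun n ω => f n ω + g n ω) := by
  intro δ hδ
  have h := (hf (δ / 2) (by positivity)).add (hg (δ / 2) (by positivity))
  rw [add_zero] at h
  refine tendsto_of_tendsto_of_tendsto_of_le_of_le tendsto_const_nhds h (fun _ => zero_le) ?_
  intro n
  refine (measure_mono ?_).trans (measure_union_le _ _)
  intro ω hω
  by_contra hc
  simp only [Set.mem_union, Set.mem_ofPred_eq, not_or, not_le] at hc hω
  linarith [norm_add_le (f n ω) (g n ω)]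

lemma Negligible.neg {f : ℕ → Ω → F} (hf : Negligible P f) :
    Negligible P (fun n ω => -f n ω) :=
  hf.mono (Eventually.of_forall fun _ _ => (norm_neg _).le)

lemma Negligible.sub {f g : ℕ → Ω → F} (hf : Negligible P f) (hg : Negligible P g) :
    Negligible P (fun n ω => f n ω - g n ω) := by
  simpa [sub_eq_add_neg] using hf.add hg.neg

lemma negligible_zero : Negligible P (fun (_ : ℕ) (_ : Ω) => (0 : F)) := by
  intro δ hδ
  simp [not_le.2 hδ]

lemma Negligible.sum {ι : Type*} (s : Finset ι) {f : ι → ℕ → Ω → F}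
    (hf : ∀ j ∈ s, Negligible P (f j)) : Negligible P (fun n ω => ∑ j ∈ s, f j n ω) := by
  classical
  induction s using Finset.induction_on with
  | empty => simpa using negligible_zero
  | insert j s hj ih =>
    simp_rw [Finset.sum_insert hj]
    exact (hf j (Finset.mem_insert_self _ _)).add
      (ih fun i hi => hf i (Finset.mem_insert_of_mem hi))

lemma BoundedInProb.mono {f : ℕ → Ω → F} {g : ℕ → Ω → G} (hg : BoundedInProb P g)
    (h : ∀ᶠ n in atTop, ∀ ω, ‖f n ω‖ ≤ ‖g n ω‖) : BoundedInProb P f := by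
  intro ε hε
  obtain ⟨M, hM, hg⟩ := hg ε hε
  refine ⟨M, hM, ?_⟩
  filter_upwards [h, hg] with n hn hg
  exact (measure_mono fun ω hω => le_trans hω (hn ω)).trans hg

lemma BoundedInProb.add {f g : ℕ → Ω → F} (hf : BoundedInProb P f) (hg : BoundedInProb P g) :
    BoundedInProb P (fun n ω => f n ω + g n ω) := by
  intro ε hε
  obtain ⟨M, hM, hf⟩ := hf (ε / 2) (ENNReal.half_pos hε.ne')
  obtain ⟨K, hK, hg⟩ := hg (ε / 2) (ENNReal.half_pos hε.ne')
  refine ⟨M + K, by positivity, ?_⟩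
  filter_upwards [hf, hg] with n hf hg
  rw [← ENNReal.add_halves ε]
  refine (measure_mono ?_).trans ((measure_union_le _ _).trans (add_le_add hf hg))
  intro ω hω
  by_contra hc
  simp only [Set.mem_union, Set.mem_ofPred_eq, not_or, not_le] at hc hω
  linarith [norm_add_le (f n ω) (g n ω)]

lemma BoundedInProb.neg {f : ℕ → Ω → F} (hf : BoundedInProb P f) :
    BoundedInProb P (fun n ω => -f n ω) :=
  hf.mono (Eventually.of_forall fun _ _ => (norm_neg _).le)

lemma BoundedInProb.sub {f g : ℕ → Ω → F} (hf : BoundedInProb P f) (hg : BoundedInProb P g) :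
    BoundedInProb P (fun n ω => f n ω - g n ω) := by
  simpa [sub_eq_add_neg] using hf.add hg.neg

lemma boundedInProb_const (c : F) : BoundedInProb P (fun (_ : ℕ) (_ : Ω) => c) := by
  intro ε hε
  refine ⟨‖c‖ + 1, by positivity, Eventually.of_forall fun _ => ?_⟩
  simp [not_le.2 (zero_lt_one' ℝ)]

lemma Negligible.boundedInProb {f : ℕ → Ω → F} (hf : Negligible P f) : BoundedInProb P f :=
  fun _ hε => ⟨1, one_pos, hf.eventually_le one_pos hε⟩

lemma boundedInProb_of_tendstoInMeasure {f : ℕ → Ω → F} {c : F}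
    (h : TendstoInMeasure P f atTop fun _ => c) : BoundedInProb P f := by
  simpa using (negligible_sub_const_iff.2 h).boundedInProb.add (boundedInProb_const c)

/-- A product of a negligible and a bounded sequence is negligible. -/
lemma Negligible.of_norm_le_mul {f : ℕ → Ω → F} {g : ℕ → Ω → G} {h : ℕ → Ω → H}
    (hf : Negligible P f) (hg : BoundedInProb P g)
    (hle : ∀ᶠ n in atTop, ∀ ω, ‖h n ω‖ ≤ ‖f n ω‖ * ‖g n ω‖) : Negligible P h := by
  refine negligible_of_eventually_forall fun δ hδ ε hε => ?_
  obtain ⟨M, hM, hg⟩ := hg (ε / 2) (ENNReal.half_pos hε.ne')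
  filter_upwards [hle, hg, hf.eventually_le (div_pos hδ hM) (ENNReal.half_pos hε.ne')]
    with n hle hg hf
  rw [← ENNReal.add_halves ε]
  refine (measure_mono ?_).trans ((measure_union_le _ _).trans (add_le_add hf hg))
  intro ω hω
  by_contra hc
  simp only [Set.mem_union, Set.mem_ofPred_eq, not_or, not_le] at hc hω
  have h1 : ‖f n ω‖ * ‖g n ω‖ ≤ δ / M * ‖g n ω‖ :=
    mul_le_mul_of_nonneg_right hc.1.le (norm_nonneg _)
  have h2 : δ / M * ‖g n ω‖ < δ / M * M := mul_lt_mul_of_pos_left hc.2 (div_pos hδ hM)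
  rw [div_mul_cancel₀ _ hM.ne'] at h2
  linarith [hle ω]

lemma BoundedInProb.of_norm_le_mul {f : ℕ → Ω → F} {g : ℕ → Ω → G} {h : ℕ → Ω → H}
    (hf : BoundedInProb P f) (hg : BoundedInProb P g)
    (hle : ∀ᶠ n in atTop, ∀ ω, ‖h n ω‖ ≤ ‖f n ω‖ * ‖g n ω‖) : BoundedInProb P h := by
  intro ε hε
  obtain ⟨M, hM, hf⟩ := hf (ε / 2) (ENNReal.half_pos hε.ne')
  obtain ⟨K, hK, hg⟩ := hg (ε / 2) (ENNReal.half_pos hε.ne')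
  refine ⟨M * K, by positivity, ?_⟩
  filter_upwards [hf, hg, hle] with n hf hg hle
  rw [← ENNReal.add_halves ε]
  refine (measure_mono ?_).trans ((measure_union_le _ _).trans (add_le_add hf hg))
  intro ω hω
  by_contra hc
  simp only [Set.mem_union, Set.mem_ofPred_eq, not_or, not_le] at hc hω
  have h1 : ‖f n ω‖ * ‖g n ω‖ < M * K :=
    mul_lt_mul'' hc.1 hc.2 (norm_nonneg _) (norm_nonneg _)
  linarith [hle ω]

lemma negligible_of_tendsto {a : ℕ → F} (ha : Tendsto a atTop (𝓝 0)) :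
    Negligible P (fun n (_ : Ω) => a n) := by
  refine negligible_of_eventually_forall fun δ hδ ε hε => ?_
  filter_upwards [(tendsto_zero_iff_norm_tendsto_zero.1 ha).eventually (gt_mem_nhds hδ)]
    with n hn
  simp [not_le.2 hn]

lemma tendstoInMeasure_const_of_tendsto {a : ℕ → F} {c : F} (ha : Tendsto a atTop (𝓝 c)) :
    TendstoInMeasure P (fun n (_ : Ω) => a n) atTop fun _ => c :=
  negligible_sub_const_iff.1 (negligible_of_tendsto (by simpa using ha.sub_const c))

lemma tendstoInMeasure_mul {X Y : ℕ → Ω → ℝ} {x y : ℝ}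
    (hX : TendstoInMeasure P X atTop fun _ => x) (hY : TendstoInMeasure P Y atTop fun _ => y) :
    TendstoInMeasure P (fun n ω => X n ω * Y n ω) atTop fun _ => x * y := by
  have h1 : Negligible P fun n ω => (X n ω - x) * Y n ω :=
    (negligible_sub_const_iff.2 hX).of_norm_le_mul (boundedInProb_of_tendstoInMeasure hY)
      (Eventually.of_forall fun n ω => (norm_mul _ _).le)
  have h2 : Negligible P fun n ω => (Y n ω - y) * x :=
    (negligible_sub_const_iff.2 hY).of_norm_le_mul (boundedInProb_const x)
      (Eventually.of_forall fun n ω => (norm_mul _ _).le)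
  refine negligible_sub_const_iff.1 ((h1.add h2).congr (Eventually.of_forall fun n ω => ?_))
  ring

lemma tendstoInMeasure_sub {X Y : ℕ → Ω → F} {x y : F}
    (hX : TendstoInMeasure P X atTop fun _ => x) (hY : TendstoInMeasure P Y atTop fun _ => y) :
    TendstoInMeasure P (fun n ω => X n ω - Y n ω) atTop fun _ => x - y :=
  negligible_sub_const_iff.1 (((negligible_sub_const_iff.2 hX).sub
    (negligible_sub_const_iff.2 hY)).congr (Eventually.of_forall fun n ω => by abel))

lemma tendstoInMeasure_sum {ι : Type*} (s : Finset ι) {X : ι → ℕ → Ω → F} {x : ι → F}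
    (h : ∀ j ∈ s, TendstoInMeasure P (X j) atTop fun _ => x j) :
    TendstoInMeasure P (fun n ω => ∑ j ∈ s, X j n ω) atTop fun _ => ∑ j ∈ s, x j :=
  negligible_sub_const_iff.1 ((Negligible.sum s fun j hj =>
    negligible_sub_const_iff.2 (h j hj)).congr
      (Eventually.of_forall fun n ω => by rw [Finset.sum_sub_distrib]))

/-- The continuous mapping theorem for convergence in probability to a constant. -/
lemma tendstoInMeasure_comp_of_continuousAt {f : ℕ → Ω → F} {c : F}
    (h : TendstoInMeasure P f atTop fun _ => c) {Φ : F → G} (hΦ : ContinuousAt Φ c) :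
    TendstoInMeasure P (fun n ω => Φ (f n ω)) atTop fun _ => Φ c := by
  rw [tendstoInMeasure_iff_dist] at h ⊢
  intro δ hδ
  obtain ⟨η, hη, hc⟩ := Metric.continuousAt_iff.1 hΦ δ hδ
  refine tendsto_of_tendsto_of_tendsto_of_le_of_le tendsto_const_nhds (h η hη)
    (fun _ => zero_le) fun n => measure_mono fun ω hω => ?_
  by_contra hlt
  exact absurd (hc (not_le.1 hlt)) (not_lt.2 hω)

lemma tendstoInMeasure_pi {ι : Type*} [Fintype ι] {E : ι → Type*}
    [∀ j, SeminormedAddCommGroup (E j)] {f : ℕ → Ω → ∀ j, E j} {c : ∀ j, E j}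
    (h : ∀ j, TendstoInMeasure P (fun n ω => f n ω j) atTop fun _ => c j) :
    TendstoInMeasure P f atTop fun _ => c := by
  classical
  have hs : Negligible P (fun n ω => ∑ j, ‖f n ω j - c j‖) :=
    Negligible.sum _ fun j _ => (negligible_sub_const_iff.2 (h j)).mono
      (Eventually.of_forall fun n ω => by simp)
  refine negligible_sub_const_iff.1 (hs.mono (Eventually.of_forall fun n ω => ?_))
  rw [Real.norm_of_nonneg (Finset.sum_nonneg fun _ _ => norm_nonneg _)]
  refine (pi_norm_le_iff_of_nonneg (Finset.sum_nonneg fun _ _ => norm_nonneg _)).2 fun j => ?_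
  exact Finset.single_le_sum (f := fun j => ‖f n ω j - c j‖) (fun _ _ => norm_nonneg _)
    (Finset.mem_univ j)

/-- Markov's inequality for second moments. -/
lemma measure_norm_ge_le (f : Ω → F) (hf : AEMeasurable (fun ω => ‖f ω‖ₑ) P) {δ : ℝ}
    (hδ : 0 < δ) :
    P {ω | δ ≤ ‖f ω‖} ≤ (∫⁻ ω, ‖f ω‖ₑ ^ 2 ∂P) / ENNReal.ofReal δ ^ 2 := by
  have h := meas_ge_le_lintegral_div (hf.pow_const 2) (ε := ENNReal.ofReal δ ^ 2)
    (by simpa using hδ) (by finiteness)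
  refine (measure_mono fun ω hω => ?_).trans h
  have : ENNReal.ofReal δ ≤ ‖f ω‖ₑ := by
    rw [← ofReal_norm]; exact ENNReal.ofReal_le_ofReal hω
  exact pow_le_pow_left' this 2

lemma negligible_of_lintegral_sq {f : ℕ → Ω → F} (hf : ∀ n, AEMeasurable (fun ω => ‖f n ω‖ₑ) P)
    (h : Tendsto (fun n => ∫⁻ ω, ‖f n ω‖ₑ ^ 2 ∂P) atTop (𝓝 0)) : Negligible P f := by
  intro δ hδ
  have h2 := ENNReal.Tendsto.div_const h (b := ENNReal.ofReal δ ^ 2)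
    (Or.inr (by simpa using hδ))
  rw [ENNReal.zero_div] at h2
  exact tendsto_of_tendsto_of_tendsto_of_le_of_le tendsto_const_nhds h2 (fun _ => zero_le)
    fun n => measure_norm_ge_le _ (hf n) hδ

lemma boundedInProb_of_lintegral_sq_le {f : ℕ → Ω → F}
    (hf : ∀ n, AEMeasurable (fun ω => ‖f n ω‖ₑ) P) {C : ℝ≥0∞} (hC : C ≠ ⊤)
    (h : ∀ᶠ n in atTop, ∫⁻ ω, ‖f n ω‖ₑ ^ 2 ∂P ≤ C) : BoundedInProb P f := by
  intro ε hε
  -- Markov's inequality bounds the tail at `M` by `C / M ^ 2`, eventually in `n`; it remains to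
  -- pick `M` with this at most `ε`.
  have ht : Tendsto (fun M : ℝ => C / ENNReal.ofReal M ^ 2) atTop (𝓝 0) := by
    have h1 : Tendsto (fun M : ℝ => ENNReal.ofReal M ^ 2) atTop (𝓝 ⊤) := by
      have := ((ENNReal.continuous_pow 2).tendsto ⊤).comp ENNReal.tendsto_ofReal_atTop
      rwa [ENNReal.top_pow two_ne_zero] at this
    simpa using ENNReal.Tendsto.const_div h1 (Or.inr hC)
  obtain ⟨M, hM, hle⟩ := ((eventually_gt_atTop (0 : ℝ)).and
    (ENNReal.tendsto_nhds_zero.1 ht ε hε)).exists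
  refine ⟨M, hM, ?_⟩
  filter_upwards [h] with n hn
  exact ((measure_norm_ge_le _ (hf n) hM).trans (ENNReal.div_le_div_right hn _)).trans hle

end InProbability

/-- A conditional form of Markov's inequality: if `T` and `Z` are independent, the tail of
`G (T, Z)` is controlled by the conditional expectation of `G (T, Z)` given `T`. -/
lemma measure_le_of_indepFun {Ω 𝒯 𝒵 : Type*} [MeasurableSpace Ω] [MeasurableSpace 𝒯]
    [MeasurableSpace 𝒵] {P : Measure Ω} [IsProbabilityMeasure P] {T : Ω → 𝒯} {Z : Ω → 𝒵}
    (hT : Measurable T) (hZ : Measurable Z) (hTZ : IndepFun T Z P) {G : 𝒯 × 𝒵 → ℝ≥0∞}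
    (hG : Measurable G) {δ κ : ℝ≥0∞} (hδ : δ ≠ 0) (hδ' : δ ≠ ⊤) :
    P {ω | δ ≤ G (T ω, Z ω)} ≤ P {ω | κ ≤ ∫⁻ ω', G (T ω, Z ω') ∂P} + κ / δ := by
  set K : 𝒯 → ℝ≥0∞ := fun t => ∫⁻ ω', G (t, Z ω') ∂P with hK
  have hKz : ∀ t, K t = ∫⁻ z, G (t, z) ∂(P.map Z) := fun t => by
    rw [lintegral_map (f := fun z => G (t, z)) (hG.comp measurable_prodMk_left) hZ]
  have hKm : Measurable K := by
    simp_rw [funext hKz]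
    exact hG.lintegral_prod_right'
  have hprod : P.map (fun ω => (T ω, Z ω)) = (P.map T).prod (P.map Z) :=
    (indepFun_iff_map_prod_eq_prod_map_map hT.aemeasurable hZ.aemeasurable).1 hTZ
  have hPZ : IsProbabilityMeasure (P.map Z) := Measure.isProbabilityMeasure_map hZ.aemeasurable
  have hPT : IsProbabilityMeasure (P.map T) := Measure.isProbabilityMeasure_map hT.aemeasurable
  -- The bad event that `G` is large although its conditional expectation is small. Under the
  -- product law each slice of `B` at fixed `t` is empty or has measure at most `κ / δ` by Markov's
  -- inequality.
  set B : Set (𝒯 × 𝒵) := {q | δ ≤ G q ∧ K q.1 < κ} with hBdef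
  have hB : MeasurableSet B :=
    (measurableSet_le measurable_const hG).inter
      (measurableSet_lt (hKm.comp measurable_fst) measurable_const)
  have hPB : P {ω | (T ω, Z ω) ∈ B} ≤ κ / δ := by
    have h1 : P {ω | (T ω, Z ω) ∈ B} = (P.map fun ω => (T ω, Z ω)) B := by
      rw [Measure.map_apply (hT.prodMk hZ) hB]; rfl
    rw [h1, hprod, Measure.prod_apply hB]
    calc ∫⁻ t, (P.map Z) (Prod.mk t ⁻¹' B) ∂(P.map T)
        ≤ ∫⁻ _, κ / δ ∂(P.map T) := by
          refine lintegral_mono fun t => ?_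
          by_cases ht : K t < κ
          · refine (measure_mono (t := {z | δ ≤ G (t, z)}) fun z hz => hz.1).trans ?_
            refine (meas_ge_le_lintegral_div
              (hG.comp measurable_prodMk_left).aemeasurable hδ hδ').trans ?_
            refine ENNReal.div_le_div_right ?_ _
            have := hKz t
            simp only [Function.comp_def]
            exact this ▸ ht.le
          · have : Prod.mk t ⁻¹' B = ∅ := by
              ext z; simp [hBdef, ht]
            simp [this]
      _ = κ / δ := by simp
  refine (measure_mono ?_).trans ((measure_union_le _ _).trans (add_le_add_right hPB _))
  intro ω hω
  by_cases h : κ ≤ K (T ω)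
  · exact Or.inl h
  · exact Or.inr ⟨hω, not_le.1 h⟩

/-! ### Averages of independent and identically distributed variables -/

/-- The average of `u i` over `i ∈ D`. -/
def avg {F : Type*} [AddCommGroup F] [Module ℝ F] (D : Finset ℕ) (u : ℕ → F) : F :=
  (D.card : ℝ)⁻¹ • ∑ i ∈ D, u i

section Avg

variable {F : Type*} [AddCommGroup F] [Module ℝ F]

lemma avg_add (D : Finset ℕ) (u v : ℕ → F) : avg D (fun i => u i + v i) = avg D u + avg D v := by
  simp [avg, Finset.sum_add_distrib, smul_add]

lemma avg_sub (D : Finset ℕ) (u v : ℕ → F) : avg D (fun i => u i - v i) = avg D u - avg D v := by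
  simp [avg, Finset.sum_sub_distrib, smul_sub]

lemma avg_smul (D : Finset ℕ) (c : ℝ) (u : ℕ → F) : avg D (fun i => c • u i) = c • avg D u := by
  simp [avg, ← Finset.smul_sum, smul_comm c]

lemma avg_congr {D : Finset ℕ} {u v : ℕ → F} (h : ∀ i ∈ D, u i = v i) : avg D u = avg D v := by
  rw [avg, avg, Finset.sum_congr rfl h]

lemma avg_const {D : Finset ℕ} (hD : D.Nonempty) (c : F) : avg D (fun _ => c) = c := by
  have : (D.card : ℝ) ≠ 0 := by simpa using hD.ne_empty
  rw [avg, Finset.sum_const, ← Nat.cast_smul_eq_nsmul ℝ, smul_smul, inv_mul_cancel₀ this, one_smul]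

lemma avg_eq_sum (D : Finset ℕ) (u : ℕ → F) : avg D u = ∑ i ∈ D, (D.card : ℝ)⁻¹ • u i :=
  Finset.smul_sum

lemma map_avg {G : Type*} [AddCommGroup G] [Module ℝ G] (f : F →ₗ[ℝ] G) (D : Finset ℕ)
    (u : ℕ → F) : f (avg D u) = avg D fun i => f (u i) := by
  simp [avg]

/-- The difference of two averages over disjoint sets is a weighted sum over their union. -/
lemma avg_sub_avg_eq_sum {D U : Finset ℕ} (hDU : Disjoint D U) (u : ℕ → F) :
    avg D u - avg U u
      = ∑ i ∈ D ∪ U, (if i ∈ D then (D.card : ℝ)⁻¹ else -(U.card : ℝ)⁻¹) • u i := by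
  rw [Finset.sum_union hDU, avg_eq_sum, avg_eq_sum, sub_eq_add_neg, ← Finset.sum_neg_distrib]
  congr 1
  · exact Finset.sum_congr rfl fun i hi => by simp [hi]
  · refine Finset.sum_congr rfl fun i hi => ?_
    simp [Finset.disjoint_right.1 hDU hi]

end Avg

/-- A constant has the same average over `D` and over `U`. Because these weights cancel, differences
of averages need no centring of the summands. -/
lemma sum_weights_eq_zero {D U : Finset ℕ} (hDU : Disjoint D U) (hD : D.Nonempty)
    (hU : U.Nonempty) :
    ∑ i ∈ D ∪ U, (if i ∈ D then (D.card : ℝ)⁻¹ else -(U.card : ℝ)⁻¹) = 0 := by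
  have h := avg_sub_avg_eq_sum hDU (fun _ => (1 : ℝ))
  rw [avg_const hD, avg_const hU] at h
  simpa using h.symm

/-- The variance factor of a two-sample difference. Empty sets are harmless, since the inverse of
zero is zero. -/
lemma sum_sq_weights {D U : Finset ℕ} (hDU : Disjoint D U) :
    ∑ i ∈ D ∪ U, (if i ∈ D then (D.card : ℝ)⁻¹ else -(U.card : ℝ)⁻¹) ^ 2
      = (D.card : ℝ)⁻¹ + (U.card : ℝ)⁻¹ := by
  have h : ∀ k : ℕ, (k : ℝ) * ((k : ℝ)⁻¹) ^ 2 = (k : ℝ)⁻¹ := fun k => by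
    rcases eq_or_ne (k : ℝ) 0 with hk | hk
    · simp [hk]
    · field_simp
  rw [Finset.sum_union hDU]
  congr 1
  · rw [Finset.sum_congr rfl fun i hi => by rw [if_pos hi], Finset.sum_const, nsmul_eq_mul, h]
  · rw [Finset.sum_congr rfl fun i hi => by
      rw [if_neg (Finset.disjoint_right.1 hDU hi), neg_sq], Finset.sum_const, nsmul_eq_mul, h]

lemma sum_sq_inv_card (D : Finset ℕ) : ∑ _i ∈ D, ((D.card : ℝ)⁻¹) ^ 2 = (D.card : ℝ)⁻¹ := by
  simpa using sum_sq_weights (D := D) (U := ∅) (by simp)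

/-- The variables `Z i` are independent with common law `μ`. -/
structure IsIID {Ω E : Type*} [MeasurableSpace Ω] [MeasurableSpace E] (P : Measure Ω)
    (Z : ℕ → Ω → E) (μ : Measure E) : Prop where
  measurable : ∀ i, Measurable (Z i)
  map_eq : ∀ i, P.map (Z i) = μ
  indep : iIndepFun Z P

section IID

variable {Ω E : Type*} [MeasurableSpace Ω] [MeasurableSpace E] {P : Measure Ω}
  {Z : ℕ → Ω → E} {μ : Measure E}

lemma IsIID.lintegral_comp (hZ : IsIID P Z μ) (i : ℕ) {h : E → ℝ≥0∞} (hh : Measurable h) :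
    ∫⁻ ω, h (Z i ω) ∂P = ∫⁻ z, h z ∂μ := by
  rw [← hZ.map_eq i, lintegral_map hh (hZ.measurable i)]

lemma IsIID.integral_comp {F : Type*} [NormedAddCommGroup F] [NormedSpace ℝ F]
    [MeasurableSpace F] [BorelSpace F] [SecondCountableTopology F]
    (hZ : IsIID P Z μ) (i : ℕ) {h : E → F} (hh : Measurable h) :
    ∫ ω, h (Z i ω) ∂P = ∫ z, h z ∂μ := by
  rw [← hZ.map_eq i, integral_map (hZ.measurable i).aemeasurable hh.aestronglyMeasurable]

lemma IsIID.memLp_comp {F : Type*} [NormedAddCommGroup F] (hZ : IsIID P Z μ) (i : ℕ) {h : E → F}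
    {q : ℝ≥0∞} (hh : MemLp h q μ) : MemLp (fun ω => h (Z i ω)) q P := by
  rw [← hZ.map_eq i] at hh
  exact hh.comp_of_map (hZ.measurable i).aemeasurable

lemma lintegral_enorm_sq_eq_ofReal {Ω : Type*} [MeasurableSpace Ω] {P : Measure Ω} {f : Ω → ℝ}
    (hf : MemLp f 2 P) :
    ∫⁻ ω, ‖f ω‖ₑ ^ 2 ∂P = ENNReal.ofReal (∫ ω, f ω ^ 2 ∂P) := by
  rw [ofReal_integral_eq_lintegral_ofReal hf.integrable_sq
    (Eventually.of_forall fun _ => sq_nonneg _)]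
  refine lintegral_congr fun ω => ?_
  rw [← ofReal_norm, ← ENNReal.ofReal_pow (norm_nonneg _), Real.norm_eq_abs, sq_abs]

variable [IsProbabilityMeasure P]

lemma IsIID.isProbabilityMeasure (hZ : IsIID P Z μ) : IsProbabilityMeasure μ :=
  hZ.map_eq 0 ▸ Measure.isProbabilityMeasure_map (hZ.measurable 0).aemeasurable

/-- Under either alternative in `hc` the sum has mean zero, so its second moment is its variance,
which by independence is `∑ c i ^ 2` times the variance of `h`. No integrability is assumed: the
later applications take for `h` a learnt function of which only measurability is known. -/
lemma IsIID.lintegral_sq_weighted_sum_real_le (hZ : IsIID P Z μ) {h : E → ℝ} (hm : Measurable h)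
    (S : Finset ℕ) (c : ℕ → ℝ) (hc : ∑ i ∈ S, c i = 0 ∨ ∫ z, h z ∂μ = 0) :
    ∫⁻ ω, ‖∑ i ∈ S, c i * h (Z i ω)‖ₑ ^ 2 ∂P
      ≤ ENNReal.ofReal (∑ i ∈ S, c i ^ 2) * ∫⁻ z, ‖h z‖ₑ ^ 2 ∂μ := by
  have := hZ.isProbabilityMeasure
  -- If all weights vanish the left side is zero; otherwise an infinite second moment makes the
  -- right side infinite. Only the square-integrable case has content.
  by_cases hc0 : ∑ i ∈ S, c i ^ 2 = 0
  · have hz : ∀ i ∈ S, c i = 0 := fun i hi => by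
      simpa using (Finset.sum_eq_zero_iff_of_nonneg fun i _ => sq_nonneg (c i)).1 hc0 i hi
    have : ∀ ω, ∑ i ∈ S, c i * h (Z i ω) = 0 := fun ω =>
      Finset.sum_eq_zero fun i hi => by rw [hz i hi, zero_mul]
    simp [this]
  have hcpos : 0 < ∑ i ∈ S, c i ^ 2 :=
    lt_of_le_of_ne (Finset.sum_nonneg fun _ _ => sq_nonneg _) (Ne.symm hc0)
  by_cases hfin : ∫⁻ z, ‖h z‖ₑ ^ 2 ∂μ = ⊤
  · rw [hfin, ENNReal.mul_top (by simpa using hcpos)]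
    exact le_top
  have hL : MemLp h 2 μ := by
    refine ⟨hm.aestronglyMeasurable, ?_⟩
    rw [eLpNorm_lt_top_iff_lintegral_rpow_enorm_lt_top (by norm_num) (by norm_num)]
    simpa using lt_top_iff_ne_top.2 hfin
  have hLi : ∀ i, MemLp (fun ω => c i * h (Z i ω)) 2 P := fun i =>
    (hZ.memLp_comp i hL).const_mul (c i)
  have hsum : MemLp (fun ω => ∑ i ∈ S, c i * h (Z i ω)) 2 P :=
    memLp_finsetSum _ fun i _ => hLi i
  have hmean : ∫ ω, ∑ i ∈ S, c i * h (Z i ω) ∂P = 0 := by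
    rw [integral_finsetSum _ fun i _ => (hLi i).integrable (by norm_num)]
    simp_rw [integral_const_mul, hZ.integral_comp _ hm, ← Finset.sum_mul]
    rcases hc with hc | hc <;> simp [hc]
  have hvar : Var[fun ω => ∑ i ∈ S, c i * h (Z i ω); P] = (∑ i ∈ S, c i ^ 2) * Var[h; μ] := by
    have h1 : (fun ω => ∑ i ∈ S, c i * h (Z i ω)) = ∑ i ∈ S, fun ω => c i * h (Z i ω) := by
      ext ω; simp
    rw [h1, IndepFun.variance_sum (fun i _ => hLi i), Finset.sum_mul]
    · refine Finset.sum_congr rfl fun i _ => ?_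
      rw [variance_const_mul]
      congr 1
      rw [← hZ.map_eq i, variance_map hm.aemeasurable (hZ.measurable i).aemeasurable]
      rfl
    · intro i _ j _ hij
      exact (hZ.indep.indepFun hij).comp (hm.const_mul (c i)) (hm.const_mul (c j))
  have hle : ∫ ω, (∑ i ∈ S, c i * h (Z i ω)) ^ 2 ∂P ≤ (∑ i ∈ S, c i ^ 2) * ∫ z, h z ^ 2 ∂μ := by
    have h1 := variance_eq_sub hsum
    simp only [Pi.pow_apply, hmean] at h1
    have h2 := variance_eq_sub hL
    simp only [Pi.pow_apply] at h2
    have h3 : Var[h; μ] ≤ ∫ z, h z ^ 2 ∂μ := by rw [h2]; nlinarith [sq_nonneg (∫ z, h z ∂μ)]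
    have h4 := mul_le_mul_of_nonneg_left h3 hcpos.le
    rw [← hvar, h1] at h4
    linarith
  rw [lintegral_enorm_sq_eq_ofReal hsum, lintegral_enorm_sq_eq_ofReal hL,
    ← ENNReal.ofReal_mul hcpos.le]
  exact ENNReal.ofReal_le_ofReal hle

lemma enorm_sq_eq_sum {d : ℕ} (v : Vec d) : ‖v‖ₑ ^ 2 = ∑ j, ‖v j‖ₑ ^ 2 := by
  have h := EuclideanSpace.real_norm_sq_eq v
  simp_rw [← ofReal_norm, ← ENNReal.ofReal_pow (norm_nonneg _), h]
  rw [ENNReal.ofReal_sum_of_nonneg fun _ _ => sq_nonneg _]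
  simp

/-- A weighted sum of independent variables has small second moment if its mean is zero. -/
lemma IsIID.lintegral_sq_weighted_sum_le {d : ℕ} (hZ : IsIID P Z μ) {h : E → Vec d}
    (hm : Measurable h) (S : Finset ℕ) (c : ℕ → ℝ)
    (hc : ∑ i ∈ S, c i = 0 ∨ ∀ j, ∫ z, h z j ∂μ = 0) :
    ∫⁻ ω, ‖∑ i ∈ S, c i • h (Z i ω)‖ₑ ^ 2 ∂P
      ≤ ENNReal.ofReal (∑ i ∈ S, c i ^ 2) * ∫⁻ z, ‖h z‖ₑ ^ 2 ∂μ := by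
  have hmj : ∀ j, Measurable fun z => h z j := fun j => by fun_prop
  have hZm := hZ.measurable
  simp_rw [enorm_sq_eq_sum]
  rw [lintegral_finsetSum _ fun j _ => by fun_prop, lintegral_finsetSum _ fun j _ => by fun_prop,
    Finset.mul_sum]
  refine Finset.sum_le_sum fun j _ => ?_
  simpa using hZ.lintegral_sq_weighted_sum_real_le (hmj j) S c (hc.imp_right fun h => h j)

/-- The weak law of large numbers, for averages over arbitrary sets of growing size. -/
lemma IsIID.tendstoInMeasure_avg (hZ : IsIID P Z μ) {h : E → ℝ} (hm : Measurable h)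
    (hL : MemLp h 2 μ) {S : ℕ → Finset ℕ} (hS : Tendsto (fun n => (S n).card) atTop atTop) :
    TendstoInMeasure P (fun n ω => avg (S n) fun i => h (Z i ω)) atTop fun _ => ∫ z, h z ∂μ := by
  have := hZ.isProbabilityMeasure
  have hZm := hZ.measurable
  set m := ∫ z, h z ∂μ with hmdef
  have hL' : MemLp (fun z => h z - m) 2 μ := hL.sub (memLp_const m)
  have hcen : ∫ z, (h z - m) ∂μ = 0 := by
    rw [integral_sub (hL.integrable (by norm_num)) (integrable_const _)]
    simp [hmdef]
  refine negligible_sub_const_iff.1 ?_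
  have hneg : Negligible P fun n ω => ∑ i ∈ S n, ((S n).card : ℝ)⁻¹ * (h (Z i ω) - m) := by
    refine negligible_of_lintegral_sq (fun n => by fun_prop) ?_
    have hbound : Tendsto (fun n => ENNReal.ofReal (((S n).card : ℝ)⁻¹)
        * ∫⁻ z, ‖h z - m‖ₑ ^ 2 ∂μ) atTop (𝓝 0) := by
      have h1 : Tendsto (fun n => ENNReal.ofReal (((S n).card : ℝ)⁻¹)) atTop (𝓝 0) := by
        have h2 := tendsto_inv_atTop_zero.comp (tendsto_natCast_atTop_atTop (R := ℝ)|>.comp hS)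
        simpa using ENNReal.tendsto_ofReal h2
      have h3 := ENNReal.Tendsto.mul_const (b := ∫⁻ z, ‖h z - m‖ₑ ^ 2 ∂μ) h1
        (Or.inr (by rw [lintegral_enorm_sq_eq_ofReal hL']; exact ENNReal.ofReal_ne_top))
      simpa using h3
    refine tendsto_of_tendsto_of_tendsto_of_le_of_le tendsto_const_nhds hbound
      (fun _ => zero_le) fun n => ?_
    have := hZ.lintegral_sq_weighted_sum_real_le (hm.sub_const m) (S n)
      (fun _ => ((S n).card : ℝ)⁻¹) (Or.inr hcen)
    rwa [sum_sq_inv_card] at this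
  refine hneg.congr ?_
  filter_upwards [hS.eventually_gt_atTop 0] with n hn ω
  have h1 := avg_sub (S n) (fun i => h (Z i ω)) (fun _ => m)
  rw [avg_const (Finset.card_pos.1 hn) m, avg_eq_sum] at h1
  rw [← h1]
  simp

/-- A centred weighted sum is bounded in probability at the scale of its weights. -/
lemma IsIID.boundedInProb_weighted_sum {d : ℕ} (hZ : IsIID P Z μ) {h : E → Vec d}
    (hm : Measurable h) (hL : MemLp h 2 μ) {S : ℕ → Finset ℕ} {c : ℕ → ℕ → ℝ}
    (hc : ∀ᶠ n in atTop, ∑ i ∈ S n, c n i = 0 ∨ ∀ j, ∫ z, h z j ∂μ = 0) {C : ℝ}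
    (hC : ∀ᶠ n : ℕ in atTop, (n : ℝ) * ∑ i ∈ S n, c n i ^ 2 ≤ C) :
    BoundedInProb P fun n ω => √(n : ℝ) • ∑ i ∈ S n, c n i • h (Z i ω) := by
  have hZm := hZ.measurable
  have hfin : ∫⁻ z, ‖h z‖ₑ ^ 2 ∂μ ≠ ⊤ := by
    have := (eLpNorm_lt_top_iff_lintegral_rpow_enorm_lt_top (by norm_num) (by norm_num)).1 hL.2
    simpa using this.ne
  refine boundedInProb_of_lintegral_sq_le (C := ENNReal.ofReal C * ∫⁻ z, ‖h z‖ₑ ^ 2 ∂μ)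
    (fun n => by fun_prop) (by finiteness) ?_
  filter_upwards [hc, hC] with n hc hC
  have h1 := hZ.lintegral_sq_weighted_sum_le hm (S n) (c n) hc
  simp_rw [enorm_smul, mul_pow]
  rw [lintegral_const_mul _ (by fun_prop)]
  have h2 : ‖√(n : ℝ)‖ₑ ^ 2 = ENNReal.ofReal n := by
    rw [← ofReal_norm, ← ENNReal.ofReal_pow (norm_nonneg _), Real.norm_eq_abs, sq_abs,
      Real.sq_sqrt (Nat.cast_nonneg n)]
  rw [h2]
  refine (mul_le_mul_right h1 _).trans ?_
  rw [← mul_assoc, ← ENNReal.ofReal_mul (Nat.cast_nonneg n)]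
  exact mul_le_mul_left (ENNReal.ofReal_le_ofReal hC) _

end IID

/-! ### A two-sample central limit theorem -/

lemma labeled_disjoint_unlabeled (n N : ℕ) : Disjoint (labeled n) (unlabeled n N) := by
  rw [Finset.disjoint_left]
  intro i hi hi'
  simp only [labeled, unlabeled, Finset.mem_range, Finset.mem_Ico] at hi hi'
  omega

lemma card_labeled (n : ℕ) : (labeled n).card = n := by simp [labeled]

lemma card_unlabeled (n N : ℕ) : (unlabeled n N).card = N := by simp [unlabeled]

/-- Finiteness of `r` is what matters: eventually `n ≤ (r + 1) * N n`. -/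
lemma tendsto_atTop_of_ratio {N : ℕ → ℕ} (hN : ∀ n, 0 < N n) {r : ℝ}
    (hr : Tendsto (fun n : ℕ => (n : ℝ) / N n) atTop (𝓝 r)) : Tendsto N atTop atTop := by
  have hr0 : 0 ≤ r := ge_of_tendsto' hr fun n => by positivity
  have h1 : ∀ᶠ n : ℕ in atTop, (n : ℝ) ≤ (r + 1) * N n := by
    filter_upwards [hr.eventually (gt_mem_nhds (lt_add_one r))] with n hn
    have : (0 : ℝ) < N n := by exact_mod_cast hN n
    rw [div_lt_iff₀ this] at hn
    exact hn.le
  have h2 : Tendsto (fun n : ℕ => (r + 1) * (N n : ℝ)) atTop atTop :=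
    tendsto_atTop_mono' _ h1 tendsto_natCast_atTop_atTop
  exact tendsto_natCast_atTop_iff.1 ((tendsto_const_mul_atTop_of_pos (by positivity)).1 h2)

section CLT

variable {Ω E : Type*} [MeasurableSpace Ω] [MeasurableSpace E] {P : Measure Ω}
  {Z : ℕ → Ω → E} {μ : Measure E}

lemma IsIID.comp {E' : Type*} [MeasurableSpace E'] (hZ : IsIID P Z μ) {a : E → E'}
    (ha : Measurable a) : IsIID P (fun i ω => a (Z i ω)) (μ.map a) where
  measurable i := ha.comp (hZ.measurable i)
  map_eq i := by
    rw [← hZ.map_eq i, Measure.map_map ha (hZ.measurable i)]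
    rfl
  indep := hZ.indep.comp (fun _ => a) fun _ => ha

/-- The Cramér–Wold device: a vector-valued limit theorem reduces to real projections evaluated at
`1`. -/
lemma charFun_map_eq_charFun_map_inner {F : Type*} [NormedAddCommGroup F]
    [InnerProductSpace ℝ F] [MeasurableSpace F] [BorelSpace F] [SecondCountableTopology F]
    {f : Ω → F} (hf : AEMeasurable f P) (t : F) :
    charFun (P.map f) t = charFun (P.map fun ω => inner ℝ (f ω) t) 1 := by
  rw [charFun_apply, charFun_apply_real, integral_map hf (by fun_prop),
    integral_map (by fun_prop) (by fun_prop)]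
  simp

/-- The right side depends on `S` only through its cardinality. This carries the central limit
theorem from initial segments to arbitrary index sets, in particular to the unlabeled block, which
moves with `n`. -/
lemma IsIID.charFun_map_mul_sum {ξ : ℕ → Ω → ℝ} {ν : Measure ℝ} (hξ : IsIID P ξ ν)
    (S : Finset ℕ) (s t : ℝ) :
    charFun (P.map fun ω => s * ∑ i ∈ S, ξ i ω) t = charFun ν (s * t) ^ S.card := by
  have hm := hξ.measurable
  rw [charFun_map_mul_comp (by fun_prop),
    (hξ.indep.restrict S).charFun_map_fun_finsetSum_eq_prod fun i _ => (hm i).aemeasurable]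
  simp [hξ.map_eq]

variable [IsProbabilityMeasure P]

/-- Convergence of the characteristic functions of normalized sums, along varying arguments. -/
lemma IsIID.tendsto_charFun_normalized_sum {ξ : ℕ → Ω → ℝ} {ν : Measure ℝ} (hξ : IsIID P ξ ν)
    (hL : MemLp (ξ 0) 2 P) (h0 : ∫ ω, ξ 0 ω ∂P = 0) {S : ℕ → Finset ℕ}
    (hS : Tendsto (fun n => (S n).card) atTop atTop) {s : ℕ → ℝ} {s₀ : ℝ}
    (hs : Tendsto s atTop (𝓝 s₀)) :
    Tendsto (fun n => charFun (P.map fun ω => (s n * (√((S n).card : ℝ))⁻¹) * ∑ i ∈ S n, ξ i ω) 1)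
      atTop (𝓝 (Complex.exp (-(Var[ξ 0; P] * s₀ ^ 2 / 2 : ℝ)))) := by
  have hm := hξ.measurable
  set v : ℝ≥0 := Var[ξ 0; P].toNNReal with hv
  have hident : ∀ i, IdentDistrib (ξ i) (ξ 0) P P := fun i =>
    ⟨(hm i).aemeasurable, (hm 0).aemeasurable, by rw [hξ.map_eq, hξ.map_eq]⟩
  have hclt := tendstoInDistribution_inv_sqrt_mul_sum_sub (P := P) (P' := gaussianReal 0 v)
    (Y := id) ⟨aemeasurable_id, by simp [hv]⟩ hL hξ.indep hident
  simp only [h0, mul_zero, sub_zero] at hclt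
  have hclt' : TendstoInDistribution
      (fun (n : ℕ) ω => (√((S n).card : ℝ))⁻¹ * ∑ k ∈ Finset.range (S n).card, ξ k ω) atTop
      (id : ℝ → ℝ) (fun _ => P) (gaussianReal 0 v) :=
    ⟨fun n => hclt.forall_aemeasurable _, hclt.aemeasurable_limit, hclt.tendsto.comp hS⟩
  -- Slutsky's theorem for the deterministic factor `s n → s₀`.
  have hsl := hclt'.continuous_comp_prodMk_of_tendstoInMeasure_const
    (g := fun q : ℝ × ℝ => q.2 * q.1) (by fun_prop)
    (tendstoInMeasure_const_of_tendsto hs) (fun _ => by fun_prop)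
  have hch := ProbabilityMeasure.tendsto_iff_tendsto_charFun.1 hsl.tendsto 1
  have hlim : charFun ((gaussianReal 0 v).map fun ω : ℝ => s₀ * id ω) 1
      = Complex.exp (-(Var[ξ 0; P] * s₀ ^ 2 / 2 : ℝ)) := by
    rw [charFun_map_mul_comp aemeasurable_id, Measure.map_id, charFun_gaussianReal]
    have : ((v : ℝ≥0) : ℝ) = Var[ξ 0; P] := Real.coe_toNNReal _ (variance_nonneg _ _)
    congr 1
    rw [← this]
    push_cast
    ring
  simp only [ProbabilityMeasure.coe_mk] at hch
  rw [hlim] at hch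
  refine hch.congr fun n => ?_
  -- The sums over `S n` and over the initial segment of the same length have equal characteristic
  -- functions.
  have h1 := hξ.charFun_map_mul_sum (S n) (s n * (√((S n).card : ℝ))⁻¹) 1
  have h2 := hξ.charFun_map_mul_sum (Finset.range (S n).card) (s n * (√((S n).card : ℝ))⁻¹) 1
  rw [Finset.card_range] at h2
  rw [h1, ← h2]
  simp only [mul_assoc]

/-- The two-sample central limit theorem on the level of characteristic functions. -/
lemma IsIID.tendsto_charFun_two_sample (hZ : IsIID P Z μ) {a b : E → ℝ} (ham : Measurable a)
    (hbm : Measurable b) (ha : MemLp a 2 μ) (hb : MemLp b 2 μ) (ha0 : ∫ z, a z ∂μ = 0)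
    (hb0 : ∫ z, b z ∂μ = 0) {N : ℕ → ℕ} (hN : ∀ n, 0 < N n) {r : ℝ}
    (hr : Tendsto (fun n : ℕ => (n : ℝ) / N n) atTop (𝓝 r)) :
    Tendsto (fun n : ℕ => charFun (P.map fun ω => √(n : ℝ) * avg (labeled n) (fun i => a (Z i ω))
      + √(n : ℝ) * avg (unlabeled n (N n)) (fun i => b (Z i ω))) 1)
      atTop (𝓝 (Complex.exp (-((Var[a; μ] + r * Var[b; μ]) / 2 : ℝ)))) := by
  have hZm := hZ.measurable
  have hr0 : 0 ≤ r := ge_of_tendsto' hr fun n => by positivity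
  have hNtop := tendsto_atTop_of_ratio hN hr
  have hvar : ∀ {c : E → ℝ}, Measurable c → Var[fun ω => c (Z 0 ω); P] = Var[c; μ] := by
    intro c hc
    rw [← hZ.map_eq 0, variance_map hc.aemeasurable (hZm 0).aemeasurable]
    rfl
  have hA := (hZ.comp ham).tendsto_charFun_normalized_sum (hZ.memLp_comp 0 ha)
    (by rw [hZ.integral_comp 0 ham, ha0]) (S := labeled) (by simp only [card_labeled]; exact tendsto_id)
    (s := fun _ => 1) tendsto_const_nhds
  -- The unlabeled average is scaled by √n / N = √(n / N) · N^(-1/2), so the extra factor tends to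
  -- √r. This is the source of the weight `r` on the second variance.
  have hB := (hZ.comp hbm).tendsto_charFun_normalized_sum (hZ.memLp_comp 0 hb)
    (by rw [hZ.integral_comp 0 hbm, hb0]) (S := fun n => unlabeled n (N n))
    (by simpa only [card_unlabeled] using hNtop)
    (s := fun n : ℕ => √((n : ℝ) / N n)) ((Real.continuous_sqrt.tendsto r).comp hr)
  have hAB := hA.mul hB
  rw [← Complex.exp_add, hvar ham, hvar hbm, Real.sq_sqrt hr0] at hAB
  have hlim : (-((Var[a; μ] * 1 ^ 2 / 2 : ℝ) : ℂ) + -((Var[b; μ] * r / 2 : ℝ) : ℂ))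
      = (-((Var[a; μ] + r * Var[b; μ]) / 2 : ℝ) : ℂ) := by
    push_cast; ring
  rw [hlim] at hAB
  refine hAB.congr' ?_
  filter_upwards [eventually_gt_atTop 0] with n hn
  have hdisj := labeled_disjoint_unlabeled n (N n)
  have hind : IndepFun (fun ω => √(n : ℝ) * avg (labeled n) (fun i => a (Z i ω)))
      (fun ω => √(n : ℝ) * avg (unlabeled n (N n)) (fun i => b (Z i ω))) P := by
    have h := hZ.indep.indepFun_finset _ _ hdisj hZm
    have h2 := h.comp
      (φ := fun z : labeled n → E => √(n : ℝ) * (((labeled n).card : ℝ)⁻¹ * ∑ i, a (z i)))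
      (ψ := fun z : unlabeled n (N n) → E =>
        √(n : ℝ) * (((unlabeled n (N n)).card : ℝ)⁻¹ * ∑ i, b (z i)))
      (by fun_prop) (by fun_prop)
    convert h2 using 1
    · ext ω
      simp only [avg, smul_eq_mul, Function.comp_apply]
      rw [Finset.sum_coe_sort (labeled n) fun i => a (Z i ω)]
    · ext ω
      simp only [avg, smul_eq_mul, Function.comp_apply]
      rw [Finset.sum_coe_sort (unlabeled n (N n)) fun i => b (Z i ω)]
  rw [hind.charFun_map_fun_add_eq_mul (by unfold avg; fun_prop) (by unfold avg; fun_prop),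
    Pi.mul_apply]
  have hn' : (0 : ℝ) < n := by exact_mod_cast hn
  have hN' : (0 : ℝ) < N n := by exact_mod_cast hN n
  congr 4
  · ext ω
    rw [avg, card_labeled, smul_eq_mul, ← mul_assoc]
    congr 1
    rw [one_mul, ← div_eq_mul_inv, Real.sqrt_div_self]
  · ext ω
    rw [avg, card_unlabeled, smul_eq_mul, ← mul_assoc]
    congr 1
    rw [Real.sqrt_div hn'.le, div_mul_eq_mul_div, ← div_eq_mul_inv, div_div,
      Real.mul_self_sqrt hN'.le, div_eq_mul_inv]

/-- **Two-sample central limit theorem** for prediction-powered averages. -/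
theorem IsIID.tendstoInDistribution_two_sample {d : ℕ} (hZ : IsIID P Z μ) {f g : E → Vec d}
    (hfm : Measurable f) (hgm : Measurable g) (hf : MemLp f 2 μ) (hg : MemLp g 2 μ)
    (hf0 : ∫ z, f z ∂μ = 0) {N : ℕ → ℕ} (hN : ∀ n, 0 < N n) {r : ℝ}
    (hr : Tendsto (fun n : ℕ => (n : ℝ) / N n) atTop (𝓝 r)) (lam : ℝ)
    {V : Matrix (Fin d) (Fin d) ℝ} (hV : V.PosSemidef)
    (hVt : ∀ t : Vec d, t.ofLp ⬝ᵥ V *ᵥ t.ofLp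
      = Var[fun z => inner ℝ (f z - lam • g z) t; μ] + r * Var[fun z => inner ℝ (lam • g z) t; μ]) :
    TendstoInDistribution (fun (n : ℕ) ω => √(n : ℝ) • (avg (labeled n) (fun i => f (Z i ω))
        - lam • (avg (labeled n) (fun i => g (Z i ω))
          - avg (unlabeled n (N n)) (fun i => g (Z i ω)))))
      atTop (id : Vec d → Vec d) (fun _ => P) (multivariateGaussian 0 V) := by
  have := hZ.isProbabilityMeasure
  have hZm := hZ.measurable
  have hmeas : ∀ n : ℕ, Measurable fun ω => √(n : ℝ) • (avg (labeled n) (fun i => f (Z i ω))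
        - lam • (avg (labeled n) (fun i => g (Z i ω))
          - avg (unlabeled n (N n)) (fun i => g (Z i ω)))) := fun n => by
    unfold avg; fun_prop
  refine ⟨fun n => (hmeas n).aemeasurable, aemeasurable_id, ?_⟩
  refine ProbabilityMeasure.tendsto_iff_tendsto_charFun.2 fun t => ?_
  simp only [ProbabilityMeasure.coe_mk, Measure.map_id, charFun_multivariateGaussian hV, hVt]
  -- `g` need not be centred. The labeled summand has mean `-m` and the unlabeled one mean `m`; both
  -- are centred below, and the two corrections cancel in the sum once both samples are nonempty.
  set m : ℝ := ∫ z, inner ℝ (lam • g z) t ∂μ with hm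
  have hgi : MemLp (fun z => inner ℝ (lam • g z) t) 2 μ := (hg.const_smul lam).inner_const t
  have hfi : MemLp (fun z => inner ℝ (f z - lam • g z) t) 2 μ :=
    (hf.sub (hg.const_smul lam)).inner_const t
  have hcen : ∫ z, inner ℝ (f z - lam • g z) t ∂μ = -m := by
    simp_rw [inner_sub_left]
    have hfint := hf.integrable (by norm_num)
    rw [integral_sub ((hf.inner_const t).integrable (by norm_num)) (hgi.integrable (by norm_num))]
    have : ∫ z, inner ℝ (f z) t ∂μ = 0 := by
      simp_rw [real_inner_comm t]
      rw [integral_inner hfint, hf0, inner_zero_right]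
    rw [this, zero_sub]
  have h := hZ.tendsto_charFun_two_sample (a := fun z => inner ℝ (f z - lam • g z) t + m)
    (b := fun z => inner ℝ (lam • g z) t - m) (by fun_prop) (by fun_prop)
    (hfi.add (memLp_const m)) (hgi.sub (memLp_const m))
    (by rw [integral_add (hfi.integrable (by norm_num)) (integrable_const _), hcen]; simp)
    (by rw [integral_sub (hgi.integrable (by norm_num)) (integrable_const _), ← hm]; simp)
    hN hr
  rw [variance_add_const (by fun_prop), variance_sub_const (by fun_prop)] at h
  convert h.congr' ?_ using 2
  · simp
  · filter_upwards [eventually_gt_atTop 0] with n hn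
    rw [charFun_map_eq_charFun_map_inner (hmeas n).aemeasurable]
    congr 2
    ext ω
    have hL : (labeled n).Nonempty := by simpa [labeled] using hn.ne'
    have hU : (unlabeled n (N n)).Nonempty := by simpa [unlabeled] using hN n
    have hin : ∀ (D : Finset ℕ) (u : ℕ → Vec d),
        inner ℝ (avg D u) t = avg D fun i => inner ℝ (u i) t := fun D u => by
      simp [avg, sum_inner, inner_smul_left]
    simp only [inner_smul_left, inner_sub_left, hin, avg_sub, avg_add, avg_const hL,
      avg_const hU, ← smul_eq_mul, avg_smul]
    simp
    ring

end CLT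

/-! ### Moments of Gaussian vectors -/

/-- All moments of `f` are finite. -/
def AllMoments {E F : Type*} [MeasurableSpace E] [NormedAddCommGroup F] (f : E → F)
    (μ : Measure E) : Prop :=
  ∀ q : ℝ≥0∞, q ≠ ⊤ → MemLp f q μ

section AllMoments

variable {E E' F : Type*} [MeasurableSpace E] [MeasurableSpace E'] [NormedAddCommGroup F]
  {μ : Measure E} {ν : Measure E'}

lemma AllMoments.memLp_two {f : E → F} (hf : AllMoments f μ) : MemLp f 2 μ := hf 2 (by norm_num)

lemma AllMoments.integrable {f : E → F} (hf : AllMoments f μ) : Integrable f μ :=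
  memLp_one_iff_integrable.1 (hf 1 (by norm_num))

lemma AllMoments.add {f g : E → F} (hf : AllMoments f μ) (hg : AllMoments g μ) :
    AllMoments (fun z => f z + g z) μ := fun q hq => (hf q hq).add (hg q hq)

lemma AllMoments.sub {f g : E → F} (hf : AllMoments f μ) (hg : AllMoments g μ) :
    AllMoments (fun z => f z - g z) μ := fun q hq => (hf q hq).sub (hg q hq)

lemma AllMoments.norm {f : E → F} (hf : AllMoments f μ) : AllMoments (fun z => ‖f z‖) μ :=
  fun q hq => (hf q hq).norm

lemma AllMoments.comp_fst [IsFiniteMeasure ν] {f : E → F} (hf : AllMoments f μ) :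
    AllMoments (fun z : E × E' => f z.1) (μ.prod ν) := fun q hq => (hf q hq).comp_fst ν

lemma AllMoments.comp_snd [SFinite ν] [IsFiniteMeasure μ] {f : E' → F} (hf : AllMoments f ν) :
    AllMoments (fun z : E × E' => f z.2) (μ.prod ν) := fun q hq => (hf q hq).comp_snd μ

variable [NormedSpace ℝ F]

/-- Hölder's inequality with exponents `2 * q`, `2 * q`. Closure under products is the reason for
working with all moments: the integrands below are polynomials in Gaussian variables. -/
lemma AllMoments.smul {f : E → ℝ} {g : E → F} (hf : AllMoments f μ) (hg : AllMoments g μ) :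
    AllMoments (fun z => f z • g z) μ := fun q hq => by
  have h2 : 2 * q ≠ ⊤ := ENNReal.mul_ne_top (by norm_num) hq
  have : ENNReal.HolderTriple (2 * q) (2 * q) q := ⟨by
    rw [ENNReal.mul_inv (by simp) (by simp), ← add_mul, ENNReal.inv_two_add_inv_two, one_mul]⟩
  exact (hg _ h2).smul (hf _ h2)

lemma AllMoments.mul {f g : E → ℝ} (hf : AllMoments f μ) (hg : AllMoments g μ) :
    AllMoments (fun z => f z * g z) μ := hf.smul hg

lemma AllMoments.const_smul {g : E → F} (c : ℝ) (hg : AllMoments g μ) :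
    AllMoments (fun z => c • g z) μ := fun q hq => (hg q hq).const_smul c

lemma AllMoments.const_mul {g : E → ℝ} (c : ℝ) (hg : AllMoments g μ) :
    AllMoments (fun z => c * g z) μ := hg.const_smul c

lemma AllMoments.clm_comp {G : Type*} [NormedAddCommGroup G] [NormedSpace ℝ G] {f : E → F}
    (hf : AllMoments f μ) (L : F →L[ℝ] G) : AllMoments (fun z => L (f z)) μ :=
  fun q hq => L.comp_memLp' (hf q hq)

lemma AllMoments.coord {d : ℕ} {f : E → Vec d} (hf : AllMoments f μ) (a : Fin d) :
    AllMoments (fun z => f z a) μ := hf.clm_comp (EuclideanSpace.proj a)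

lemma AllMoments.inner_const {d : ℕ} {f : E → Vec d} (hf : AllMoments f μ) (v : Vec d) :
    AllMoments (fun z => inner ℝ (f z) v) μ := fun q hq => (hf q hq).inner_const v

end AllMoments

/-- The fourth derivative of the Gaussian moment generating function. `key` differentiates a cubic
polynomial times the exponential; the successive polynomial factors are v t, v + v² t² and 3 v² t +
v³ t³, and the linear coefficient of the last is the value sought. -/
lemma iteratedDeriv_four_exp_sq (v : ℝ) :
    iteratedDeriv 4 (fun t : ℝ => Real.exp (v * t ^ 2 / 2)) 0 = 3 * v ^ 2 := by
  have key : ∀ a b c e : ℝ,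
      deriv (fun t => (a + b * t + c * t ^ 2 + e * t ^ 3) * Real.exp (v * t ^ 2 / 2))
        = fun t => (b + 2 * c * t + 3 * e * t ^ 2
          + (a + b * t + c * t ^ 2 + e * t ^ 3) * (v * t)) * Real.exp (v * t ^ 2 / 2) := by
    intro a b c e
    ext t
    have hE : HasDerivAt (fun t : ℝ => Real.exp (v * t ^ 2 / 2))
        (Real.exp (v * t ^ 2 / 2) * (v * t)) t := by
      have h := ((hasDerivAt_pow 2 t).const_mul v).div_const 2
      exact (h.congr_deriv (by push_cast; ring)).exp
    have hp : HasDerivAt (fun t : ℝ => a + b * t + c * t ^ 2 + e * t ^ 3)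
        (b + 2 * c * t + 3 * e * t ^ 2) t := by
      have h := ((((hasDerivAt_id' t).const_mul b).const_add a).add
        ((hasDerivAt_pow 2 t).const_mul c)).add ((hasDerivAt_pow 3 t).const_mul e)
      exact h.congr_deriv (by push_cast; ring)
    have h := (hp.mul hE).deriv
    refine Eq.trans ?_ (h.trans ?_)
    · rfl
    · ring
  have h1 : deriv (fun t : ℝ => Real.exp (v * t ^ 2 / 2))
      = fun t => (0 + v * t + 0 * t ^ 2 + 0 * t ^ 3) * Real.exp (v * t ^ 2 / 2) := by
    have h := key 1 0 0 0
    simp only [zero_mul, add_zero, one_mul, mul_zero, zero_add] at h ⊢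
    exact h
  have h2 : deriv (fun t => (0 + v * t + 0 * t ^ 2 + 0 * t ^ 3) * Real.exp (v * t ^ 2 / 2))
      = fun t => (v + 0 * t + v ^ 2 * t ^ 2 + 0 * t ^ 3) * Real.exp (v * t ^ 2 / 2) := by
    rw [key]; ext t; ring
  have h3 : deriv (fun t => (v + 0 * t + v ^ 2 * t ^ 2 + 0 * t ^ 3) * Real.exp (v * t ^ 2 / 2))
      = fun t => (0 + 3 * v ^ 2 * t + 0 * t ^ 2 + v ^ 3 * t ^ 3) * Real.exp (v * t ^ 2 / 2) := by
    rw [key]; ext t; ring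
  rw [iteratedDeriv_succ, iteratedDeriv_succ, iteratedDeriv_succ, iteratedDeriv_one, h1, h2, h3,
    key]
  simp

lemma integral_pow_four_gaussianReal (v : ℝ≥0) : ∫ x, x ^ 4 ∂(gaussianReal 0 v) = 3 * v ^ 2 := by
  have h := iteratedDeriv_mgf_zero (X := id) (μ := gaussianReal 0 v)
    (by simp [integrableExpSet_id_gaussianReal]) 4
  rw [mgf_id_gaussianReal] at h
  simp only [zero_mul, zero_add] at h
  rw [iteratedDeriv_four_exp_sq] at h
  simpa using h.symm

lemma allMoments_id_of_isGaussian {F : Type*} [NormedAddCommGroup F] [NormedSpace ℝ F]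
    [MeasurableSpace F] [BorelSpace F] [CompleteSpace F] [SecondCountableTopology F]
    (μ : Measure F) [IsGaussian μ] :
    AllMoments (fun x : F => x) μ := fun q hq => IsGaussian.memLp_id μ q hq

section MultivariateGaussian

variable {d : ℕ} {S : Matrix (Fin d) (Fin d) ℝ}

lemma allMoments_inner_multivariateGaussian (v : Vec d) :
    AllMoments (fun x : Vec d => inner ℝ x v) (multivariateGaussian 0 S) :=
  (allMoments_id_of_isGaussian _).inner_const v

lemma integral_inner_multivariateGaussian (v : Vec d) :
    ∫ x, inner ℝ x v ∂(multivariateGaussian 0 S) = 0 := by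
  simp_rw [real_inner_comm v]
  rw [integral_inner (allMoments_id_of_isGaussian _).integrable]
  simp

lemma integral_inner_mul_inner_multivariateGaussian (hS : S.PosSemidef) (u v : Vec d) :
    ∫ x, inner ℝ x u * inner ℝ x v ∂(multivariateGaussian 0 S) = u.ofLp ⬝ᵥ S *ᵥ v.ofLp := by
  rw [← covarianceBilin_multivariateGaussian (μ := 0) hS,
    covarianceBilin_apply_eq_cov IsGaussian.memLp_two_id,
    covariance_eq_sub]
  · simp_rw [real_inner_comm _ u, real_inner_comm _ v]
    simp [integral_inner_multivariateGaussian]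
  · simp_rw [real_inner_comm _ u]
    exact (allMoments_inner_multivariateGaussian u).memLp_two
  · simp_rw [real_inner_comm _ v]
    exact (allMoments_inner_multivariateGaussian v).memLp_two

lemma quadForm_nonneg (hS : S.PosSemidef) (v : Vec d) : 0 ≤ quadForm S v := by
  simpa [quadForm] using hS.dotProduct_mulVec_nonneg v.ofLp

lemma map_inner_multivariateGaussian (hS : S.PosSemidef) (v : Vec d) :
    (multivariateGaussian 0 S).map (fun x => inner ℝ x v)
      = gaussianReal 0 (quadForm S v).toNNReal := by
  have h := IsGaussian.map_eq_gaussianReal (μ := multivariateGaussian 0 S) (innerSL ℝ v)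
  have hfun : (⇑(innerSL ℝ v) : Vec d → ℝ) = fun x => inner ℝ x v := by
    ext x; simp [real_inner_comm]
  rw [hfun] at h
  rw [h, integral_inner_multivariateGaussian]
  congr 2
  rw [variance_eq_sub (allMoments_inner_multivariateGaussian v).memLp_two,
    integral_inner_multivariateGaussian]
  simp only [Pi.pow_apply, pow_two, mul_zero, sub_zero]
  rw [integral_inner_mul_inner_multivariateGaussian hS]
  rfl

lemma integral_inner_pow_four_multivariateGaussian (hS : S.PosSemidef) (v : Vec d) :
    ∫ x, (inner ℝ x v : ℝ) ^ 4 ∂(multivariateGaussian 0 S) = 3 * quadForm S v ^ 2 := by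
  have h := integral_pow_four_gaussianReal (quadForm S v).toNNReal
  rw [← map_inner_multivariateGaussian hS, integral_map (by fun_prop) (by fun_prop),
    Real.coe_toNNReal _ (quadForm_nonneg hS v)] at h
  exact h

/-- A case of Isserlis' theorem. -/
lemma integral_inner_sq_mul_inner_sq_multivariateGaussian (hS : S.PosSemidef) (u v : Vec d) :
    ∫ x, (inner ℝ x u * inner ℝ x v : ℝ) ^ 2 ∂(multivariateGaussian 0 S)
      = quadForm S u * quadForm S v + 2 * (u.ofLp ⬝ᵥ S *ᵥ v.ofLp) ^ 2 := by
  have hu := allMoments_inner_multivariateGaussian (S := S) u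
  have hv := allMoments_inner_multivariateGaussian (S := S) v
  have hsym : v.ofLp ⬝ᵥ S *ᵥ u.ofLp = u.ofLp ⬝ᵥ S *ᵥ v.ofLp := by
    rw [← integral_inner_mul_inner_multivariateGaussian hS,
      ← integral_inner_mul_inner_multivariateGaussian hS]
    simp_rw [mul_comm]
  have h4 : ∀ w : Vec d, Integrable (fun x => (inner ℝ x w : ℝ) ^ 4)
      (multivariateGaussian 0 S) := fun w => by
    have hw := allMoments_inner_multivariateGaussian (S := S) w
    have := ((hw.mul hw).mul (hw.mul hw)).integrable
    refine this.congr (Eventually.of_forall fun x => ?_)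
    simp only
    ring
  have h22 : Integrable (fun x => (inner ℝ x u * inner ℝ x v : ℝ) ^ 2)
      (multivariateGaussian 0 S) := by
    have := ((hu.mul hv).mul (hu.mul hv)).integrable
    refine this.congr (Eventually.of_forall fun x => ?_)
    simp only
    ring
  -- Polarization: the mixed moment is expressed through fourth powers of single projections, which
  -- are one-dimensional Gaussians.
  have hpt : ∀ x : Vec d, (inner ℝ x (u + v) : ℝ) ^ 4 + (inner ℝ x (u - v) : ℝ) ^ 4
      = 2 * (inner ℝ x u : ℝ) ^ 4 + 12 * (inner ℝ x u * inner ℝ x v : ℝ) ^ 2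
        + 2 * (inner ℝ x v : ℝ) ^ 4 := fun x => by
    rw [inner_add_right, inner_sub_right]; ring
  have hint := congrArg (fun f : Vec d → ℝ => ∫ x, f x ∂(multivariateGaussian 0 S)) (funext hpt)
  rw [integral_add (h4 _) (h4 _), integral_add (f := fun x : Vec d => 2 * (inner ℝ x u : ℝ) ^ 4
      + 12 * (inner ℝ x u * inner ℝ x v : ℝ) ^ 2) (((h4 u).const_mul 2).add (h22.const_mul 12))
      ((h4 v).const_mul 2), integral_add ((h4 u).const_mul 2) (h22.const_mul 12)] at hint
  simp only [integral_const_mul, integral_inner_pow_four_multivariateGaussian hS] at hint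
  have hp : quadForm S (u + v)
      = quadForm S u + 2 * (u.ofLp ⬝ᵥ S *ᵥ v.ofLp) + quadForm S v := by
    simp only [quadForm, WithLp.ofLp_add, Matrix.mulVec_add, dotProduct_add, add_dotProduct, hsym]
    ring
  have hm : quadForm S (u - v)
      = quadForm S u - 2 * (u.ofLp ⬝ᵥ S *ᵥ v.ofLp) + quadForm S v := by
    simp only [quadForm, WithLp.ofLp_sub, Matrix.mulVec_sub, dotProduct_sub, sub_dotProduct, hsym]
    ring
  rw [hp, hm] at hint
  linarith

end MultivariateGaussian

/-! ### The Gaussian linear model -/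

/-- The law of one data point `(X, W, ε)`. -/
def dataLaw {d p : ℕ} (SX : Matrix (Fin d) (Fin d) ℝ) (SW : Matrix (Fin p) (Fin p) ℝ) (σ : ℝ≥0) :
    Measure (Vec d × Vec p × ℝ) :=
  (multivariateGaussian 0 SX).prod ((multivariateGaussian 0 SW).prod (gaussianReal 0 (σ ^ 2)))

instance {d p : ℕ} (SX : Matrix (Fin d) (Fin d) ℝ) (SW : Matrix (Fin p) (Fin p) ℝ) (σ : ℝ≥0) :
    IsProbabilityMeasure (dataLaw SX SW σ) := by
  unfold dataLaw; infer_instance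

section Model

variable {d p : ℕ} {SX : Matrix (Fin d) (Fin d) ℝ} {SW : Matrix (Fin p) (Fin p) ℝ} {σ : ℝ≥0}

lemma allMoments_x : AllMoments (fun z : Vec d × Vec p × ℝ => z.1) (dataLaw SX SW σ) :=
  (allMoments_id_of_isGaussian _).comp_fst

lemma allMoments_w : AllMoments (fun z : Vec d × Vec p × ℝ => z.2.1) (dataLaw SX SW σ) :=
  ((allMoments_id_of_isGaussian _).comp_fst (E' := ℝ)).comp_snd
    (f := fun z : Vec p × ℝ => z.1)

lemma allMoments_eps : AllMoments (fun z : Vec d × Vec p × ℝ => z.2.2) (dataLaw SX SW σ) :=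
  ((allMoments_id_of_isGaussian _).comp_snd (E := Vec p)).comp_snd
    (f := fun z : Vec p × ℝ => z.2)

/-- By independence the integral factors, and the projection of `X` is centred. -/
lemma integral_inner_mul_noise (u : Vec d) (γ : Vec p) (α β : ℝ) :
    ∫ z, inner ℝ z.1 u * (α * inner ℝ z.2.1 γ + β * z.2.2) ∂(dataLaw SX SW σ) = 0 := by
  rw [dataLaw, integral_prod_mul (fun x : Vec d => (inner ℝ x u : ℝ))
    fun y : Vec p × ℝ => α * inner ℝ y.1 γ + β * y.2, integral_inner_multivariateGaussian, zero_mul]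

lemma integral_noise (γ : Vec p) (α β : ℝ) :
    ∫ y, (α * inner ℝ y.1 γ + β * y.2)
      ∂((multivariateGaussian 0 SW).prod (gaussianReal 0 (σ ^ 2))) = 0 := by
  have h1 : AllMoments (fun y : Vec p × ℝ => (inner ℝ y.1 γ : ℝ))
      ((multivariateGaussian 0 SW).prod (gaussianReal 0 (σ ^ 2))) :=
    (allMoments_inner_multivariateGaussian γ).comp_fst
  have h2 : AllMoments (fun y : Vec p × ℝ => y.2)
      ((multivariateGaussian 0 SW).prod (gaussianReal 0 (σ ^ 2))) :=
    (allMoments_id_of_isGaussian _).comp_snd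
  rw [integral_add (h1.const_mul α).integrable (h2.const_mul β).integrable, integral_const_mul,
    integral_const_mul, integral_fun_fst (fun x : Vec p => (inner ℝ x γ : ℝ)),
    integral_fun_snd (fun x : ℝ => x), integral_inner_multivariateGaussian]
  simp

lemma integral_noise_sq (hSW : SW.PosSemidef) (γ : Vec p) (α β : ℝ) :
    ∫ y, (α * inner ℝ y.1 γ + β * y.2) ^ 2
      ∂((multivariateGaussian 0 SW).prod (gaussianReal 0 (σ ^ 2)))
        = α ^ 2 * quadForm SW γ + β ^ 2 * σ ^ 2 := by
  have h1 : AllMoments (fun y : Vec p × ℝ => (inner ℝ y.1 γ : ℝ))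
      ((multivariateGaussian 0 SW).prod (gaussianReal 0 (σ ^ 2))) :=
    (allMoments_inner_multivariateGaussian γ).comp_fst
  have h2 : AllMoments (fun y : Vec p × ℝ => y.2)
      ((multivariateGaussian 0 SW).prod (gaussianReal 0 (σ ^ 2))) :=
    (allMoments_id_of_isGaussian _).comp_snd
  have hpt : ∀ y : Vec p × ℝ, (α * inner ℝ y.1 γ + β * y.2) ^ 2
      = α ^ 2 * (inner ℝ y.1 γ * inner ℝ y.1 γ) + 2 * α * β * (inner ℝ y.1 γ * y.2)
        + β ^ 2 * (y.2 * y.2) := fun y => by ring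
  have hg : ∫ x, x * x ∂(gaussianReal 0 (σ ^ 2)) = (σ : ℝ) ^ 2 := by
    have := variance_eq_sub (X := id) (IsGaussian.memLp_two_id (μ := gaussianReal 0 (σ ^ 2)))
    rw [variance_id_gaussianReal] at this
    simpa [pow_two] using this.symm
  simp_rw [hpt]
  rw [integral_add (((h1.mul h1).const_mul _).add ((h1.mul h2).const_mul _)).integrable
      ((h2.mul h2).const_mul _).integrable, integral_add ((h1.mul h1).const_mul _).integrable
      ((h1.mul h2).const_mul _).integrable, integral_const_mul, integral_const_mul,
    integral_const_mul, integral_prod_mul (fun x : Vec p => (inner ℝ x γ : ℝ)) (fun y : ℝ => y),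
    integral_fun_fst (fun x : Vec p => (inner ℝ x γ * inner ℝ x γ : ℝ)),
    integral_fun_snd (fun x : ℝ => x * x), integral_inner_multivariateGaussian, hg,
    integral_inner_mul_inner_multivariateGaussian hSW]
  simp [quadForm]

lemma integral_x_coord_mul (hSX : SX.PosSemidef) (u v : Vec d) :
    ∫ z, inner ℝ z.1 u * inner ℝ z.1 v ∂(dataLaw SX SW σ) = u.ofLp ⬝ᵥ SX *ᵥ v.ofLp := by
  rw [dataLaw, integral_fun_fst (fun x : Vec d => (inner ℝ x u * inner ℝ x v : ℝ)),
    integral_inner_mul_inner_multivariateGaussian hSX]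
  simp

/-- The variance of `⟨X, u⟩ (α ⟨W, γ⟩ + β ε + κ ⟨X, v⟩)`. -/
lemma variance_inner_mul_linear (hSX : SX.PosSemidef) (hSW : SW.PosSemidef) (u v : Vec d)
    (γ : Vec p) (α β κ : ℝ) :
    Var[fun z => inner ℝ z.1 u * (α * inner ℝ z.2.1 γ + β * z.2.2 + κ * inner ℝ z.1 v);
      dataLaw SX SW σ]
      = quadForm SX u * (α ^ 2 * quadForm SW γ + β ^ 2 * σ ^ 2 + κ ^ 2 * quadForm SX v)
        + κ ^ 2 * (u.ofLp ⬝ᵥ SX *ᵥ v.ofLp) ^ 2 := by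
  have hu : AllMoments (fun z : Vec d × Vec p × ℝ => (inner ℝ z.1 u : ℝ)) (dataLaw SX SW σ) :=
    allMoments_x.inner_const u
  have hv : AllMoments (fun z : Vec d × Vec p × ℝ => (inner ℝ z.1 v : ℝ)) (dataLaw SX SW σ) :=
    allMoments_x.inner_const v
  have hb : AllMoments (fun z : Vec d × Vec p × ℝ => α * inner ℝ z.2.1 γ + β * z.2.2)
      (dataLaw SX SW σ) :=
    ((allMoments_w.inner_const γ).const_mul α).add (allMoments_eps.const_mul β)
  have hmean : ∫ z, inner ℝ z.1 u * (α * inner ℝ z.2.1 γ + β * z.2.2 + κ * inner ℝ z.1 v)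
      ∂(dataLaw SX SW σ) = κ * (u.ofLp ⬝ᵥ SX *ᵥ v.ofLp) := by
    have hpt : ∀ z : Vec d × Vec p × ℝ,
        inner ℝ z.1 u * (α * inner ℝ z.2.1 γ + β * z.2.2 + κ * inner ℝ z.1 v)
        = inner ℝ z.1 u * (α * inner ℝ z.2.1 γ + β * z.2.2)
          + κ * (inner ℝ z.1 u * inner ℝ z.1 v) := fun z => by ring
    simp_rw [hpt]
    rw [integral_add (hu.mul hb).integrable ((hu.mul hv).const_mul κ).integrable,
      integral_inner_mul_noise, integral_const_mul, integral_x_coord_mul hSX, zero_add]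
  have hsq : ∫ z, (inner ℝ z.1 u * (α * inner ℝ z.2.1 γ + β * z.2.2 + κ * inner ℝ z.1 v)) ^ 2
      ∂(dataLaw SX SW σ)
      = quadForm SX u * (α ^ 2 * quadForm SW γ + β ^ 2 * σ ^ 2)
        + κ ^ 2 * (quadForm SX u * quadForm SX v + 2 * (u.ofLp ⬝ᵥ SX *ᵥ v.ofLp) ^ 2) := by
    -- Of the three terms, the first factors by independence, the second is linear in the centred
    -- noise and vanishes, and the third depends on `X` alone and is given by Isserlis' theorem.
    have hpt : ∀ z : Vec d × Vec p × ℝ,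
        (inner ℝ z.1 u * (α * inner ℝ z.2.1 γ + β * z.2.2 + κ * inner ℝ z.1 v)) ^ 2
        = (inner ℝ z.1 u * inner ℝ z.1 u) * (α * inner ℝ z.2.1 γ + β * z.2.2) ^ 2
          + 2 * κ * ((inner ℝ z.1 u * inner ℝ z.1 u * inner ℝ z.1 v)
            * (α * inner ℝ z.2.1 γ + β * z.2.2))
          + κ ^ 2 * (inner ℝ z.1 u * inner ℝ z.1 v) ^ 2 := fun z => by ring
    have hb2 : AllMoments (fun z : Vec d × Vec p × ℝ => (α * inner ℝ z.2.1 γ + β * z.2.2) ^ 2)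
        (dataLaw SX SW σ) := by simpa only [pow_two] using hb.mul hb
    have huv2 : AllMoments (fun z : Vec d × Vec p × ℝ => (inner ℝ z.1 u * inner ℝ z.1 v : ℝ) ^ 2)
        (dataLaw SX SW σ) := by simpa only [pow_two] using (hu.mul hv).mul (hu.mul hv)
    simp_rw [hpt]
    rw [integral_add (((hu.mul hu).mul hb2).add
        ((((hu.mul hu).mul hv).mul hb).const_mul _)).integrable (huv2.const_mul _).integrable,
      integral_add ((hu.mul hu).mul hb2).integrable
        ((((hu.mul hu).mul hv).mul hb).const_mul _).integrable,
      integral_const_mul, integral_const_mul]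
    have e1 : ∫ z : Vec d × Vec p × ℝ, (inner ℝ z.1 u * inner ℝ z.1 u)
        * (α * inner ℝ z.2.1 γ + β * z.2.2) ^ 2 ∂(dataLaw SX SW σ)
        = quadForm SX u * (α ^ 2 * quadForm SW γ + β ^ 2 * σ ^ 2) := by
      rw [dataLaw, integral_prod_mul (fun x : Vec d => (inner ℝ x u * inner ℝ x u : ℝ))
        fun y : Vec p × ℝ => (α * inner ℝ y.1 γ + β * y.2) ^ 2, integral_noise_sq hSW,
        integral_inner_mul_inner_multivariateGaussian hSX]
      rfl
    have e2 : ∫ z : Vec d × Vec p × ℝ, (inner ℝ z.1 u * inner ℝ z.1 u * inner ℝ z.1 v)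
        * (α * inner ℝ z.2.1 γ + β * z.2.2) ∂(dataLaw SX SW σ) = 0 := by
      rw [dataLaw, integral_prod_mul
        (fun x : Vec d => (inner ℝ x u * inner ℝ x u * inner ℝ x v : ℝ))
        fun y : Vec p × ℝ => α * inner ℝ y.1 γ + β * y.2, integral_noise, mul_zero]
    have e3 : ∫ z : Vec d × Vec p × ℝ, (inner ℝ z.1 u * inner ℝ z.1 v : ℝ) ^ 2
        ∂(dataLaw SX SW σ)
        = quadForm SX u * quadForm SX v + 2 * (u.ofLp ⬝ᵥ SX *ᵥ v.ofLp) ^ 2 := by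
      rw [dataLaw, integral_fun_fst (fun x : Vec d => (inner ℝ x u * inner ℝ x v : ℝ) ^ 2),
        integral_inner_sq_mul_inner_sq_multivariateGaussian hSX]
      simp
    rw [e1, e2, e3]
    ring
  rw [variance_eq_sub (hu.mul (hb.add (hv.const_mul κ))).memLp_two]
  simp only [Pi.pow_apply]
  rw [hmean, hsq]
  ring

end Model

/-! ### Minimizers of quadratic functions -/

section Quadratic

variable {d : ℕ}

/-- The operator on Euclidean space with a given matrix. -/
abbrev op (A : Matrix (Fin d) (Fin d) ℝ) : Vec d →L[ℝ] Vec d :=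
  Matrix.toEuclideanCLM (𝕜 := ℝ) A

lemma inner_op (A : Matrix (Fin d) (Fin d) ℝ) (u v : Vec d) :
    inner ℝ u (op A v) = u.ofLp ⬝ᵥ A *ᵥ v.ofLp :=
  Matrix.inner_toEuclideanCLM A u v

lemma op_apply (A : Matrix (Fin d) (Fin d) ℝ) (v : Vec d) (a : Fin d) :
    op A v a = ∑ j, A a j * v j := by
  simp [op, Matrix.mulVec, dotProduct]

lemma op_mul_apply (A B : Matrix (Fin d) (Fin d) ℝ) (v : Vec d) :
    op (A * B) v = op A (op B v) := by
  simp [op]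

lemma op_one_apply (v : Vec d) : op (1 : Matrix (Fin d) (Fin d) ℝ) v = v := by
  simp [op]

lemma inner_op_comm {A : Matrix (Fin d) (Fin d) ℝ} (hA : A.IsHermitian) (u v : Vec d) :
    inner ℝ (op A u) v = inner ℝ u (op A v) := by
  rw [real_inner_comm, inner_op, inner_op, Matrix.dotProduct_mulVec, dotProduct_comm,
    ← Matrix.mulVec_transpose]
  have : Aᵀ = A := Matrix.isHermitian_iff_isSymm.1 hA
  rw [this]

lemma _root_.Matrix.PosDef.op_inv_op {A : Matrix (Fin d) (Fin d) ℝ} (hA : A.PosDef) (v : Vec d) :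
    op A⁻¹ (op A v) = v := by
  rw [← op_mul_apply, Matrix.nonsing_inv_mul _ ((Matrix.isUnit_iff_isUnit_det _).1 hA.isUnit),
    op_one_apply]

lemma _root_.Matrix.PosDef.op_op_inv {A : Matrix (Fin d) (Fin d) ℝ} (hA : A.PosDef) (v : Vec d) :
    op A (op A⁻¹ v) = v := by
  rw [← op_mul_apply, Matrix.mul_nonsing_inv _ ((Matrix.isUnit_iff_isUnit_det _).1 hA.isUnit),
    op_one_apply]

lemma posDef_iff_inner_op {A : Matrix (Fin d) (Fin d) ℝ} (hA : A.IsHermitian) :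
    A.PosDef ↔ ∀ v : Vec d, v ≠ 0 → 0 < inner ℝ v (op A v) := by
  constructor
  · intro h v hv
    rw [inner_op]
    simpa using h.dotProduct_mulVec_pos (x := v.ofLp) (by simpa using hv)
  · intro h
    refine Matrix.PosDef.of_dotProduct_mulVec_pos hA fun x hx => ?_
    have := h (WithLp.toLp 2 x) (by simpa using hx)
    rw [inner_op] at this
    simpa using this

/-- A positive definite quadratic form is coercive. -/
lemma _root_.Matrix.PosDef.exists_coercive {A : Matrix (Fin d) (Fin d) ℝ} (hA : A.PosDef) :
    ∃ m : ℝ, 0 < m ∧ ∀ v : Vec d, m * ‖v‖ ^ 2 ≤ inner ℝ v (op A v) := by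
  have hpos := (posDef_iff_inner_op hA.isHermitian).1 hA
  -- An empty unit sphere forces every vector to be zero, so any constant works. Otherwise the
  -- minimum of the form on the compact sphere is positive, and homogeneity does the rest.
  rcases (Metric.sphere (0 : Vec d) 1).eq_empty_or_nonempty with he | hne
  · refine ⟨1, one_pos, fun v => ?_⟩
    by_cases hv : v = 0
    · simp [hv]
    · exfalso
      have : ‖v‖⁻¹ • v ∈ Metric.sphere (0 : Vec d) 1 := by
        simp [norm_smul, hv]
      simp [he] at this
  · obtain ⟨w, hw, hmin⟩ := (isCompact_sphere (0 : Vec d) 1).exists_isMinOn hne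
      (f := fun v => inner ℝ v (op A v)) (by fun_prop)
    have hw1 : ‖w‖ = 1 := by simpa using hw
    refine ⟨inner ℝ w (op A w), hpos w (by rintro rfl; simp at hw1), fun v => ?_⟩
    by_cases hv : v = 0
    · simp [hv]
    · have hn : ‖v‖ ≠ 0 := by simpa using hv
      have hmem : ‖v‖⁻¹ • v ∈ Metric.sphere (0 : Vec d) 1 := by
        simp [norm_smul, hv]
      have h := isMinOn_iff.1 hmin _ hmem
      simp only [map_smul, inner_smul_left, inner_smul_right] at h
      simp only [conj_trivial] at h
      have h2 := mul_le_mul_of_nonneg_right h (sq_nonneg ‖v‖)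
      have h3 : ‖v‖⁻¹ * (‖v‖⁻¹ * inner ℝ v (op A v)) * ‖v‖ ^ 2 = inner ℝ v (op A v) := by
        field_simp
      linarith

lemma argmin_eq_of_unique {F : Vec d → ℝ} {v : Vec d} (hv : ∀ t, F v ≤ F t)
    (huniq : ∀ w, (∀ t, F w ≤ F t) → w = v) : argmin F = v := by
  have h : ∃! ϑ : Vec d, ∀ t, F ϑ ≤ F t := ⟨v, hv, huniq⟩
  rw [argmin, dif_pos h]
  exact huniq _ h.choose_spec.1

open Classical in
/-- The unique minimizer of `ϑ ↦ ⟨ϑ, A ϑ⟩ - 2 ⟨b, ϑ⟩` if `A` is positive definite,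
and zero otherwise. -/
def quadMin (A : Matrix (Fin d) (Fin d) ℝ) (b : Vec d) : Vec d :=
  if A.PosDef then op A⁻¹ b else 0

/-- A unique minimizer exists exactly when `A` is positive definite, so the default value of
`argmin` and that of `quadMin` are taken in the same cases. The identity holds for every symmetric
`A`, hence at every outcome, whether or not the random matrix there is positive definite. -/
lemma argmin_quadratic {A : Matrix (Fin d) (Fin d) ℝ} (hA : A.IsHermitian) (b : Vec d) (c : ℝ)
    {F : Vec d → ℝ} (hF : ∀ ϑ, F ϑ = inner ℝ ϑ (op A ϑ) - 2 * inner ℝ b ϑ + c) :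
    argmin F = quadMin A b := by
  have hexp : ∀ u v : Vec d,
      F (u + v) = F u + inner ℝ v (op A v) + 2 * inner ℝ (op A u - b) v := by
    intro u v
    have h1 : inner ℝ v (op A u) = inner ℝ (op A u) v := real_inner_comm _ _
    have h2 : inner ℝ u (op A v) = inner ℝ (op A u) v := (inner_op_comm hA u v).symm
    simp only [hF, map_add, inner_add_left, inner_add_right, inner_sub_left, h1, h2]
    ring
  by_cases hpd : A.PosDef
  · rw [quadMin, if_pos hpd]
    have hstat : ∀ v, F (op A⁻¹ b + v) = F (op A⁻¹ b) + inner ℝ v (op A v) := fun v => by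
      rw [hexp, hpd.op_op_inv]
      simp
    have hpos := (posDef_iff_inner_op hA).1 hpd
    refine argmin_eq_of_unique (fun t => ?_) fun w hw => ?_
    · have h := hstat (t - op A⁻¹ b)
      rw [add_sub_cancel] at h
      by_cases ht : t - op A⁻¹ b = 0
      · rw [sub_eq_zero.1 ht]
      · linarith [hpos _ ht]
    · by_contra hne
      have h := hstat (w - op A⁻¹ b)
      rw [add_sub_cancel] at h
      linarith [hpos _ (sub_ne_zero.2 hne), hw (op A⁻¹ b)]
  · rw [quadMin, if_neg hpd, argmin, dif_neg]
    rintro ⟨u, hu, huniq⟩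
    rw [posDef_iff_inner_op hA] at hpd
    push Not at hpd
    obtain ⟨v, hv, hle⟩ := hpd
    have hmin : ∀ w, w ≠ 0 → inner ℝ w (op A w) + 2 * inner ℝ (op A u - b) w ≤ 0 → False := by
      intro w hw hlew
      have : u + w = u := huniq _ fun t => by
        have := hexp u w
        linarith [hu t]
      exact hw (by simpa using this)
    -- Along a direction `v` of nonpositive curvature, the sign of the step can be chosen so that
    -- the linear term does not increase either. The minimizer `u` could then be moved to a
    -- different minimizer.
    rcases le_total (inner ℝ (op A u - b) v : ℝ) 0 with hs | hs
    · exact hmin v hv (by linarith)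
    · refine hmin (-v) (by simpa using hv) ?_
      simp only [map_neg, inner_neg_left, inner_neg_right, neg_neg]
      linarith

end Quadratic

/-! ### Random matrices -/

section RandomMatrix

variable {Ω : Type*} [MeasurableSpace Ω] {d : ℕ}

/-- Cramer's formula, valid for singular matrices too, where both the inverse matrix and the inverse
determinant are zero by convention. -/
lemma measurable_matrix_inv {A : Ω → Matrix (Fin d) (Fin d) ℝ}
    (hA : ∀ a b, Measurable fun ω => A ω a b) (a b : Fin d) :
    Measurable fun ω => (A ω)⁻¹ a b := by
  have hdet : Continuous fun M : Fin d → Fin d → ℝ => (Matrix.of M).det :=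
    Continuous.matrix_det (continuous_id (X := Matrix (Fin d) (Fin d) ℝ))
  have hadj : Continuous fun M : Fin d → Fin d → ℝ => (Matrix.of M).adjugate a b :=
    (Continuous.matrix_adjugate (continuous_id (X := Matrix (Fin d) (Fin d) ℝ))).matrix_elem a b
  have hm : Measurable fun ω => (fun a b => A ω a b : Fin d → Fin d → ℝ) :=
    measurable_pi_lambda _ fun a => measurable_pi_lambda _ fun b => hA a b
  have h := ((hdet.measurable.comp hm).inv).mul (hadj.measurable.comp hm)
  have he : (fun ω => (A ω)⁻¹ a b) = fun ω => (A ω).det⁻¹ * (A ω).adjugate a b := by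
    ext ω
    simp [Matrix.inv_def, Ring.inverse_eq_inv']
  rw [he]
  exact h

lemma measurable_op_apply {A : Ω → Matrix (Fin d) (Fin d) ℝ} {v : Ω → Vec d}
    (hA : ∀ a b, Measurable fun ω => A ω a b) (hv : Measurable v) :
    Measurable fun ω => op (A ω) (v ω) := by
  have h : ∀ a, Measurable fun ω => op (A ω) (v ω) a := fun a => by
    simp_rw [op_apply]
    fun_prop
  exact (WithLp.measurable_toLp 2 _).comp (measurable_pi_lambda _ h)

/-- Positive definiteness is coercivity with some constant 1/(k + 1), and by continuity it suffices
to test coercivity on a countable dense set of vectors. This gives a countable union of countable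
intersections. -/
lemma measurableSet_posDef {A : Ω → Matrix (Fin d) (Fin d) ℝ}
    (hA : ∀ a b, Measurable fun ω => A ω a b) (hsym : ∀ ω, (A ω).IsHermitian) :
    MeasurableSet {ω | (A ω).PosDef} := by
  have h : {ω | (A ω).PosDef} = ⋃ k : ℕ, ⋂ j : ℕ,
      {ω | ((k : ℝ) + 1)⁻¹ * ‖TopologicalSpace.denseSeq (Vec d) j‖ ^ 2
        ≤ inner ℝ (TopologicalSpace.denseSeq (Vec d) j)
          (op (A ω) (TopologicalSpace.denseSeq (Vec d) j))} := by
    ext ω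
    simp only [Set.mem_ofPred_eq, Set.mem_iUnion, Set.mem_iInter]
    constructor
    · intro hpd
      obtain ⟨m, hm, hco⟩ := hpd.exists_coercive
      obtain ⟨k, hk⟩ := exists_nat_one_div_lt hm
      refine ⟨k, fun j => le_trans ?_ (hco _)⟩
      rw [← one_div]
      exact mul_le_mul_of_nonneg_right hk.le (sq_nonneg _)
    · rintro ⟨k, hk⟩
      refine (posDef_iff_inner_op (hsym ω)).2 fun v hv => ?_
      have hall : ∀ v : Vec d, ((k : ℝ) + 1)⁻¹ * ‖v‖ ^ 2 ≤ inner ℝ v (op (A ω) v) := by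
        have hclosed : IsClosed {v : Vec d | ((k : ℝ) + 1)⁻¹ * ‖v‖ ^ 2
            ≤ inner ℝ v (op (A ω) v)} := isClosed_le (by fun_prop) (by fun_prop)
        have hsub := hclosed.closure_subset_iff.2 (Set.range_subset_iff.2 hk)
        rw [(TopologicalSpace.denseRange_denseSeq (Vec d)).closure_range] at hsub
        exact fun v => hsub (Set.mem_univ v)
      have hn : 0 < ‖v‖ := by simpa using hv
      exact lt_of_lt_of_le (by positivity) (hall v)
  rw [h]
  refine MeasurableSet.iUnion fun k => MeasurableSet.iInter fun j => ?_
  refine measurableSet_le measurable_const ?_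
  exact measurable_const.inner (measurable_op_apply hA measurable_const)

lemma measurable_quadMin {A : Ω → Matrix (Fin d) (Fin d) ℝ} {b : Ω → Vec d}
    (hA : ∀ a b, Measurable fun ω => A ω a b) (hsym : ∀ ω, (A ω).IsHermitian)
    (hb : Measurable b) : Measurable fun ω => quadMin (A ω) (b ω) := by
  classical
  unfold quadMin
  convert Measurable.ite (measurableSet_posDef hA hsym)
    (measurable_op_apply (measurable_matrix_inv hA) hb) (measurable_const (a := (0 : Vec d)))

/-- Entrywise convergence in probability of random matrices. -/
def MatTendsto (P : Measure Ω) (A : ℕ → Ω → Matrix (Fin d) (Fin d) ℝ)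
    (B : Matrix (Fin d) (Fin d) ℝ) : Prop :=
  TendstoInMeasure P (fun n ω => (fun a b => A n ω a b : Fin d → Fin d → ℝ)) atTop
    fun _ => (fun a b => B a b : Fin d → Fin d → ℝ)

variable {P : Measure Ω}

lemma matTendsto_of_entries {A : ℕ → Ω → Matrix (Fin d) (Fin d) ℝ} {B : Matrix (Fin d) (Fin d) ℝ}
    (h : ∀ a b, TendstoInMeasure P (fun n ω => A n ω a b) atTop fun _ => B a b) :
    MatTendsto P A B :=
  tendstoInMeasure_pi fun a => tendstoInMeasure_pi fun b => h a b

lemma continuous_op :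
    Continuous fun M : Fin d → Fin d → ℝ => op (Matrix.of M) := by
  let L : (Fin d → Fin d → ℝ) →ₗ[ℝ] (Vec d →L[ℝ] Vec d) :=
    { toFun := fun M => op (Matrix.of M)
      map_add' := fun M N => map_add (Matrix.toEuclideanCLM (𝕜 := ℝ)) (Matrix.of M) (Matrix.of N)
      map_smul' := fun c M => map_smul (Matrix.toEuclideanCLM (𝕜 := ℝ)) c (Matrix.of M) }
  exact L.continuous_of_finiteDimensional

lemma continuousAt_matrix_inv {B : Matrix (Fin d) (Fin d) ℝ} (hB : IsUnit B.det) :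
    ContinuousAt (fun M : Fin d → Fin d → ℝ => (fun a b => (Matrix.of M)⁻¹ a b : Fin d → Fin d → ℝ))
      (fun a b => B a b) := by
  have hdet : Continuous fun M : Fin d → Fin d → ℝ => (Matrix.of M).det :=
    Continuous.matrix_det (continuous_id (X := Matrix (Fin d) (Fin d) ℝ))
  have hadj : ∀ a b, Continuous fun M : Fin d → Fin d → ℝ => (Matrix.of M).adjugate a b :=
    fun a b =>
    (Continuous.matrix_adjugate (continuous_id (X := Matrix (Fin d) (Fin d) ℝ))).matrix_elem a b
  refine continuousAt_pi.2 fun a => continuousAt_pi.2 fun b => ?_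
  have h : (fun M : Fin d → Fin d → ℝ => (Matrix.of M)⁻¹ a b)
      = fun M => ((Matrix.of M).det)⁻¹ * (Matrix.of M).adjugate a b := by
    ext M
    simp [Matrix.inv_def, Ring.inverse_eq_inv']
  rw [h]
  exact (hdet.continuousAt.inv₀ hB.ne_zero).mul (hadj a b).continuousAt

lemma MatTendsto.inv {A : ℕ → Ω → Matrix (Fin d) (Fin d) ℝ} {B : Matrix (Fin d) (Fin d) ℝ}
    (h : MatTendsto P A B) (hB : IsUnit B.det) :
    MatTendsto P (fun n ω => (A n ω)⁻¹) B⁻¹ :=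
  tendstoInMeasure_comp_of_continuousAt h (continuousAt_matrix_inv hB)

lemma MatTendsto.entry {A : ℕ → Ω → Matrix (Fin d) (Fin d) ℝ} {B : Matrix (Fin d) (Fin d) ℝ}
    (h : MatTendsto P A B) (a b : Fin d) :
    TendstoInMeasure P (fun n ω => A n ω a b) atTop fun _ => B a b :=
  tendstoInMeasure_comp_of_continuousAt h (Φ := fun M : Fin d → Fin d → ℝ => M a b)
    (continuous_apply_apply a b).continuousAt

lemma MatTendsto.mul {A A' : ℕ → Ω → Matrix (Fin d) (Fin d) ℝ} {B B' : Matrix (Fin d) (Fin d) ℝ}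
    (h : MatTendsto P A B) (h' : MatTendsto P A' B') :
    MatTendsto P (fun n ω => A n ω * A' n ω) (B * B') := by
  refine matTendsto_of_entries fun a b => ?_
  simp only [Matrix.mul_apply]
  exact tendstoInMeasure_sum _ fun j _ => tendstoInMeasure_mul (h.entry a j) (h'.entry j b)

lemma MatTendsto.negligible_op_sub {A : ℕ → Ω → Matrix (Fin d) (Fin d) ℝ}
    {B : Matrix (Fin d) (Fin d) ℝ} (h : MatTendsto P A B) :
    Negligible P fun n ω => op (A n ω) - op B :=
  negligible_sub_const_iff.2
    (tendstoInMeasure_comp_of_continuousAt h continuous_op.continuousAt)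

/-- A symmetric perturbation of operator norm below the coercivity constant of `B` keeps the form
positive. -/
lemma MatTendsto.tendsto_measure_not_posDef {A : ℕ → Ω → Matrix (Fin d) (Fin d) ℝ}
    {B : Matrix (Fin d) (Fin d) ℝ} (h : MatTendsto P A B) (hB : B.PosDef)
    (hsym : ∀ n ω, (A n ω).IsHermitian) :
    Tendsto (fun n => P {ω | ¬ (A n ω).PosDef}) atTop (𝓝 0) := by
  obtain ⟨m, hm, hco⟩ := hB.exists_coercive
  refine tendsto_of_tendsto_of_tendsto_of_le_of_le tendsto_const_nhds
    (h.negligible_op_sub m hm) (fun _ => zero_le) fun n => measure_mono fun ω hω => ?_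
  by_contra hlt
  simp only [Set.mem_ofPred_eq, not_le] at hlt
  refine hω ((posDef_iff_inner_op (hsym n ω)).2 fun v hv => ?_)
  have h1 : inner ℝ v (op (A n ω) v)
      = inner ℝ v (op B v) + inner ℝ v ((op (A n ω) - op B) v) := by
    simp [inner_sub_right]
  have h2 : -(‖op (A n ω) - op B‖ * ‖v‖ ^ 2) ≤ inner ℝ v ((op (A n ω) - op B) v) := by
    have h3 := abs_real_inner_le_norm v ((op (A n ω) - op B) v)
    have h4 := (op (A n ω) - op B).le_opNorm v
    have h5 := mul_le_mul_of_nonneg_left h4 (norm_nonneg v)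
    have := neg_abs_le (inner ℝ v ((op (A n ω) - op B) v))
    nlinarith
  have hn : 0 < ‖v‖ ^ 2 := by have : 0 < ‖v‖ := by simpa using hv
                              positivity
  rw [h1]
  nlinarith [hco v]

/-- The asymptotic linearization of minimizers of random quadratic functions. -/
theorem negligible_quadMin_sub {A : ℕ → Ω → Matrix (Fin d) (Fin d) ℝ}
    {B : Matrix (Fin d) (Fin d) ℝ} (h : MatTendsto P A B) (hB : B.PosDef)
    (hsym : ∀ n ω, (A n ω).IsHermitian) {b : ℕ → Ω → Vec d} (θ : Vec d)
    (hb : BoundedInProb P fun n ω => √(n : ℝ) • (b n ω - op (A n ω) θ)) :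
    Negligible P fun n ω => √(n : ℝ) • (quadMin (A n ω) (b n ω) - θ)
      - op B⁻¹ (√(n : ℝ) • (b n ω - op (A n ω) θ)) := by
  have hinv := (h.inv ((Matrix.isUnit_iff_isUnit_det _).1 hB.isUnit)).negligible_op_sub
  have hneg : Negligible P fun n ω =>
      (op (A n ω)⁻¹ - op B⁻¹) (√(n : ℝ) • (b n ω - op (A n ω) θ)) :=
    hinv.of_norm_le_mul hb (Eventually.of_forall fun n ω => ContinuousLinearMap.le_opNorm _ _)
  -- Where `A n` is positive definite, the quantity to be bounded is exactly `(A n)⁻¹ - B⁻¹` applied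
  -- to a sequence bounded in probability. The remaining outcomes have vanishing probability.
  refine hneg.of_eq_on (h.tendsto_measure_not_posDef hB hsym)
    (Eventually.of_forall fun n ω hω => ?_)
  simp only [Set.mem_ofPred_eq, not_not] at hω
  rw [quadMin, if_pos hω, sub_apply]
  congr 1
  rw [map_smul, map_sub, hω.op_inv_op]

end RandomMatrix

/-! ### Closed forms of the estimators -/

section ClosedForm

variable {d : ℕ}

/-- The empirical second moment matrix of the vectors `x i`, `i ∈ D`. -/
def gram (D : Finset ℕ) (x : ℕ → Vec d) : Matrix (Fin d) (Fin d) ℝ :=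
  Matrix.of fun a b => avg D fun i => x i a * x i b

lemma gram_isHermitian (D : Finset ℕ) (x : ℕ → Vec d) : (gram D x).IsHermitian := by
  refine Matrix.isHermitian_iff_isSymm.2 (Matrix.IsSymm.ext fun a b => ?_)
  simp [gram, mul_comm]

lemma avg_apply (D : Finset ℕ) (u : ℕ → Vec d) (a : Fin d) :
    avg D u a = avg D fun i => u i a := by
  simp [avg]

lemma op_gram (D : Finset ℕ) (x : ℕ → Vec d) (v : Vec d) :
    op (gram D x) v = avg D fun i => (inner ℝ (x i) v : ℝ) • x i := by
  ext a
  simp only [op_apply, gram, Matrix.of_apply, avg_apply]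
  simp only [avg, smul_eq_mul, mul_assoc, Finset.sum_mul, ← Finset.mul_sum]
  rw [Finset.sum_comm]
  refine congrArg _ (Finset.sum_congr rfl fun i _ => ?_)
  simp only [PiLp.inner_apply, PiLp.smul_apply, smul_eq_mul, Finset.sum_mul]
  refine Finset.sum_congr rfl fun j _ => ?_
  simp
  ring

lemma inner_avg (D : Finset ℕ) (u : ℕ → Vec d) (v : Vec d) :
    inner ℝ v (avg D u) = avg D fun i => (inner ℝ v (u i) : ℝ) :=
  map_avg (innerSL ℝ v).toLinearMap D u

lemma avg_sqLoss (D : Finset ℕ) (x : ℕ → Vec d) (y : ℕ → ℝ) (ϑ : Vec d) :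
    (D.card : ℝ)⁻¹ * ∑ i ∈ D, sqLoss d ϑ (x i) (y i)
      = inner ℝ ϑ (op (gram D x) ϑ) - 2 * inner ℝ (avg D fun i => y i • x i) ϑ
        + avg D fun i => y i ^ 2 := by
  rw [op_gram, inner_avg, real_inner_comm, inner_avg, ← smul_eq_mul (2 : ℝ), ← avg_smul, ← avg_sub,
    ← avg_add, avg, smul_eq_mul]
  refine congrArg _ (Finset.sum_congr rfl fun i _ => ?_)
  simp only [sqLoss, inner_smul_right, real_inner_comm ϑ, smul_eq_mul]
  ring

lemma xyEstimator_sqLoss (D : Finset ℕ) (x : ℕ → Vec d) (y : ℕ → ℝ) :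
    xyEstimator D (sqLoss d) x y = quadMin (gram D x) (avg D fun i => y i • x i) :=
  argmin_quadratic (gram_isHermitian D x) _ _ fun ϑ => avg_sqLoss D x y ϑ

/-- The matrix of the quadratic objective of the estimator with imputed loss `lam • ℓ`. -/
def ppiGram (L U : Finset ℕ) (lam : ℝ) (x : ℕ → Vec d) : Matrix (Fin d) (Fin d) ℝ :=
  gram L x - lam • (gram L x - gram U x)

lemma ppiGram_isHermitian (L U : Finset ℕ) (lam : ℝ) (x : ℕ → Vec d) :
    (ppiGram L U lam x).IsHermitian :=
  (gram_isHermitian L x).sub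
    (((gram_isHermitian L x).sub (gram_isHermitian U x)).smul (k := lam) (by simp [IsSelfAdjoint]))

lemma op_ppiGram (L U : Finset ℕ) (lam : ℝ) (x : ℕ → Vec d) (v : Vec d) :
    op (ppiGram L U lam x) v
      = op (gram L x) v - lam • (op (gram L x) v - op (gram U x) v) := by
  simp [op, ppiGram]

/-- The objective is quadratic for every `lam`, though its matrix need not be positive semidefinite.
Being deterministic, the formula may be used with a data-dependent `lam`. -/
lemma ppiEstimator_smul_sqLoss (L U : Finset ℕ) (lam : ℝ) (x : ℕ → Vec d) (y yh : ℕ → ℝ) :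
    ppiEstimator L U (sqLoss d) (lam • sqLoss d) x y yh
      = quadMin (ppiGram L U lam x) ((avg L fun i => y i • x i)
        - lam • ((avg L fun i => yh i • x i) - avg U fun i => yh i • x i)) := by
  refine argmin_quadratic (ppiGram_isHermitian L U lam x) _
    ((avg L fun i => y i ^ 2) - lam * ((avg L fun i => yh i ^ 2) - avg U fun i => yh i ^ 2))
    fun ϑ => ?_
  have h : ∀ (D : Finset ℕ), (D.card : ℝ)⁻¹ * ∑ i ∈ D, (lam • sqLoss d) ϑ (x i) (yh i)
      = lam * ((D.card : ℝ)⁻¹ * ∑ i ∈ D, sqLoss d ϑ (x i) (yh i)) := fun D => by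
    simp only [Pi.smul_apply, smul_eq_mul, ← Finset.mul_sum]
    ring
  rw [ppiObjective, h, h, avg_sqLoss, avg_sqLoss, avg_sqLoss, op_ppiGram]
  simp only [inner_sub_right, inner_sub_left, inner_smul_right, inner_smul_left, conj_trivial]
  ring

/-- An imputed loss linear in ϑ changes only the linear coefficient. The division by 2 comes from
the normalization `-2 ⟨b, ϑ⟩`. -/
lemma ppiEstimator_linear (D U : Finset ℕ) (n N : ℕ) (M : Matrix (Fin d) (Fin d) ℝ)
    (s : Vec d × ℝ → Vec d) (x : ℕ → Vec d) (y yh : ℕ → ℝ) :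
    ppiEstimator D U (sqLoss d) (linearImputedLoss n N M s) x y yh
      = quadMin (gram D x) ((avg D fun i => y i • x i)
        + ((1 + (n : ℝ) / N)⁻¹ / 2) • op M ((avg D fun i => s (x i, yh i))
          - avg U fun i => s (x i, yh i))) := by
  refine argmin_quadratic (gram_isHermitian D x) _ (avg D fun i => y i ^ 2) fun ϑ => ?_
  have h : ∀ B : Finset ℕ,
      (B.card : ℝ)⁻¹ * ∑ i ∈ B, linearImputedLoss n N M s ϑ (x i) (yh i)
      = (1 + (n : ℝ) / N)⁻¹ * inner ℝ ϑ (op M (avg B fun i => s (x i, yh i))) := fun B => by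
    have h1 : op M (avg B fun i => s (x i, yh i)) = avg B fun i => op M (s (x i, yh i)) :=
      map_avg (op M).toLinearMap B _
    rw [h1, inner_avg, ← smul_eq_mul (1 + (n : ℝ) / N)⁻¹, ← avg_smul, avg, smul_eq_mul]
    simp only [inner_op, smul_eq_mul, linearImputedLoss]
  rw [ppiObjective, h, h, avg_sqLoss]
  simp only [map_sub, real_inner_comm ϑ, inner_add_right, inner_smul_right, inner_sub_right]
  ring

end ClosedForm

/-! ### Asymptotics of power-tuned estimators in the Gaussian linear model -/

section Asymptotics

variable {d p : ℕ}

/-- The outcome `Y` at a data point `(X, W, ε)`. -/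
def outcome (θ : Vec d) (γ : Vec p) (z : Vec d × Vec p × ℝ) : ℝ :=
  inner ℝ z.2.1 γ + inner ℝ z.1 θ + z.2.2

/-- The prediction at a data point `(X, W, ε)`. -/
def prediction (γ : Vec p) (z : Vec d × Vec p × ℝ) : ℝ := inner ℝ z.2.1 γ

/-- The residual moment `(Y - ⟨X, θ⟩) X`. -/
def resid (γ : Vec p) (z : Vec d × Vec p × ℝ) : Vec d := (inner ℝ z.2.1 γ + z.2.2) • z.1

/-- The imputed moment `(Ŷ - κ ⟨X, θ⟩) X`. -/
def imputed (θ : Vec d) (γ : Vec p) (κ : ℝ) (z : Vec d × Vec p × ℝ) : Vec d :=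
  (inner ℝ z.2.1 γ - κ * inner ℝ z.1 θ) • z.1

lemma measurable_outcome (θ : Vec d) (γ : Vec p) : Measurable (outcome θ γ) := by
  unfold outcome; fun_prop

lemma measurable_prediction (γ : Vec p) : Measurable (prediction (d := d) γ) := by
  unfold prediction; fun_prop

lemma measurable_resid (γ : Vec p) : Measurable (resid (d := d) γ) := by
  unfold resid; fun_prop

lemma measurable_imputed (θ : Vec d) (γ : Vec p) (κ : ℝ) : Measurable (imputed θ γ κ) := by
  unfold imputed; fun_prop

variable {SX : Matrix (Fin d) (Fin d) ℝ} {SW : Matrix (Fin p) (Fin p) ℝ} {σ : ℝ≥0}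
variable {θ : Vec d} {γ : Vec p}

lemma allMoments_resid : AllMoments (resid γ) (dataLaw SX SW σ) :=
  ((allMoments_w.inner_const γ).add allMoments_eps).smul allMoments_x

lemma allMoments_imputed (κ : ℝ) : AllMoments (imputed θ γ κ) (dataLaw SX SW σ) :=
  ((allMoments_w.inner_const γ).sub ((allMoments_x.inner_const θ).const_mul κ)).smul allMoments_x

lemma integral_resid : ∫ z, resid γ z ∂(dataLaw SX SW σ) = 0 := by
  refine ext_inner_right ℝ fun u => ?_
  rw [inner_zero_left, real_inner_comm, ← integral_inner allMoments_resid.integrable]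
  have h := integral_inner_mul_noise (SX := SX) (SW := SW) (σ := σ) u γ 1 1
  rw [← h]
  refine integral_congr_ae (Eventually.of_forall fun z => ?_)
  simp only [resid, inner_smul_right, real_inner_comm u]
  ring

lemma integral_resid_coord (j : Fin d) : ∫ z, resid γ z j ∂(dataLaw SX SW σ) = 0 := by
  have h := (EuclideanSpace.proj j : Vec d →L[ℝ] ℝ).integral_comp_comm
    (allMoments_resid (γ := γ) (SX := SX) (SW := SW) (σ := σ)).integrable
  rw [integral_resid, map_zero] at h
  exact h

lemma integral_coord_mul_coord (hSX : SX.PosSemidef) (a b : Fin d) :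
    ∫ z, z.1 a * z.1 b ∂(dataLaw SX SW σ) = SX a b := by
  have h := integral_x_coord_mul (SW := SW) (σ := σ) hSX (EuclideanSpace.single a 1)
    (EuclideanSpace.single b 1)
  simpa [EuclideanSpace.inner_single_right] using h

/-- The asymptotic covariance of the estimator whose linearization is
`SX⁻¹ (mean_L resid - lam (mean_L imputed - mean_U imputed))`. -/
def asympCov (SX : Matrix (Fin d) (Fin d) ℝ) (SW : Matrix (Fin p) (Fin p) ℝ) (σ : ℝ≥0)
    (θ : Vec d) (γ : Vec p) (r lam κ : ℝ) : Matrix (Fin d) (Fin d) ℝ :=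
  (σ ^ 2 + (1 - lam) ^ 2 * quadForm SW γ + lam ^ 2 * r * quadForm SW γ
      + κ ^ 2 * lam ^ 2 * (1 + r) * quadForm SX θ) • SX⁻¹
    + (κ ^ 2 * lam ^ 2 * (1 + r)) • Matrix.vecMulVec θ.ofLp θ.ofLp

lemma asympCov_posSemidef (hSX : SX.PosDef) (hSW : SW.PosSemidef) {r : ℝ} (hr : 0 ≤ r)
    (lam κ : ℝ) : (asympCov SX SW σ θ γ r lam κ).PosSemidef := by
  have h1 := quadForm_nonneg hSW γ
  have h2 := quadForm_nonneg hSX.posSemidef θ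
  have h3 : (Matrix.vecMulVec θ.ofLp θ.ofLp).PosSemidef := by
    simpa using Matrix.posSemidef_vecMulVec_self_star θ.ofLp
  exact (hSX.posSemidef.inv.smul (by positivity)).add (h3.smul (by positivity))

lemma asympCov_trace (r lam κ : ℝ) : (asympCov SX SW σ θ γ r lam κ).trace
    = (σ ^ 2 + (1 - lam) ^ 2 * quadForm SW γ + lam ^ 2 * r * quadForm SW γ
      + κ ^ 2 * lam ^ 2 * (1 + r) * quadForm SX θ) * SX⁻¹.trace
    + κ ^ 2 * lam ^ 2 * (1 + r) * ‖θ‖ ^ 2 := by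
  rw [asympCov, Matrix.trace_add, Matrix.trace_smul, Matrix.trace_smul, Matrix.trace_vecMulVec,
    smul_eq_mul, smul_eq_mul, EuclideanSpace.real_norm_sq_eq]
  simp [dotProduct, pow_two]

/-- Moving the symmetric matrix `SX⁻¹` onto `t` turns both projections into ⟨X, u⟩ times a linear
form in ⟨W, γ⟩, ε and ⟨X, θ⟩, with coefficients (1 - lam, 1, lam κ) for labeled and (lam, 0, -lam κ)
for unlabeled points. Then `variance_inner_mul_linear` applies twice. -/
lemma dotProduct_asympCov_mulVec (hSX : SX.PosDef) (hSW : SW.PosSemidef) (r lam κ : ℝ)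
    (t : Vec d) :
    t.ofLp ⬝ᵥ asympCov SX SW σ θ γ r lam κ *ᵥ t.ofLp
      = Var[fun z => inner ℝ (op SX⁻¹ (resid γ z) - lam • op SX⁻¹ (imputed θ γ κ z)) t;
          dataLaw SX SW σ]
        + r * Var[fun z => inner ℝ (lam • op SX⁻¹ (imputed θ γ κ z)) t; dataLaw SX SW σ] := by
  set u : Vec d := op SX⁻¹ t with hu
  have hinv : SX⁻¹.IsHermitian := hSX.isHermitian.inv
  have hin : ∀ v : Vec d, (inner ℝ (op SX⁻¹ v) t : ℝ) = inner ℝ v u := fun v =>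
    inner_op_comm hinv v t
  have e1 : ∀ z : Vec d × Vec p × ℝ,
      inner ℝ (op SX⁻¹ (resid γ z) - lam • op SX⁻¹ (imputed θ γ κ z)) t
        = inner ℝ z.1 u * ((1 - lam) * inner ℝ z.2.1 γ + 1 * z.2.2
          + (lam * κ) * inner ℝ z.1 θ) := fun z => by
    rw [inner_sub_left, inner_smul_left, hin, hin]
    simp only [resid, imputed, inner_smul_left, conj_trivial]
    ring
  have e2 : ∀ z : Vec d × Vec p × ℝ, inner ℝ (lam • op SX⁻¹ (imputed θ γ κ z)) t
        = inner ℝ z.1 u * (lam * inner ℝ z.2.1 γ + 0 * z.2.2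
          + (-(lam * κ)) * inner ℝ z.1 θ) := fun z => by
    rw [inner_smul_left, hin]
    simp only [imputed, inner_smul_left, conj_trivial]
    ring
  have hq : quadForm SX u = t.ofLp ⬝ᵥ SX⁻¹ *ᵥ t.ofLp := by
    rw [quadForm, ← inner_op, hu, hSX.op_op_inv, real_inner_comm, inner_op]
  have hc : u.ofLp ⬝ᵥ SX *ᵥ θ.ofLp = t.ofLp ⬝ᵥ θ.ofLp := by
    rw [← inner_op, ← inner_op_comm hSX.isHermitian, hu, hSX.op_op_inv]
    simp [PiLp.inner_apply, dotProduct, mul_comm]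
  simp_rw [e1, e2]
  rw [variance_inner_mul_linear hSX.posSemidef hSW, variance_inner_mul_linear hSX.posSemidef hSW,
    hq, hc, asympCov, Matrix.add_mulVec, Matrix.smul_mulVec, Matrix.smul_mulVec, dotProduct_add,
    dotProduct_smul, dotProduct_smul, Matrix.vecMulVec_mulVec, smul_eq_mul, smul_eq_mul]
  have hv : t.ofLp ⬝ᵥ MulOpposite.op (θ.ofLp ⬝ᵥ t.ofLp) • θ.ofLp = (t.ofLp ⬝ᵥ θ.ofLp) ^ 2 := by
    rw [dotProduct_smul, dotProduct_comm θ.ofLp]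
    simp [pow_two]
  rw [hv]
  ring

variable {Ω : Type*} [MeasurableSpace Ω] {P : Measure Ω} [IsProbabilityMeasure P]
  {Z : ℕ → Ω → Vec d × Vec p × ℝ}

/-- Asymptotic normality of estimators with a prediction-powered linearization. -/
theorem isAsympCov_of_linearization (hZ : IsIID P Z (dataLaw SX SW σ)) (hSX : SX.PosDef)
    (hSW : SW.PosSemidef) {N : ℕ → ℕ} (hN : ∀ n, 0 < N n) {r : ℝ}
    (hr : Tendsto (fun n : ℕ => (n : ℝ) / N n) atTop (𝓝 r)) (lam κ : ℝ)
    {est : ℕ → Ω → Vec d} (hest : ∀ n, Measurable (est n))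
    (hlin : Negligible P fun n ω => √(n : ℝ) • (est n ω - θ)
      - op SX⁻¹ (√(n : ℝ) • ((avg (labeled n) fun i => resid γ (Z i ω))
        - lam • ((avg (labeled n) fun i => imputed θ γ κ (Z i ω))
          - avg (unlabeled n (N n)) fun i => imputed θ γ κ (Z i ω))))) :
    IsAsympCov P est θ (asympCov SX SW σ θ γ r lam κ) := by
  have hr0 : 0 ≤ r := ge_of_tendsto' hr fun n => by positivity
  have hV := asympCov_posSemidef (σ := σ) (θ := θ) (γ := γ) hSX hSW hr0 lam κ
  refine ⟨hV, ?_⟩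
  have hfint : ∫ z, op SX⁻¹ (resid γ z) ∂(dataLaw SX SW σ) = 0 := by
    rw [ContinuousLinearMap.integral_comp_comm _ allMoments_resid.integrable, integral_resid,
      map_zero]
  have hclt := hZ.tendstoInDistribution_two_sample (f := fun z => op SX⁻¹ (resid γ z))
    (g := fun z => op SX⁻¹ (imputed θ γ κ z))
    ((op SX⁻¹).continuous.measurable.comp (measurable_resid γ))
    ((op SX⁻¹).continuous.measurable.comp (measurable_imputed θ γ κ))
    (allMoments_resid.clm_comp _).memLp_two ((allMoments_imputed κ).clm_comp _).memLp_two
    hfint hN hr lam hV (dotProduct_asympCov_mulVec hSX hSW r lam κ)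
  refine tendstoInDistribution_of_tendstoInMeasure_sub _ _ hclt ?_
    fun n => by have := hest n; fun_prop
  refine negligible_iff_tendstoInMeasure.1 (hlin.congr (Eventually.of_forall fun n ω => ?_))
  simp only [Pi.sub_apply]
  congr 1
  have hop : ∀ (D : Finset ℕ) (u : ℕ → Vec d), op SX⁻¹ (avg D u) = avg D fun i => op SX⁻¹ (u i) :=
    fun D u => map_avg (op SX⁻¹).toLinearMap D u
  simp only [map_smul, map_sub, hop]

lemma matTendsto_gram (hZ : IsIID P Z (dataLaw SX SW σ)) (hSX : SX.PosDef)
    {S : ℕ → Finset ℕ} (hS : Tendsto (fun n => (S n).card) atTop atTop) :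
    MatTendsto P (fun n ω => gram (S n) fun i => (Z i ω).1) SX := by
  refine matTendsto_of_entries fun a b => ?_
  have h := hZ.tendstoInMeasure_avg (h := fun z => z.1 a * z.1 b) (by fun_prop)
    ((allMoments_x.coord a).mul (allMoments_x.coord b)).memLp_two hS
  rw [integral_coord_mul_coord hSX.posSemidef] at h
  exact h

lemma measurable_gram_entry (hZm : ∀ i, Measurable (Z i)) (D : Finset ℕ) (a b : Fin d) :
    Measurable fun ω => gram D (fun i => (Z i ω).1) a b := by
  simp only [gram, Matrix.of_apply, avg]
  fun_prop

lemma measurable_avg {F : Type*} [NormedAddCommGroup F] [NormedSpace ℝ F] [MeasurableSpace F]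
    [BorelSpace F] [SecondCountableTopology F] {u : ℕ → Ω → F} (D : Finset ℕ)
    (hu : ∀ i, Measurable (u i)) :
    Measurable fun ω => avg D fun i => u i ω := by
  unfold avg; fun_prop

/-- Centred averages over a fixed proportion of the labeled data are of order `n^(-1/2)`. -/
lemma boundedInProb_avg {E : Type*} [MeasurableSpace E] {μ : Measure E} {Z : ℕ → Ω → E}
    (hZ : IsIID P Z μ) {h : E → Vec d} (hm : Measurable h)
    (hL : MemLp h 2 μ) (h0 : ∀ j, ∫ z, h z j ∂μ = 0) {S : ℕ → Finset ℕ} {C : ℝ}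
    (hC : ∀ᶠ n : ℕ in atTop, (n : ℝ) * ((S n).card : ℝ)⁻¹ ≤ C) :
    BoundedInProb P fun n ω => √(n : ℝ) • avg (S n) fun i => h (Z i ω) := by
  simp_rw [avg_eq_sum]
  refine hZ.boundedInProb_weighted_sum hm hL (Eventually.of_forall fun n => Or.inr h0) (C := C) ?_
  simpa only [sum_sq_inv_card] using hC

/-- Differences of labeled and unlabeled averages are of order `n^(-1/2)`. -/
lemma boundedInProb_avg_sub_avg {E : Type*} [MeasurableSpace E] {μ : Measure E} {Z : ℕ → Ω → E}
    (hZ : IsIID P Z μ) {h : E → Vec d} (hm : Measurable h)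
    (hL : MemLp h 2 μ) {S U : ℕ → Finset ℕ} (hSU : ∀ n, Disjoint (S n) (U n))
    (hS : ∀ᶠ n in atTop, (S n).Nonempty) (hU : ∀ᶠ n in atTop, (U n).Nonempty) {C : ℝ}
    (hC : ∀ᶠ n : ℕ in atTop, (n : ℝ) * (((S n).card : ℝ)⁻¹ + ((U n).card : ℝ)⁻¹) ≤ C) :
    BoundedInProb P fun n ω => √(n : ℝ) • ((avg (S n) fun i => h (Z i ω))
      - avg (U n) fun i => h (Z i ω)) := by
  simp_rw [avg_sub_avg_eq_sum (hSU _)]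
  refine hZ.boundedInProb_weighted_sum hm hL ?_ (C := C) ?_
  · filter_upwards [hS, hU] with n hS hU
    exact Or.inl (sum_weights_eq_zero (hSU n) hS hU)
  · simpa only [sum_sq_weights (hSU _)] using hC

/-- Asymptotic normality of the estimator with imputed loss `lamHat • ℓ`. -/
theorem isAsympCov_ppiEstimator (hZ : IsIID P Z (dataLaw SX SW σ)) (hSX : SX.PosDef)
    (hSW : SW.PosSemidef) {N : ℕ → ℕ} (hN : ∀ n, 0 < N n) {r : ℝ}
    (hr : Tendsto (fun n : ℕ => (n : ℝ) / N n) atTop (𝓝 r)) {lam : ℝ} {lamHat : ℕ → Ω → ℝ}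
    (hlm : ∀ n, Measurable (lamHat n))
    (hlam : TendstoInMeasure P lamHat atTop fun _ => lam) :
    IsAsympCov P (fun n ω => ppiEstimator (labeled n) (unlabeled n (N n)) (sqLoss d)
      (lamHat n ω • sqLoss d) (fun i => (Z i ω).1) (fun i => outcome θ γ (Z i ω))
      (fun i => prediction γ (Z i ω))) θ (asympCov SX SW σ θ γ r lam 1) := by
  have hZm := hZ.measurable
  have hNtop := tendsto_atTop_of_ratio hN hr
  have hgm : ∀ n a b, Measurable fun ω =>
      ppiGram (labeled n) (unlabeled n (N n)) (lamHat n ω) (fun i => (Z i ω).1) a b := by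
    intro n a b
    have h1 := measurable_gram_entry hZm (labeled n) a b
    have h2 := measurable_gram_entry hZm (unlabeled n (N n)) a b
    have h3 := hlm n
    simp only [ppiGram, Matrix.sub_apply, Matrix.smul_apply, smul_eq_mul]
    fun_prop
  have hgt : MatTendsto P (fun n ω => ppiGram (labeled n) (unlabeled n (N n)) (lamHat n ω)
      fun i => (Z i ω).1) SX := by
    have hL := matTendsto_gram hZ hSX (S := labeled)
      (by simp only [card_labeled]; exact tendsto_id)
    have hU := matTendsto_gram hZ hSX (S := fun n => unlabeled n (N n))
      (by simpa only [card_unlabeled] using hNtop)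
    refine matTendsto_of_entries fun a b => ?_
    have h := tendstoInMeasure_sub (hL.entry a b)
      (tendstoInMeasure_mul hlam (tendstoInMeasure_sub (hL.entry a b) (hU.entry a b)))
    simpa [ppiGram] using h
  -- An exact identity: subtracting `A θ` from `b` replaces Y by Y - ⟨X, θ⟩ and Ŷ by Ŷ - ⟨X, θ⟩ in
  -- every average, which is the case κ = 1.
  have hbeta : ∀ n ω, ((avg (labeled n) fun i => outcome θ γ (Z i ω) • (Z i ω).1)
        - lamHat n ω • ((avg (labeled n) fun i => prediction γ (Z i ω) • (Z i ω).1)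
          - avg (unlabeled n (N n)) fun i => prediction γ (Z i ω) • (Z i ω).1))
      - op (ppiGram (labeled n) (unlabeled n (N n)) (lamHat n ω) fun i => (Z i ω).1) θ
      = (avg (labeled n) fun i => resid γ (Z i ω))
        - lamHat n ω • ((avg (labeled n) fun i => imputed θ γ 1 (Z i ω))
          - avg (unlabeled n (N n)) fun i => imputed θ γ 1 (Z i ω)) := by
    intro n ω
    have e1 : ∀ z : Vec d × Vec p × ℝ, resid γ z
        = outcome θ γ z • z.1 - (inner ℝ z.1 θ : ℝ) • z.1 := fun z => by
      rw [resid, outcome, ← sub_smul]; congr 1; ring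
    have e2 : ∀ z : Vec d × Vec p × ℝ, imputed θ γ 1 z
        = prediction γ z • z.1 - (inner ℝ z.1 θ : ℝ) • z.1 := fun z => by
      rw [imputed, prediction, ← sub_smul, one_mul]
    simp only [e1, e2, avg_sub, op_ppiGram, op_gram]
    module
  have hlead : BoundedInProb P fun n ω => √(n : ℝ) • avg (labeled n) fun i => resid γ (Z i ω) :=
    boundedInProb_avg hZ (measurable_resid γ) allMoments_resid.memLp_two integral_resid_coord
      (C := 1) (Eventually.of_forall fun n => by rw [card_labeled]; exact mul_inv_le_one)
  have hdiff : BoundedInProb P fun n ω => √(n : ℝ) •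
      ((avg (labeled n) fun i => imputed θ γ 1 (Z i ω))
        - avg (unlabeled n (N n)) fun i => imputed θ γ 1 (Z i ω)) := by
    refine boundedInProb_avg_sub_avg hZ (measurable_imputed θ γ 1)
      (allMoments_imputed 1).memLp_two (fun n => labeled_disjoint_unlabeled n (N n)) ?_
      (Eventually.of_forall fun n => by simpa [unlabeled] using hN n) (C := 1 + (r + 1)) ?_
    · filter_upwards [eventually_gt_atTop 0] with n hn
      simpa [labeled] using hn.ne'
    · filter_upwards [hr.eventually (gt_mem_nhds (lt_add_one r))] with n hn
      rw [card_labeled, card_unlabeled, mul_add]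
      exact add_le_add mul_inv_le_one (by rw [← div_eq_mul_inv]; exact hn.le)
  -- Mere consistency of the tuning parameter suffices, with no rate: it multiplies a difference of
  -- averages that is itself of order n^(-1/2).
  have hprod : Negligible P fun n ω => (lamHat n ω - lam) • (√(n : ℝ) •
      ((avg (labeled n) fun i => imputed θ γ 1 (Z i ω))
        - avg (unlabeled n (N n)) fun i => imputed θ γ 1 (Z i ω))) :=
    (negligible_sub_const_iff.2 hlam).of_norm_le_mul hdiff
      (Eventually.of_forall fun n ω => (norm_smul _ _).le)
  have hlamB := boundedInProb_of_tendstoInMeasure hlam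
  have hbd : BoundedInProb P fun n ω => √(n : ℝ) • ((avg (labeled n) fun i => resid γ (Z i ω))
        - lamHat n ω • ((avg (labeled n) fun i => imputed θ γ 1 (Z i ω))
          - avg (unlabeled n (N n)) fun i => imputed θ γ 1 (Z i ω))) := by
    have h := hlead.sub (hlamB.of_norm_le_mul (h := fun n ω => lamHat n ω • (√(n : ℝ) •
      ((avg (labeled n) fun i => imputed θ γ 1 (Z i ω))
        - avg (unlabeled n (N n)) fun i => imputed θ γ 1 (Z i ω)))) hdiff
      (Eventually.of_forall fun n ω => (norm_smul _ _).le))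
    refine h.mono (Eventually.of_forall fun n ω => le_of_eq (congrArg norm ?_))
    module
  refine isAsympCov_of_linearization hZ hSX hSW hN hr lam 1 (fun n => ?_) ?_
  · simp only [ppiEstimator_smul_sqLoss]
    refine measurable_quadMin (hgm n) (fun ω => ppiGram_isHermitian _ _ _ _) ?_
    have hy := measurable_outcome θ γ
    have hyh := measurable_prediction (d := d) γ
    have h3 := hlm n
    exact (measurable_avg _ fun i => by fun_prop).sub
      (h3.smul ((measurable_avg _ fun i => by fun_prop).sub (measurable_avg _ fun i => by fun_prop)))
  · simp only [ppiEstimator_smul_sqLoss]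
    have h := negligible_quadMin_sub hgt hSX (fun n ω => ppiGram_isHermitian _ _ _ _)
      (b := fun n ω => (avg (labeled n) fun i => outcome θ γ (Z i ω) • (Z i ω).1)
        - lamHat n ω • ((avg (labeled n) fun i => prediction γ (Z i ω) • (Z i ω).1)
          - avg (unlabeled n (N n)) fun i => prediction γ (Z i ω) • (Z i ω).1)) θ
      (by simp only [hbeta]; exact hbd)
    simp only [hbeta] at h
    have hop : Negligible P fun n ω => op SX⁻¹ ((lamHat n ω - lam) • (√(n : ℝ) •
        ((avg (labeled n) fun i => imputed θ γ 1 (Z i ω))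
          - avg (unlabeled n (N n)) fun i => imputed θ γ 1 (Z i ω)))) :=
      hprod.of_norm_le_mul (boundedInProb_const (op SX⁻¹)) (Eventually.of_forall fun n ω => by
        rw [mul_comm]; exact ContinuousLinearMap.le_opNorm _ _)
    refine (h.sub hop).congr (Eventually.of_forall fun n ω => ?_)
    rw [sub_sub, ← map_add]
    congr 2
    module

end Asymptotics

/-! ### Root mean squares and sample covariances -/

section Rms

variable {d : ℕ}

/-- The root mean square of the vectors `u i`, `i ∈ D`. -/
def rms (D : Finset ℕ) (u : ℕ → Vec d) : ℝ := √(avg D fun i => ‖u i‖ ^ 2)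

lemma rms_nonneg (D : Finset ℕ) (u : ℕ → Vec d) : 0 ≤ rms D u := Real.sqrt_nonneg _

lemma avg_mono {D : Finset ℕ} {u v : ℕ → ℝ} (h : ∀ i ∈ D, u i ≤ v i) : avg D u ≤ avg D v :=
  mul_le_mul_of_nonneg_left (Finset.sum_le_sum h) (by positivity)

lemma avg_nonneg {D : Finset ℕ} {u : ℕ → ℝ} (h : ∀ i ∈ D, 0 ≤ u i) : 0 ≤ avg D u :=
  mul_nonneg (by positivity) (Finset.sum_nonneg h)

lemma rms_sq (D : Finset ℕ) (u : ℕ → Vec d) : rms D u ^ 2 = avg D fun i => ‖u i‖ ^ 2 :=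
  Real.sq_sqrt (avg_nonneg fun _ _ => sq_nonneg _)

lemma rms_le_mul {D : Finset ℕ} {u v : ℕ → Vec d} {c : ℝ} (hc : 0 ≤ c)
    (h : ∀ i ∈ D, ‖u i‖ ≤ c * ‖v i‖) : rms D u ≤ c * rms D v := by
  refine abs_le_of_sq_le_sq' ?_ (mul_nonneg hc (rms_nonneg D v)) |>.2
  rw [mul_pow, rms_sq, rms_sq, ← smul_eq_mul, ← avg_smul]
  refine avg_mono fun i hi => ?_
  rw [smul_eq_mul, ← mul_pow]
  exact pow_le_pow_left₀ (norm_nonneg _) (h i hi) 2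

lemma enorm_rms_sq (D : Finset ℕ) (u : ℕ → Vec d) :
    ‖rms D u‖ₑ ^ 2 = ENNReal.ofReal ((D.card : ℝ)⁻¹) * ∑ i ∈ D, ‖u i‖ₑ ^ 2 := by
  rw [← ofReal_norm, Real.norm_of_nonneg (rms_nonneg D u), ← ENNReal.ofReal_pow (rms_nonneg D u),
    rms_sq, avg, smul_eq_mul, ENNReal.ofReal_mul (by positivity),
    ENNReal.ofReal_sum_of_nonneg fun _ _ => sq_nonneg _]
  congr 1
  refine Finset.sum_congr rfl fun i _ => ?_
  rw [← ofReal_norm, ENNReal.ofReal_pow (norm_nonneg _)]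

lemma abs_coord_le_norm (v : Vec d) (a : Fin d) : |v a| ≤ ‖v‖ := PiLp.norm_apply_le v a

/-- The Cauchy–Schwarz inequality for the empirical measure on `D`. -/
lemma abs_avg_mul_le (D : Finset ℕ) (u v : ℕ → Vec d) (a b : Fin d) :
    |avg D fun i => u i a * v i b| ≤ rms D u * rms D v := by
  have h1 : |avg D fun i => u i a * v i b| ≤ (D.card : ℝ)⁻¹ * ∑ i ∈ D, ‖u i‖ * ‖v i‖ := by
    rw [avg, smul_eq_mul, abs_mul, abs_of_nonneg (by positivity : (0 : ℝ) ≤ (D.card : ℝ)⁻¹)]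
    refine mul_le_mul_of_nonneg_left ?_ (by positivity)
    refine (Finset.abs_sum_le_sum_abs _ _).trans (Finset.sum_le_sum fun i _ => ?_)
    rw [abs_mul]
    exact mul_le_mul (abs_coord_le_norm _ a) (abs_coord_le_norm _ b) (abs_nonneg _)
      (norm_nonneg _)
  refine h1.trans (abs_le_of_sq_le_sq' ?_ (mul_nonneg (rms_nonneg D u) (rms_nonneg D v)) |>.2)
  rw [mul_pow, mul_pow, rms_sq, rms_sq, avg, avg, smul_eq_mul, smul_eq_mul]
  have h2 := Finset.sum_mul_sq_le_sq_mul_sq D (fun i => ‖u i‖) (fun i => ‖v i‖)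
  calc ((D.card : ℝ)⁻¹) ^ 2 * (∑ i ∈ D, ‖u i‖ * ‖v i‖) ^ 2
      ≤ ((D.card : ℝ)⁻¹) ^ 2 * ((∑ i ∈ D, ‖u i‖ ^ 2) * ∑ i ∈ D, ‖v i‖ ^ 2) :=
        mul_le_mul_of_nonneg_left h2 (by positivity)
    _ = _ := by ring

lemma abs_avg_coord_le (D : Finset ℕ) (u : ℕ → Vec d) (a : Fin d) :
    |avg D fun i => u i a| ≤ rms D u := by
  refine abs_le_of_sq_le_sq ?_ (rms_nonneg D u)
  rw [rms_sq]
  have h1 : (avg D fun i => u i a) ^ 2 ≤ avg D fun i => u i a ^ 2 := by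
    rcases D.eq_empty_or_nonempty with rfl | hD
    · simp [avg]
    have hc : (0 : ℝ) < D.card := by exact_mod_cast hD.card_pos
    have h := sq_sum_le_card_mul_sum_sq (s := D) (f := fun i => u i a)
    rw [avg, avg, smul_eq_mul, smul_eq_mul, mul_pow]
    calc ((D.card : ℝ)⁻¹) ^ 2 * (∑ i ∈ D, u i a) ^ 2
        ≤ ((D.card : ℝ)⁻¹) ^ 2 * (D.card * ∑ i ∈ D, u i a ^ 2) :=
          mul_le_mul_of_nonneg_left h (by positivity)
      _ = _ := by field_simp
  refine h1.trans (avg_mono fun i _ => ?_)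
  rw [← sq_abs]
  exact pow_le_pow_left₀ (abs_nonneg _) (abs_coord_le_norm _ a) 2

lemma sampleCov_apply {D : Finset ℕ} (hD : D.Nonempty) (u v : ℕ → Vec d) (a b : Fin d) :
    sampleCov D u v a b
      = (avg D fun i => u i a * v i b) - (avg D fun i => u i a) * avg D fun i => v i b := by
  have hu : ∀ (w : ℕ → Vec d) c, sampleMean D w c = avg D fun i => w i c := fun w c =>
    avg_apply D w c
  have hc : ((D.card : ℝ)) ≠ 0 := by simpa using hD.ne_empty
  simp only [sampleCov, Matrix.of_apply, hu]
  set ma := avg D fun i => u i a with hma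
  set mb := avg D fun i => v i b with hmb
  have e : ∀ i, (u i a - ma) * (v i b - mb)
      = u i a * v i b - mb * u i a - ma * v i b + ma * mb := fun i => by ring
  have e2 : (D.card : ℝ)⁻¹ * ∑ i ∈ D, (u i a - ma) * (v i b - mb)
      = avg D fun i => u i a * v i b - mb * u i a - ma * v i b + ma * mb := by
    rw [avg, smul_eq_mul]
    simp_rw [e]
  rw [e2, avg_add, avg_sub, avg_sub, avg_const hD]
  simp only [← smul_eq_mul, avg_smul]
  simp only [smul_eq_mul] at *
  rw [← hma, ← hmb]
  ring

/-- Sample covariances are continuous with respect to the root mean square. -/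
lemma abs_sampleCov_add_sub_le {D : Finset ℕ} (hD : D.Nonempty) (u v h k : ℕ → Vec d)
    (a b : Fin d) :
    |sampleCov D (fun i => u i + h i) (fun i => v i + k i) a b - sampleCov D u v a b|
      ≤ 2 * (rms D h * rms D v + rms D u * rms D k + rms D h * rms D k) := by
  have hb : ∀ p q : ℕ → Vec d,
      |(avg D fun i => p i a * q i b) - (avg D fun i => p i a) * avg D fun i => q i b|
        ≤ 2 * (rms D p * rms D q) := fun p q => by
    have h1 := abs_avg_mul_le D p q a b
    have h2 := mul_le_mul (abs_avg_coord_le D p a) (abs_avg_coord_le D q b) (abs_nonneg _)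
      (rms_nonneg D p)
    rw [← abs_mul] at h2
    have h3 := abs_sub (avg D fun i => p i a * q i b)
      ((avg D fun i => p i a) * avg D fun i => q i b)
    linarith
  -- Bilinearity: three error covariances remain, each at most twice a product of root mean squares
  -- by `hb`.
  have e : sampleCov D (fun i => u i + h i) (fun i => v i + k i) a b - sampleCov D u v a b
      = ((avg D fun i => h i a * v i b) - (avg D fun i => h i a) * avg D fun i => v i b)
        + ((avg D fun i => u i a * k i b) - (avg D fun i => u i a) * avg D fun i => k i b)
        + ((avg D fun i => h i a * k i b) - (avg D fun i => h i a) * avg D fun i => k i b) := by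
    rw [sampleCov_apply hD, sampleCov_apply hD]
    simp only [PiLp.add_apply, add_mul, mul_add, avg_add]
    ring
  rw [e]
  refine (abs_add_three _ _ _).trans ?_
  linarith [hb h v, hb u k, hb h k]

end Rms

section RandomRms

variable {d : ℕ} {Ω E : Type*} [MeasurableSpace Ω] [MeasurableSpace E] {P : Measure Ω}
  {Z : ℕ → Ω → E} {μ : Measure E}

/-- By linearity the expected mean square is the second moment of `h`; there is equality for
nonempty `D`, and zero on the left for empty `D`. -/
lemma IsIID.lintegral_enorm_rms_sq_le (hZ : IsIID P Z μ) {h : E → Vec d} (hm : Measurable h)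
    (D : Finset ℕ) :
    ∫⁻ ω, ‖rms D fun i => h (Z i ω)‖ₑ ^ 2 ∂P ≤ ∫⁻ z, ‖h z‖ₑ ^ 2 ∂μ := by
  have hZm := hZ.measurable
  simp_rw [enorm_rms_sq]
  rw [lintegral_const_mul _ (by fun_prop), lintegral_finsetSum _ fun i _ => by fun_prop]
  rw [Finset.sum_congr rfl fun i _ => hZ.lintegral_comp i (h := fun z => ‖h z‖ₑ ^ 2) (by fun_prop)]
  rw [Finset.sum_const, nsmul_eq_mul, ← mul_assoc]
  refine mul_le_of_le_one_left zero_le ?_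
  rw [← ENNReal.ofReal_natCast, ← ENNReal.ofReal_mul (by positivity)]
  exact ENNReal.ofReal_le_one.2 inv_mul_le_one

lemma lintegral_enorm_sq_ne_top {h : E → Vec d} (hL : MemLp h 2 μ) :
    ∫⁻ z, ‖h z‖ₑ ^ 2 ∂μ ≠ ⊤ := by
  have := (eLpNorm_lt_top_iff_lintegral_rpow_enorm_lt_top (by norm_num) (by norm_num)).1 hL.2
  simpa using this.ne

lemma IsIID.boundedInProb_rms (hZ : IsIID P Z μ) {h : E → Vec d} (hm : Measurable h)
    (hL : MemLp h 2 μ) (S : ℕ → Finset ℕ) :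
    BoundedInProb P fun n ω => rms (S n) fun i => h (Z i ω) := by
  have hZm := hZ.measurable
  refine boundedInProb_of_lintegral_sq_le (fun n => ?_) (lintegral_enorm_sq_ne_top hL)
    (Eventually.of_forall fun n => hZ.lintegral_enorm_rms_sq_le hm (S n))
  unfold rms avg
  fun_prop

variable [IsProbabilityMeasure P]

/-- Consistency of sample covariances of perturbed vectors. -/
theorem IsIID.matTendsto_sampleCov (hZ : IsIID P Z μ) {f g : E → Vec d} (hfm : Measurable f)
    (hgm : Measurable g) (hf : AllMoments f μ) (hg : AllMoments g μ) {S : ℕ → Finset ℕ}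
    (hS : Tendsto (fun n => (S n).card) atTop atTop) {u v : ℕ → Ω → ℕ → Vec d}
    (hu : Negligible P fun n ω => rms (S n) fun i => u n ω i - f (Z i ω))
    (hv : Negligible P fun n ω => rms (S n) fun i => v n ω i - g (Z i ω)) :
    MatTendsto P (fun n ω => sampleCov (S n) (u n ω) (v n ω))
      (Matrix.of fun a b => ∫ z, f z a * g z b ∂μ - (∫ z, f z a ∂μ) * ∫ z, g z b ∂μ) := by
  refine matTendsto_of_entries fun a b => ?_
  have hmain : TendstoInMeasure P (fun n ω => (avg (S n) fun i => f (Z i ω) a * g (Z i ω) b)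
      - (avg (S n) fun i => f (Z i ω) a) * avg (S n) fun i => g (Z i ω) b) atTop
      fun _ => ∫ z, f z a * g z b ∂μ - (∫ z, f z a ∂μ) * ∫ z, g z b ∂μ :=
    tendstoInMeasure_sub
      (hZ.tendstoInMeasure_avg (h := fun z => f z a * g z b) (by fun_prop)
        ((hf.coord a).mul (hg.coord b)).memLp_two hS)
      (tendstoInMeasure_mul
        (hZ.tendstoInMeasure_avg (h := fun z => f z a) (by fun_prop) (hf.coord a).memLp_two hS)
        (hZ.tendstoInMeasure_avg (h := fun z => g z b) (by fun_prop) (hg.coord b).memLp_two hS))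
  have hmul : ∀ {x y : ℕ → Ω → ℝ}, Negligible P x → BoundedInProb P y →
      Negligible P fun n ω => x n ω * y n ω := fun hx hy =>
    hx.of_norm_le_mul hy (Eventually.of_forall fun n ω => (norm_mul _ _).le)
  have hbf := hZ.boundedInProb_rms hfm hf.memLp_two S
  have hbg := hZ.boundedInProb_rms hgm hg.memLp_two S
  have herr : Negligible P fun n ω =>
      2 * ((rms (S n) fun i => u n ω i - f (Z i ω)) * (rms (S n) fun i => g (Z i ω))
        + (rms (S n) fun i => v n ω i - g (Z i ω)) * (rms (S n) fun i => f (Z i ω))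
        + (rms (S n) fun i => u n ω i - f (Z i ω)) * (rms (S n) fun i => v n ω i - g (Z i ω))) := by
    have h := (((hmul hu hbg).add (hmul hv hbf)).add (hmul hu hv.boundedInProb))
    exact (h.add h).congr (Eventually.of_forall fun n ω => by ring)
  have hdiff : Negligible P fun n ω => sampleCov (S n) (u n ω) (v n ω) a b
      - ((avg (S n) fun i => f (Z i ω) a * g (Z i ω) b)
      - (avg (S n) fun i => f (Z i ω) a) * avg (S n) fun i => g (Z i ω) b) := by
    refine herr.mono ?_
    filter_upwards [hS.eventually_gt_atTop 0] with n hn ω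
    have hne := Finset.card_pos.1 hn
    have h := abs_sampleCov_add_sub_le hne (fun i => f (Z i ω)) (fun i => g (Z i ω))
      (fun i => u n ω i - f (Z i ω)) (fun i => v n ω i - g (Z i ω)) a b
    simp only [add_sub_cancel] at h
    rw [sampleCov_apply hne (fun i => f (Z i ω))] at h
    refine h.trans ((le_abs_self _).trans (le_of_eq ?_))
    rw [Real.norm_eq_abs]
    congr 1
    ring
  refine negligible_sub_const_iff.1
    ((hdiff.add (negligible_sub_const_iff.2 hmain)).congr (Eventually.of_forall fun n ω => ?_))
  simp only [Matrix.of_apply]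
  ring

end RandomRms

/-! ### Functions learnt on independent data -/

section Fresh

variable {Ω E : Type*} [MeasurableSpace Ω] [MeasurableSpace E] {P : Measure Ω}
  {Z : ℕ → Ω → E} {μ : Measure E}

open Classical in
/-- The extension of a finite family to a sequence. -/
def extendFamily (e₀ : E) (B : Finset ℕ) (z : B → E) (i : ℕ) : E :=
  if h : i ∈ B then z ⟨i, h⟩ else e₀

lemma measurable_extendFamily (e₀ : E) (B : Finset ℕ) : Measurable (extendFamily e₀ B) := by
  classical
  refine measurable_pi_lambda _ fun i => ?_
  by_cases h : i ∈ B
  · simpa only [extendFamily, h, dif_pos] using measurable_pi_apply (⟨i, h⟩ : B)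
  · simpa only [extendFamily, h, dif_neg, not_false_eq_true] using measurable_const

omit [MeasurableSpace E] in
lemma extendFamily_of_mem (e₀ : E) {B : Finset ℕ} (z : ℕ → E) {i : ℕ} (hi : i ∈ B) :
    extendFamily e₀ B (fun j => z j) i = z i := by
  simp [extendFamily, hi]

/-- Turns a conditional Chebyshev bound into unconditional negligibility. `I n` plays the part of
the random mean square error E‖ŝ - s⋆‖², which is only known to vanish in probability. -/
lemma negligible_of_conditional {F : Type*} [SeminormedAddCommGroup F] {f : ℕ → Ω → F}
    {I : ℕ → Ω → ℝ≥0∞} {C : ℝ≥0∞} (hC0 : C ≠ 0) (hC : C ≠ ⊤)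
    (hI : ∀ δ : ℝ≥0∞, 0 < δ → Tendsto (fun n => P {ω | δ ≤ I n ω}) atTop (𝓝 0))
    (h : ∀ δ : ℝ, 0 < δ → ∀ κ : ℝ≥0∞, ∀ᶠ n in atTop,
      P {ω | δ ≤ ‖f n ω‖} ≤ P {ω | κ ≤ C * I n ω} + κ / ENNReal.ofReal δ ^ 2) :
    Negligible P f := by
  refine negligible_of_eventually_forall fun δ hδ ε hε => ?_
  have hδ2 : ENNReal.ofReal δ ^ 2 ≠ 0 := by simpa using hδ
  by_cases hεt : ε = ⊤
  · simp [hεt]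
  -- This truncation level makes the Chebyshev term exactly `ε / 2`; the event that the conditional
  -- bound exceeds it eventually has probability at most `ε / 2`.
  set κ : ℝ≥0∞ := ε / 2 * ENNReal.ofReal δ ^ 2 with hκ
  have hκ0 : 0 < κ := ENNReal.mul_pos (ENNReal.half_pos hε.ne').ne' hδ2
  have hκδ : κ / ENNReal.ofReal δ ^ 2 = ε / 2 :=
    ENNReal.mul_div_cancel_right hδ2 (by finiteness)
  filter_upwards [h δ hδ κ, ENNReal.tendsto_nhds_zero.1 (hI (κ / C) (ENNReal.div_pos hκ0.ne' hC))
    (ε / 2) (ENNReal.half_pos hε.ne')] with n h1 h2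
  refine h1.trans ?_
  rw [hκδ, ← ENNReal.add_halves ε]
  refine add_le_add ((measure_mono fun ω hω => ?_).trans h2) (by rw [ENNReal.add_halves])
  rw [Set.mem_ofPred_eq, ENNReal.div_le_iff hC0 hC, mul_comm]
  exact hω

variable [IsProbabilityMeasure P]

/-- A Chebyshev bound for statistics `Ψ t z` of the data `z i`, `i ∈ B`, where the parameter `t`
is computed from independent data. -/
lemma measure_norm_ge_le_of_indepFun {𝒯 F : Type*} [MeasurableSpace 𝒯] [SeminormedAddCommGroup F]
    (hZm : ∀ i, Measurable (Z i)) (e₀ : E) {T : Ω → 𝒯} (hT : Measurable T) (B : Finset ℕ)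
    (hind : IndepFun T (fun ω (i : B) => Z i ω) P) {Ψ : 𝒯 → (ℕ → E) → F}
    (hΨ : Measurable fun q : 𝒯 × (ℕ → E) => ‖Ψ q.1 q.2‖ₑ)
    (hB : ∀ t z z', (∀ i ∈ B, z i = z' i) → Ψ t z = Ψ t z') {K : 𝒯 → ℝ≥0∞}
    (hK : ∀ t, ∫⁻ ω, ‖Ψ t fun i => Z i ω‖ₑ ^ 2 ∂P ≤ K t) {δ : ℝ} (hδ : 0 < δ) (κ : ℝ≥0∞) :
    P {ω | δ ≤ ‖Ψ (T ω) fun i => Z i ω‖} ≤ P {ω | κ ≤ K (T ω)} + κ / ENNReal.ofReal δ ^ 2 := by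
  have hZB : Measurable fun ω (i : B) => Z i ω := measurable_pi_lambda _ fun i => hZm i
  -- `Ψ` is given a whole sequence but reads only the entries in `B`, so the filler `e₀` never
  -- matters and `Ψ` becomes a function of the finite family that is independent of `T`.
  have hext : ∀ t ω, Ψ t (extendFamily e₀ B fun i : B => Z i ω) = Ψ t fun i => Z i ω := fun t ω =>
    hB t _ _ fun i hi => extendFamily_of_mem e₀ (fun j => Z j ω) hi
  have h := measure_le_of_indepFun hT hZB hind
    (G := fun q : 𝒯 × (B → E) => ‖Ψ q.1 (extendFamily e₀ B q.2)‖ₑ ^ 2)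
    ((hΨ.comp (measurable_fst.prodMk ((measurable_extendFamily e₀ B).comp
      measurable_snd))).pow_const 2)
    (δ := ENNReal.ofReal δ ^ 2) (κ := κ) (by simpa using hδ) (by finiteness)
  simp only [hext] at h
  refine (measure_mono fun ω hω => ?_).trans (h.trans (add_le_add_left (measure_mono ?_) _))
  · have : ENNReal.ofReal δ ≤ ‖Ψ (T ω) fun i => Z i ω‖ₑ := by
      rw [← ofReal_norm]; exact ENNReal.ofReal_le_ofReal hω
    exact pow_le_pow_left' this 2
  · exact fun ω hω => le_trans hω (hK (T ω))

/-- The joint law of the three variables is a product of three measures, and products are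
associative. -/
lemma indepFun_prodMk_of_indepFun {α β γ : Type*} [MeasurableSpace α] [MeasurableSpace β]
    [MeasurableSpace γ] {U : Ω → α} {V : Ω → β} {W : Ω → γ} (hU : Measurable U)
    (hV : Measurable V) (hW : Measurable W) (h : IndepFun U (fun ω => (V ω, W ω)) P)
    (hVW : IndepFun V W P) : IndepFun (fun ω => (U ω, V ω)) W P := by
  have e1 := (indepFun_iff_map_prod_eq_prod_map_map hU.aemeasurable
    (hV.prodMk hW).aemeasurable).1 h
  have e2 := (indepFun_iff_map_prod_eq_prod_map_map hV.aemeasurable hW.aemeasurable).1 hVW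
  have e3 := (indepFun_iff_map_prod_eq_prod_map_map hU.aemeasurable hV.aemeasurable).1
    (h.comp measurable_id measurable_fst : IndepFun (id ∘ U) (Prod.fst ∘ fun ω => (V ω, W ω)) P)
  refine (indepFun_iff_map_prod_eq_prod_map_map (hU.prodMk hV).aemeasurable hW.aemeasurable).2 ?_
  have : IsProbabilityMeasure (P.map U) := Measure.isProbabilityMeasure_map hU.aemeasurable
  have : IsProbabilityMeasure (P.map V) := Measure.isProbabilityMeasure_map hV.aemeasurable
  have : IsProbabilityMeasure (P.map W) := Measure.isProbabilityMeasure_map hW.aemeasurable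
  have e4 : (fun ω => ((U ω, V ω), W ω))
      = (MeasurableEquiv.prodAssoc (α := α) (β := β) (γ := γ)).symm
        ∘ fun ω => (U ω, (V ω, W ω)) := rfl
  have e3' : P.map (fun ω => (U ω, V ω)) = (P.map U).prod (P.map V) := e3
  rw [e4, ← Measure.map_map (MeasurableEquiv.measurable _) (hU.prodMk (hV.prodMk hW)), e1, e2, e3']
  rw [← Measure.prodAssoc_prod, Measure.map_map (MeasurableEquiv.measurable _)
    (MeasurableEquiv.measurable _), MeasurableEquiv.symm_comp_self, Measure.map_id]

/-- Data on disjoint sets are independent, also jointly with an independent seed. -/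
lemma IsIID.indepFun_seed {𝒰 : Type*} [MeasurableSpace 𝒰] (hZ : IsIID P Z μ) {seed : Ω → 𝒰}
    (hseed : Measurable seed) (hind : IndepFun seed (fun ω i => Z i ω) P) {S B : Finset ℕ}
    (hSB : Disjoint S B) :
    IndepFun (fun ω => (seed ω, fun i : S => Z i ω)) (fun ω (i : B) => Z i ω) P := by
  have hZm := hZ.measurable
  refine indepFun_prodMk_of_indepFun hseed (measurable_pi_lambda _ fun i => hZm i)
    (measurable_pi_lambda _ fun i => hZm i) ?_ (hZ.indep.indepFun_finset S B hSB hZm)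
  exact hind.comp measurable_id
    (ψ := fun z : ℕ → E => ((fun i : S => z i), (fun i : B => z i))) (by fun_prop)

end Fresh

/-! ### Folds -/

section Folds

variable {fold : ℕ → ℕ → Fin 3}

lemma foldSet_disjoint (fold : ℕ → ℕ → Fin 3) (n : ℕ) {k k' : Fin 3} (h : k ≠ k') :
    Disjoint (foldSet fold n k) (foldSet fold n k') := by
  rw [Finset.disjoint_left]
  intro i hi hi'
  simp only [foldSet, Finset.mem_filter] at hi hi'
  exact h (hi.2.symm.trans hi'.2)

lemma foldSet_disjoint_unlabeled (fold : ℕ → ℕ → Fin 3) (n N : ℕ) (k : Fin 3) :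
    Disjoint (foldSet fold n k) (unlabeled n N) :=
  (labeled_disjoint_unlabeled n N).mono_left (Finset.filter_subset _ _)

lemma sum_foldSet {F : Type*} [AddCommMonoid F] (fold : ℕ → ℕ → Fin 3) (n : ℕ) (u : ℕ → F) :
    ∑ k, ∑ i ∈ foldSet fold n k, u i = ∑ i ∈ labeled n, u i :=
  Finset.sum_fiberwise (labeled n) (fold n) u

lemma sum_card_foldSet (fold : ℕ → ℕ → Fin 3) (n : ℕ) :
    ∑ k, (foldSet fold n k).card = n := by
  have h := sum_foldSet fold n (fun _ => 1)
  simpa [card_labeled] using h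

/-- Each of the other two folds exceeds the given one by at most one point. -/
lemma le_card_foldSet (hfold : ∀ n k k',
      (foldSet fold n k).card ≤ (foldSet fold n k').card + 1) (n : ℕ) (k : Fin 3) :
    n ≤ 3 * (foldSet fold n k).card + 2 := by
  have h := sum_card_foldSet fold n
  rw [Fin.sum_univ_three] at h
  have h0 := hfold n 0 k
  have h1 := hfold n 1 k
  have h2 := hfold n 2 k
  have hk : ∀ j : Fin 3, j = 0 ∨ j = 1 ∨ j = 2 := by decide
  rcases hk k with rfl | rfl | rfl <;> omega

lemma tendsto_card_foldSet (hfold : ∀ n k k',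
      (foldSet fold n k).card ≤ (foldSet fold n k').card + 1) (k : ℕ → Fin 3) :
    Tendsto (fun n => (foldSet fold n (k n)).card) atTop atTop := by
  refine tendsto_atTop.2 fun m => ?_
  filter_upwards [eventually_ge_atTop (3 * m + 2)] with n hn
  have := le_card_foldSet hfold n (k n)
  omega

lemma mul_inv_card_foldSet_le (hfold : ∀ n k k',
      (foldSet fold n k).card ≤ (foldSet fold n k').card + 1) (k : Fin 3) :
    ∀ᶠ n : ℕ in atTop, (n : ℝ) * ((foldSet fold n k).card : ℝ)⁻¹ ≤ 5 := by
  -- From `n ≥ 5` on each fold has at least one point, so `3 * card + 2 ≤ 5 * card`.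
  filter_upwards [eventually_ge_atTop 5] with n hn
  have h := le_card_foldSet hfold n k
  have h1 : 1 ≤ (foldSet fold n k).card := by omega
  have h2 : n ≤ 5 * (foldSet fold n k).card := by omega
  have h3 : (0 : ℝ) < (foldSet fold n k).card := by exact_mod_cast h1
  rw [← div_eq_mul_inv, div_le_iff₀ h3]
  exact_mod_cast h2

/-- The average over the labeled data is a weighted average of the averages over the folds. -/
lemma sum_card_smul_avg_foldSet {F : Type*} [AddCommGroup F] [Module ℝ F]
    (fold : ℕ → ℕ → Fin 3) (n : ℕ) (u : ℕ → F) :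
    ∑ k, (((foldSet fold n k).card : ℝ) / n) • avg (foldSet fold n k) u = avg (labeled n) u := by
  have h : ∀ k, (((foldSet fold n k).card : ℝ) / n) • avg (foldSet fold n k) u
      = (n : ℝ)⁻¹ • ∑ i ∈ foldSet fold n k, u i := fun k => by
    rcases (foldSet fold n k).eq_empty_or_nonempty with he | hne
    · simp [he, avg]
    · have : ((foldSet fold n k).card : ℝ) ≠ 0 := by simpa using hne.ne_empty
      rw [avg, smul_smul]
      congr 1
      field_simp
  simp_rw [h]
  rw [← Finset.smul_sum, sum_foldSet, avg, card_labeled]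

end Folds

/-! ### Sample statistics of functions learnt on independent data. -/

section Fresh

variable {Ω E : Type*} [MeasurableSpace Ω] [MeasurableSpace E] {P : Measure Ω}
  [IsProbabilityMeasure P] {Z : ℕ → Ω → E} {μ : Measure E} {d : ℕ}

/-- Functions that are learnt on independent data and are small in mean square are small in mean
square on the sample. -/
lemma IsIID.negligible_rms_of_indepFun (hZ : IsIID P Z μ) (e₀ : E) {𝒯 : ℕ → Type*}
    [∀ n, MeasurableSpace (𝒯 n)] {T : ∀ n, Ω → 𝒯 n} (hT : ∀ n, Measurable (T n)) {D : ℕ → Finset ℕ}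
    (hind : ∀ n, IndepFun (T n) (fun ω (i : D n) => Z i ω) P) {h : ∀ n, 𝒯 n → E → Vec d}
    (hm : ∀ n, Measurable fun q : 𝒯 n × E => h n q.1 q.2)
    (hI : ∀ δ : ℝ≥0∞, 0 < δ →
      Tendsto (fun n => P {ω | δ ≤ ∫⁻ z, ‖h n (T n ω) z‖ₑ ^ 2 ∂μ}) atTop (𝓝 0)) :
    Negligible P fun n ω => rms (D n) fun i => h n (T n ω) (Z i ω) := by
  refine negligible_of_conditional one_ne_zero ENNReal.one_ne_top hI fun δ hδ κ =>
    Eventually.of_forall fun n => ?_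
  have hi : ∀ i, Measurable fun q : 𝒯 n × (ℕ → E) => h n q.1 (q.2 i) := fun i =>
    (hm n).comp (measurable_fst.prodMk ((measurable_pi_apply i).comp measurable_snd))
  simp only [one_mul]
  refine measure_norm_ge_le_of_indepFun hZ.measurable e₀ (hT n) (D n) (hind n)
    (Ψ := fun t z => rms (D n) fun i => h n t (z i)) (by unfold rms avg; fun_prop)
    (fun t z z' hz => ?_) (K := fun t => ∫⁻ z, ‖h n t z‖ₑ ^ 2 ∂μ) (fun t => ?_) hδ κ
  · exact congrArg Real.sqrt (avg_congr fun i hi => by simp only [hz i hi])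
  · exact hZ.lintegral_enorm_rms_sq_le ((hm n).comp measurable_prodMk_left) (D n)

/-- For functions that are learnt on independent data and are small in mean square, the differences
of averages are of smaller order than `n^(-1/2)`. -/
lemma IsIID.negligible_avg_sub_avg_of_indepFun (hZ : IsIID P Z μ) (e₀ : E) {𝒯 : ℕ → Type*}
    [∀ n, MeasurableSpace (𝒯 n)] {T : ∀ n, Ω → 𝒯 n} (hT : ∀ n, Measurable (T n))
    {D U : ℕ → Finset ℕ} (hDU : ∀ n, Disjoint (D n) (U n))
    (hD : ∀ᶠ n in atTop, (D n).Nonempty) (hU : ∀ᶠ n in atTop, (U n).Nonempty) {C : ℝ}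
    (hC0 : 0 < C)
    (hC : ∀ᶠ n : ℕ in atTop, (n : ℝ) * (((D n).card : ℝ)⁻¹ + ((U n).card : ℝ)⁻¹) ≤ C)
    (hind : ∀ n, IndepFun (T n) (fun ω (i : (D n ∪ U n : Finset ℕ)) => Z i ω) P)
    {h : ∀ n, 𝒯 n → E → Vec d} (hm : ∀ n, Measurable fun q : 𝒯 n × E => h n q.1 q.2)
    (hI : ∀ δ : ℝ≥0∞, 0 < δ →
      Tendsto (fun n => P {ω | δ ≤ ∫⁻ z, ‖h n (T n ω) z‖ₑ ^ 2 ∂μ}) atTop (𝓝 0)) :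
    Negligible P fun n ω => √(n : ℝ) • ((avg (D n) fun i => h n (T n ω) (Z i ω))
      - avg (U n) fun i => h n (T n ω) (Z i ω)) := by
  refine negligible_of_conditional (C := ENNReal.ofReal C) (by simpa using hC0)
    ENNReal.ofReal_ne_top hI fun δ hδ κ => ?_
  filter_upwards [hD, hU, hC] with n hDn hUn hCn
  have hi : ∀ i, Measurable fun q : 𝒯 n × (ℕ → E) => h n q.1 (q.2 i) := fun i =>
    (hm n).comp (measurable_fst.prodMk ((measurable_pi_apply i).comp measurable_snd))
  refine measure_norm_ge_le_of_indepFun hZ.measurable e₀ (hT n) (D n ∪ U n) (hind n)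
    (Ψ := fun t z => √(n : ℝ) • ((avg (D n) fun i => h n t (z i)) - avg (U n) fun i => h n t (z i)))
    (by unfold avg; fun_prop) (fun t z z' hz => ?_)
    (K := fun t => ENNReal.ofReal C * ∫⁻ z, ‖h n t z‖ₑ ^ 2 ∂μ) (fun t => ?_) hδ κ
  · rw [avg_congr (D := D n) fun i hi => by rw [hz i (Finset.mem_union_left _ hi)],
      avg_congr (D := U n) fun i hi => by rw [hz i (Finset.mem_union_right _ hi)]]
  · have hb := hZ.lintegral_sq_weighted_sum_le ((hm n).comp (measurable_prodMk_left (x := t)))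
      (D n ∪ U n)
      -- The factor √n is absorbed into the weights. They still sum to zero, so the learnt function
      -- need not be centred, and their squares sum to `n (1/|D| + 1/|U|)`, which is at most `C`.
      (fun i => √(n : ℝ) * if i ∈ D n then ((D n).card : ℝ)⁻¹ else -((U n).card : ℝ)⁻¹)
      (Or.inl (by rw [← Finset.mul_sum, sum_weights_eq_zero (hDU n) hDn hUn, mul_zero]))
    simp only [mul_pow, ← Finset.mul_sum, sum_sq_weights (hDU n),
      Real.sq_sqrt (Nat.cast_nonneg n)] at hb
    simp only [avg_sub_avg_eq_sum (hDU n), Finset.smul_sum, smul_smul]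
    exact hb.trans (mul_le_mul_left (ENNReal.ofReal_le_ofReal hCn) _)

end Fresh

/-! ### Second moments that determine the limit of the tuning matrix. -/

section Moments

variable {d p : ℕ} {SX : Matrix (Fin d) (Fin d) ℝ} {SW : Matrix (Fin p) (Fin p) ℝ} {σ : ℝ≥0}

lemma integral_noise_mul (hSW : SW.PosSemidef) (γ : Vec p) (β : ℝ) :
    ∫ y, (inner ℝ y.1 γ + β * y.2) * inner ℝ y.1 γ
      ∂((multivariateGaussian 0 SW).prod (gaussianReal 0 (σ ^ 2))) = quadForm SW γ := by
  have hw : AllMoments (fun y : Vec p × ℝ => inner ℝ y.1 γ)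
      ((multivariateGaussian 0 SW).prod (gaussianReal 0 (σ ^ 2))) :=
    (allMoments_inner_multivariateGaussian γ).comp_fst
  have he : AllMoments (fun y : Vec p × ℝ => y.2)
      ((multivariateGaussian 0 SW).prod (gaussianReal 0 (σ ^ 2))) :=
    (allMoments_id_of_isGaussian (gaussianReal 0 (σ ^ 2))).comp_snd
  have hi : ∀ α β : ℝ, Integrable (fun y : Vec p × ℝ => (α * inner ℝ y.1 γ + β * y.2) ^ 2)
      ((multivariateGaussian 0 SW).prod (gaussianReal 0 (σ ^ 2))) := fun α β =>
    ((hw.const_mul α).add (he.const_mul β)).memLp_two.integrable_sq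
  -- The product is written as a difference of squares so that `integral_noise_sq` gives both
  -- integrals.
  have e : ∀ y : Vec p × ℝ, (inner ℝ y.1 γ + β * y.2) * inner ℝ y.1 γ
      = 4⁻¹ * (2 * inner ℝ y.1 γ + β * y.2) ^ 2 - 4⁻¹ * (0 * inner ℝ y.1 γ + β * y.2) ^ 2 :=
    fun y => by ring
  simp_rw [e]
  rw [integral_sub ((hi 2 β).const_mul _) ((hi 0 β).const_mul _), integral_const_mul,
    integral_const_mul, integral_noise_sq hSW, integral_noise_sq hSW]
  ring

/-- The right side is free of `β` because ε is centred and independent of W. Hence the cross moment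
of the residual moment with Ŷ X (`β = 1`) equals the second moment of Ŷ X (`β = 0`), which is why
the tuning matrix tends to the identity. -/
lemma integral_noise_smul_coord_mul (hSX : SX.PosSemidef) (hSW : SW.PosSemidef) (γ : Vec p) (β : ℝ)
    (a b : Fin d) :
    ∫ z, (((inner ℝ z.2.1 γ + β * z.2.2 : ℝ) • z.1 : Vec d) a)
      * (((inner ℝ z.2.1 γ : ℝ) • z.1 : Vec d) b) ∂(dataLaw SX SW σ)
      = quadForm SW γ * SX a b := by
  have e : ∀ z : Vec d × Vec p × ℝ, (((inner ℝ z.2.1 γ + β * z.2.2 : ℝ) • z.1 : Vec d) a)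
      * (((inner ℝ z.2.1 γ : ℝ) • z.1 : Vec d) b)
      = (z.1 a * z.1 b) * ((inner ℝ z.2.1 γ + β * z.2.2) * inner ℝ z.2.1 γ) := fun z => by
    simp only [PiLp.smul_apply, smul_eq_mul]
    ring
  have hx := integral_coord_mul_coord (SW := SW) (σ := σ) hSX a b
  have h2 := integral_prod_mul (μ := multivariateGaussian 0 SX)
    (ν := (multivariateGaussian 0 SW).prod (gaussianReal 0 (σ ^ 2)))
    (fun x : Vec d => x a * x b) (fun y => (inner ℝ y.1 γ + β * y.2) * inner ℝ y.1 γ)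
  simp_rw [e]
  rw [dataLaw, integral_fun_fst (fun x : Vec d => x a * x b), probReal_univ, one_smul] at hx
  rw [dataLaw, h2, integral_noise_mul hSW, mul_comm, hx]

lemma integral_imputed_zero_coord (θ : Vec d) (γ : Vec p) (b : Fin d) :
    ∫ z, imputed θ γ 0 z b ∂(dataLaw SX SW σ) = 0 := by
  have h := integral_inner_mul_noise (SX := SX) (SW := SW) (σ := σ) (EuclideanSpace.single b 1) γ 1 0
  refine (integral_congr_ae (Eventually.of_forall fun z => ?_)).trans h
  simp [imputed, EuclideanSpace.inner_single_right, mul_comm]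

end Moments

lemma lossGrad_sqLoss {d : ℕ} (ϑ x : Vec d) (y : ℝ) :
    lossGrad (sqLoss d) ϑ x y = (-2 * (y - inner ℝ x ϑ)) • x := by
  refine HasGradientAt.gradient ?_
  rw [hasGradientAt_iff_hasFDerivAt]
  have h1 : HasFDerivAt (fun t : Vec d => y - inner ℝ x t) (-(innerSL ℝ x)) ϑ :=
    ((innerSL ℝ x).hasFDerivAt).const_sub y
  refine (h1.pow 2).congr_fderiv ?_
  ext v
  simp

/-! ### One round of cross-fitting. -/

section Round

variable {d p : ℕ} {SX : Matrix (Fin d) (Fin d) ℝ} {SW : Matrix (Fin p) (Fin p) ℝ} {σ : ℝ≥0}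
  {θ : Vec d} {γ : Vec p}
  {Ω : Type*} [MeasurableSpace Ω] {P : Measure Ω}
  {Z : ℕ → Ω → Vec d × Vec p × ℝ}

lemma BoundedInProb.op_apply {A : Matrix (Fin d) (Fin d) ℝ} {v : ℕ → Ω → Vec d}
    (hv : BoundedInProb P v) : BoundedInProb P fun n ω => op A (v n ω) :=
  (boundedInProb_const (P := P) (op A)).of_norm_le_mul hv
    (Eventually.of_forall fun _ _ => ContinuousLinearMap.le_opNorm _ _)

lemma Negligible.op_apply {A : Matrix (Fin d) (Fin d) ℝ} {v : ℕ → Ω → Vec d}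
    (hv : Negligible P v) : Negligible P fun n ω => op A (v n ω) :=
  hv.of_norm_le_mul (boundedInProb_const (P := P) (op A))
    (Eventually.of_forall fun _ _ => by rw [mul_comm]; exact ContinuousLinearMap.le_opNorm _ _)

lemma BoundedInProb.const_smul {v : ℕ → Ω → Vec d} (c : ℝ)
    (hv : BoundedInProb P v) : BoundedInProb P fun n ω => c • v n ω :=
  (boundedInProb_const (P := P) c).of_norm_le_mul hv
    (Eventually.of_forall fun _ _ => (norm_smul _ _).le)

lemma outcome_smul (z : Vec d × Vec p × ℝ) :
    outcome θ γ z • z.1 = resid γ z + (inner ℝ z.1 θ : ℝ) • z.1 := by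
  rw [resid, outcome, ← add_smul]
  congr 1
  ring

lemma avg_outcome_smul (D : Finset ℕ) (z : ℕ → Vec d × Vec p × ℝ) :
    (avg D fun i => outcome θ γ (z i) • (z i).1)
      = (avg D fun i => resid γ (z i)) + op (gram D fun i => (z i).1) θ := by
  simp only [outcome_smul, avg_add, op_gram]

variable [IsProbabilityMeasure P]

/-- The empirical risk minimizer is consistent. -/
lemma negligible_xyEstimator_sub (hZ : IsIID P Z (dataLaw SX SW σ)) (hSX : SX.PosDef)
    {D : ℕ → Finset ℕ} (hD : Tendsto (fun n => (D n).card) atTop atTop) {C : ℝ}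
    (hC : ∀ᶠ n : ℕ in atTop, (n : ℝ) * ((D n).card : ℝ)⁻¹ ≤ C) :
    Negligible P fun n ω => xyEstimator (D n) (sqLoss d) (fun i => (Z i ω).1)
      (fun i => outcome θ γ (Z i ω)) - θ := by
  simp only [xyEstimator_sqLoss]
  have hb : ∀ n ω, (avg (D n) fun i => outcome θ γ (Z i ω) • (Z i ω).1)
      - op (gram (D n) fun i => (Z i ω).1) θ = avg (D n) fun i => resid γ (Z i ω) := fun n ω => by
    rw [avg_outcome_smul (z := fun i => Z i ω)]; abel
  have hres := boundedInProb_avg hZ (measurable_resid γ) allMoments_resid.memLp_two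
    integral_resid_coord hC
  have h := negligible_quadMin_sub (matTendsto_gram hZ hSX hD) hSX
    (fun n ω => gram_isHermitian (D n) _)
    (b := fun n ω => avg (D n) fun i => outcome θ γ (Z i ω) • (Z i ω).1) θ
    (by simp only [hb]; exact hres)
  simp only [hb] at h
  -- The linearization shows that √n times the error is bounded in probability; multiplying by
  -- n^(-1/2) gives consistency.
  have hs : Tendsto (fun n : ℕ => (√(n : ℝ))⁻¹) atTop (𝓝 0) :=
    tendsto_inv_atTop_zero.comp (Real.tendsto_sqrt_atTop.comp tendsto_natCast_atTop_atTop)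
  refine (negligible_of_tendsto hs).of_norm_le_mul 
    (h.boundedInProb.add (hres.op_apply (A := SX⁻¹))) ?_
  filter_upwards [eventually_gt_atTop 0] with n hn ω
  have hn' : √(n : ℝ) ≠ 0 := (Real.sqrt_pos.2 (by exact_mod_cast hn)).ne'
  rw [← norm_smul, sub_add_cancel, smul_smul, inv_mul_cancel₀ hn', one_smul]

/-- If the learnt function is close to the conditional mean `-2 Ŷ X` of the gradient, the tuning
matrix is close to the identity. -/
lemma matTendsto_tuningMatrix (hZ : IsIID P Z (dataLaw SX SW σ)) (hSX : SX.PosDef)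
    (hSW : SW.PosSemidef) (hγ : 0 < quadForm SW γ) {D : ℕ → Finset ℕ}
    (hD : Tendsto (fun n => (D n).card) atTop atTop) {ϑ : ℕ → Ω → Vec d}
    (hϑ : Negligible P fun n ω => ϑ n ω - θ) {s : ℕ → Ω → Vec d × ℝ → Vec d}
    (hs : Negligible P fun n ω => rms (D n) fun i =>
      s n ω ((Z i ω).1, prediction γ (Z i ω)) - (-2 : ℝ) • imputed θ γ 0 (Z i ω)) :
    MatTendsto P (fun n ω => tuningMatrix (sqLoss d) (D n) (ϑ n ω) (s n ω) (fun i => (Z i ω).1)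
      (fun i => outcome θ γ (Z i ω)) (fun i => prediction γ (Z i ω))) 1 := by
  have hmr : Measurable fun z : Vec d × Vec p × ℝ => (-2 : ℝ) • resid γ z :=
    (measurable_resid γ).const_smul (-2 : ℝ)
  have hmi : Measurable fun z : Vec d × Vec p × ℝ => (-2 : ℝ) • imputed θ γ 0 z :=
    (measurable_imputed θ γ 0).const_smul (-2 : ℝ)
  have hgrad : Negligible P fun n ω => rms (D n) fun i =>
      lossGrad (sqLoss d) (ϑ n ω) (Z i ω).1 (outcome θ γ (Z i ω)) - (-2 : ℝ) • resid γ (Z i ω) := by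
    have hx := hZ.boundedInProb_rms (h := fun z => ‖z.1‖ • z.1) (by fun_prop)
      (allMoments_x.norm.smul allMoments_x).memLp_two D
    -- The gradients at `ϑ n` and at `θ` differ by 2⟨X, ϑ n - θ⟩ X, of norm at most ‖2 (ϑ n - θ)‖
    -- ‖X‖². This holds pointwise, so it requires no independence of `ϑ n` from the points in `D n`;
    -- the sum `hϑ.add hϑ` supplies the factor 2.
    refine (hϑ.add hϑ).of_norm_le_mul hx (Eventually.of_forall fun n ω => ?_)
    rw [Real.norm_of_nonneg (rms_nonneg _ _), Real.norm_of_nonneg (rms_nonneg _ _)]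
    refine rms_le_mul (norm_nonneg _) fun i _ => ?_
    have e : lossGrad (sqLoss d) (ϑ n ω) (Z i ω).1 (outcome θ γ (Z i ω))
        - (-2 : ℝ) • resid γ (Z i ω)
        = (inner ℝ (Z i ω).1 (ϑ n ω - θ + (ϑ n ω - θ)) : ℝ) • (Z i ω).1 := by
      rw [lossGrad_sqLoss, resid, smul_smul, ← sub_smul, outcome]
      congr 1
      simp only [inner_add_right, inner_sub_right]
      ring
    rw [e, norm_smul, norm_smul, norm_norm, ← mul_assoc]
    refine mul_le_mul_of_nonneg_right ?_ (norm_nonneg _)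
    rw [mul_comm]
    exact norm_inner_le_norm _ _
  have h0 : ∀ b : Fin d, ∫ z, ((-2 : ℝ) • imputed θ γ 0 z) b ∂(dataLaw SX SW σ) = 0 := fun b => by
    simp only [PiLp.smul_apply, smul_eq_mul, integral_const_mul, integral_imputed_zero_coord,
      mul_zero]
  -- Stated for both values of `β`: with `β = 1` it gives the limit of the cross-covariance, with `β
  -- = 0` that of the covariance of the learnt function. The two limits agree, and `hγ` makes them
  -- invertible.
  have hq : ∀ (β : ℝ) (f : Vec d × Vec p × ℝ → Vec d),
      (∀ z, f z = (inner ℝ z.2.1 γ + β * z.2.2 : ℝ) • z.1) →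
      (4 * quadForm SW γ) • SX = Matrix.of fun a b : Fin d =>
        (∫ z, ((-2 : ℝ) • f z) a * ((-2 : ℝ) • imputed θ γ 0 z) b ∂(dataLaw SX SW σ))
          - (∫ z, ((-2 : ℝ) • f z) a ∂(dataLaw SX SW σ))
            * ∫ z, ((-2 : ℝ) • imputed θ γ 0 z) b ∂(dataLaw SX SW σ) := fun β f hf => by
    ext a b
    have e : ∀ z : Vec d × Vec p × ℝ, ((-2 : ℝ) • f z) a * ((-2 : ℝ) • imputed θ γ 0 z) b
        = 4 * ((((inner ℝ z.2.1 γ + β * z.2.2 : ℝ) • z.1 : Vec d) a)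
          * (((inner ℝ z.2.1 γ : ℝ) • z.1 : Vec d) b)) := fun z => by
      simp only [hf, imputed, PiLp.smul_apply, smul_eq_mul]
      ring
    simp only [Matrix.of_apply, e, h0, integral_const_mul, Matrix.smul_apply, smul_eq_mul,
      integral_noise_smul_coord_mul hSX.posSemidef hSW]
    ring
  have hpos : ((4 * quadForm SW γ) • SX).PosDef := hSX.smul (by positivity)
  have hdet : IsUnit ((4 * quadForm SW γ) • SX).det := hpos.det_pos.ne'.isUnit
  have hA := hZ.matTendsto_sampleCov hmr hmi (allMoments_resid.const_smul (-2 : ℝ))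
    ((allMoments_imputed 0).const_smul (-2 : ℝ)) hD
    (u := fun n ω i => lossGrad (sqLoss d) (ϑ n ω) (Z i ω).1 (outcome θ γ (Z i ω)))
    (v := fun n ω i => s n ω ((Z i ω).1, prediction γ (Z i ω))) hgrad hs
  have hC := hZ.matTendsto_sampleCov hmi hmi ((allMoments_imputed 0).const_smul (-2 : ℝ))
    ((allMoments_imputed 0).const_smul (-2 : ℝ)) hD
    (u := fun n ω i => s n ω ((Z i ω).1, prediction γ (Z i ω)))
    (v := fun n ω i => s n ω ((Z i ω).1, prediction γ (Z i ω))) hs hs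
  rw [← hq 1 (resid γ) fun z => by rw [resid, one_mul]] at hA
  rw [← hq 0 (imputed θ γ 0) fun z => by rw [imputed, zero_mul, zero_mul, add_zero, sub_zero]] at hC
  have h := hA.mul (hC.inv hdet)
  rw [Matrix.mul_nonsing_inv _ hdet] at h
  exact h

/-- The linearization of the estimator of one round of cross-fitting. -/
lemma negligible_round_sub (hZ : IsIID P Z (dataLaw SX SW σ)) (hSX : SX.PosDef) {N : ℕ → ℕ} {r : ℝ} (hr0 : 0 ≤ r)
    (hr : Tendsto (fun n : ℕ => (n : ℝ) / N n) atTop (𝓝 r)) {D U : ℕ → Finset ℕ}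
    (hD : Tendsto (fun n => (D n).card) atTop atTop) {C : ℝ}
    (hC : ∀ᶠ n : ℕ in atTop, (n : ℝ) * ((D n).card : ℝ)⁻¹ ≤ C)
    (hdiff : BoundedInProb P fun n ω => √(n : ℝ) • ((avg (D n) fun i => imputed θ γ 0 (Z i ω))
      - avg (U n) fun i => imputed θ γ 0 (Z i ω)))
    {M : ℕ → Ω → Matrix (Fin d) (Fin d) ℝ} (hM : MatTendsto P M 1) {s : ℕ → Ω → Vec d × ℝ → Vec d}
    (hsU : Negligible P fun n ω => √(n : ℝ) •
      ((avg (D n) fun i =>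
          s n ω ((Z i ω).1, prediction γ (Z i ω)) - (-2 : ℝ) • imputed θ γ 0 (Z i ω))
        - avg (U n) fun i =>
          s n ω ((Z i ω).1, prediction γ (Z i ω)) - (-2 : ℝ) • imputed θ γ 0 (Z i ω))) :
    Negligible P fun n ω => √(n : ℝ) • (ppiEstimator (D n) (U n) (sqLoss d)
        (linearImputedLoss n (N n) (M n ω) (s n ω))
        (fun i => (Z i ω).1) (fun i => outcome θ γ (Z i ω)) (fun i => prediction γ (Z i ω)) - θ)
      - op SX⁻¹ (√(n : ℝ) • ((avg (D n) fun i => resid γ (Z i ω))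
        - (1 + r)⁻¹ • ((avg (D n) fun i => imputed θ γ 0 (Z i ω))
          - avg (U n) fun i => imputed θ γ 0 (Z i ω)))) := by
  set c : ℕ → ℝ := fun n => (1 + (n : ℝ) / N n)⁻¹ with hc
  have hct : Tendsto c atTop (𝓝 (1 + r)⁻¹) := (hr.const_add 1).inv₀ (by positivity)
  have hcB : BoundedInProb P fun n (_ : Ω) => c n :=
    boundedInProb_of_tendstoInMeasure (tendstoInMeasure_const_of_tendsto hct)
  set Δ : ℕ → Ω → Vec d := fun n ω => (avg (D n) fun i => s n ω ((Z i ω).1, prediction γ (Z i ω)))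
    - avg (U n) fun i => s n ω ((Z i ω).1, prediction γ (Z i ω)) with hΔ
  set Δ₀ : ℕ → Ω → Vec d := fun n ω => (avg (D n) fun i => imputed θ γ 0 (Z i ω))
    - avg (U n) fun i => imputed θ γ 0 (Z i ω) with hΔ₀
  have hsU' : Negligible P fun n ω => √(n : ℝ) • Δ n ω + (2 : ℝ) • (√(n : ℝ) • Δ₀ n ω) :=
    hsU.congr (Eventually.of_forall fun n ω => by
      simp only [hΔ, hΔ₀, avg_sub, avg_smul]
      module)
  -- `Δ` is within o_P(n^(-1/2)) of `-2 • Δ₀`, whose order is known.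
  have hΔB : BoundedInProb P fun n ω => √(n : ℝ) • Δ n ω :=
    (hsU'.boundedInProb.sub (hdiff.const_smul 2)).mono
      (Eventually.of_forall fun n ω => le_of_eq (congrArg norm (by simp only [hΔ₀]; module)))
  have hMB : BoundedInProb P fun n ω => op (M n ω) :=
    (hM.negligible_op_sub.boundedInProb.add (boundedInProb_const (op 1))).mono
      (Eventually.of_forall fun n ω => by rw [sub_add_cancel])
  have hMΔ : BoundedInProb P fun n ω => op (M n ω) (√(n : ℝ) • Δ n ω) :=
    hMB.of_norm_le_mul hΔB (Eventually.of_forall fun n ω => ContinuousLinearMap.le_opNorm _ _)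
  have hMΔ1 : Negligible P fun n ω => op (M n ω) (√(n : ℝ) • Δ n ω) - √(n : ℝ) • Δ n ω :=
    hM.negligible_op_sub.of_norm_le_mul hΔB (Eventually.of_forall fun n ω => by
      rw [show op (M n ω) (√(n : ℝ) • Δ n ω) - √(n : ℝ) • Δ n ω
        = (op (M n ω) - op 1 : Vec d →L[ℝ] Vec d) (√(n : ℝ) • Δ n ω) by
          rw [_root_.sub_apply, op_one_apply]]
      exact ContinuousLinearMap.le_opNorm _ _)
  -- With `M → 1` and `Δ ≈ -2 • Δ₀`, the correction `(c n / 2) • M Δ` is asymptotically `-c n • Δ₀`: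
  -- the factor 1/2 of the normal equations cancels the 2 of the gradient.
  have hhalf : Negligible P fun n ω => (c n / 2) •
      (op (M n ω) (√(n : ℝ) • Δ n ω) + (2 : ℝ) • (√(n : ℝ) • Δ₀ n ω)) := by
    refine (hMΔ1.add hsU').of_norm_le_mul hcB (Eventually.of_forall fun n ω => ?_)
    rw [← add_assoc, sub_add_cancel, norm_smul, norm_div, mul_comm]
    refine mul_le_mul_of_nonneg_left ?_ (norm_nonneg _)
    rw [Real.norm_ofNat]
    linarith [norm_nonneg (c n)]
  have hlast : Negligible P fun n ω => (c n - (1 + r)⁻¹) • (√(n : ℝ) • Δ₀ n ω) :=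
    (negligible_of_tendsto (P := P) (by simpa using hct.sub_const (1 + r)⁻¹)).of_norm_le_mul hdiff
      (Eventually.of_forall fun n ω => (norm_smul _ _).le)
  have hres := boundedInProb_avg hZ (measurable_resid γ) allMoments_resid.memLp_two
    integral_resid_coord hC
  have hb : ∀ n ω, (avg (D n) fun i => outcome θ γ (Z i ω) • (Z i ω).1)
      + (c n / 2) • op (M n ω) (Δ n ω) - op (gram (D n) fun i => (Z i ω).1) θ
      = (avg (D n) fun i => resid γ (Z i ω)) + (c n / 2) • op (M n ω) (Δ n ω) := fun n ω => by
    rw [avg_outcome_smul (z := fun i => Z i ω)]; abel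
  have hbB : BoundedInProb P fun n ω => √(n : ℝ) • ((avg (D n) fun i => resid γ (Z i ω))
      + (c n / 2) • op (M n ω) (Δ n ω)) := by
    have h := (hres.add hhalf.boundedInProb).sub (hcB.of_norm_le_mul
      (h := fun n ω => c n • (√(n : ℝ) • Δ₀ n ω)) hdiff
      (Eventually.of_forall fun n ω => (norm_smul _ _).le))
    refine h.mono (Eventually.of_forall fun n ω => le_of_eq (congrArg norm ?_))
    rw [map_smul]
    module
  have hest := negligible_quadMin_sub (matTendsto_gram hZ hSX hD) hSX
    (fun n ω => gram_isHermitian (D n) _)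
    (b := fun n ω => (avg (D n) fun i => outcome θ γ (Z i ω) • (Z i ω).1)
      + (c n / 2) • op (M n ω) (Δ n ω)) θ (by simp only [hb]; exact hbB)
  simp only [hb] at hest
  simp only [ppiEstimator_linear]
  refine (hest.add ((hhalf.sub hlast).op_apply (A := SX⁻¹))).congr
    (Eventually.of_forall fun n ω => ?_)
  rw [sub_add, ← map_sub]
  congr 2
  rw [map_smul]
  module

end Round

/-! ### Independence across folds, measurability, and the sum over the three rounds. -/

section CrossFitting

variable {d p : ℕ} {θ : Vec d} {γ : Vec p}

lemma xyEstimator_congr {D : Finset ℕ} {l : Loss d} {x x' : ℕ → Vec d} {y y' : ℕ → ℝ}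
    (hx : ∀ i ∈ D, x i = x' i) (hy : ∀ i ∈ D, y i = y' i) :
    xyEstimator D l x y = xyEstimator D l x' y' := by
  refine congrArg argmin (funext fun ϑ => ?_)
  rw [Finset.sum_congr rfl fun i hi => by rw [hx i hi, hy i hi]]

/-- The learnt function reads only the first two folds of its round. This locality is what makes it
independent of the third fold and of the unlabeled data. -/
lemma fittedScore_congr {𝒰 : Type*} {l : Loss d} {A : Learner d 𝒰} {fold : ℕ → ℕ → Fin 3} {n : ℕ}
    {k : Fin 3} {u : 𝒰} {x x' : ℕ → Vec d} {y y' yh yh' : ℕ → ℝ}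
    (hx : ∀ i ∈ foldSet fold n (-k) ∪ foldSet fold n (1 - k), x i = x' i)
    (hy : ∀ i ∈ foldSet fold n (-k) ∪ foldSet fold n (1 - k), y i = y' i)
    (hyh : ∀ i ∈ foldSet fold n (-k) ∪ foldSet fold n (1 - k), yh i = yh' i) :
    fittedScore l A fold n k u x y yh = fittedScore l A fold n k u x' y' yh' := by
  have h1 : initEstimator l fold n k x y = initEstimator l fold n k x' y' :=
    xyEstimator_congr (fun i hi => hx i (Finset.mem_union_left _ hi))
      fun i hi => hy i (Finset.mem_union_left _ hi)
  have h2 : (fun i : foldSet fold n (1 - k) => (x i, y i, yh i))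
      = fun i : foldSet fold n (1 - k) => (x' i, y' i, yh' i) := funext fun i => by
    have hi := Finset.mem_union_right (foldSet fold n (-k)) i.2
    rw [hx i hi, hy i hi, hyh i hi]
  rw [fittedScore, fittedScore, h1, h2]

variable {Ω : Type*} [MeasurableSpace Ω]

lemma measurable_xyEstimator {x : ℕ → Ω → Vec d} {y : ℕ → Ω → ℝ} (hx : ∀ i, Measurable (x i))
    (hy : ∀ i, Measurable (y i)) (D : Finset ℕ) :
    Measurable fun ω => xyEstimator D (sqLoss d) (fun i => x i ω) fun i => y i ω := by
  simp only [xyEstimator_sqLoss]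
  refine measurable_quadMin (fun a b => ?_) (fun ω => gram_isHermitian _ _) ?_
  · simp only [gram, Matrix.of_apply, avg]
    fun_prop
  · unfold avg
    fun_prop

lemma measurable_fittedScore {𝒰 : Type*} [MeasurableSpace 𝒰] {A : Learner d 𝒰}
    (hA : MeasurableLearner A) (fold : ℕ → ℕ → Fin 3) (n : ℕ) (k : Fin 3) {u : Ω → 𝒰}
    (hu : Measurable u) {x : ℕ → Ω → Vec d} {y yh : ℕ → Ω → ℝ} (hx : ∀ i, Measurable (x i))
    (hy : ∀ i, Measurable (y i)) (hyh : ∀ i, Measurable (yh i)) {v : Ω → Vec d × ℝ}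
    (hv : Measurable v) :
    Measurable fun ω => fittedScore (sqLoss d) A fold n k (u ω) (fun i => x i ω) (fun i => y i ω)
      (fun i => yh i ω) (v ω) := by
  have hi : Measurable fun ω => initEstimator (sqLoss d) fold n k (fun i => x i ω)
      (fun i => y i ω) := measurable_xyEstimator hx hy _
  have ht : Measurable fun ω (i : foldSet fold n (1 - k)) => (x i ω, y i ω, yh i ω) :=
    measurable_pi_lambda _ fun i => (hx i).prodMk ((hy i).prodMk (hyh i))
  exact (hA n k (foldSet fold n (1 - k))).comp (hu.prodMk (hi.prodMk (ht.prodMk hv)))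

lemma measurable_sampleCov {u v : ℕ → Ω → Vec d} (hu : ∀ i, Measurable (u i))
    (hv : ∀ i, Measurable (v i)) (D : Finset ℕ) (a b : Fin d) :
    Measurable fun ω => sampleCov D (fun i => u i ω) (fun i => v i ω) a b := by
  simp only [sampleCov, Matrix.of_apply, sampleMean]
  fun_prop

lemma measurable_foldEstimator {𝒰 : Type*} [MeasurableSpace 𝒰] {A : Learner d 𝒰}
    (hA : MeasurableLearner A) (fold : ℕ → ℕ → Fin 3) (n N : ℕ) (k : Fin 3) {u : Ω → 𝒰}
    (hu : Measurable u) {x : ℕ → Ω → Vec d} {y yh : ℕ → Ω → ℝ} (hx : ∀ i, Measurable (x i))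
    (hy : ∀ i, Measurable (y i)) (hyh : ∀ i, Measurable (yh i)) :
    Measurable fun ω => foldEstimator (sqLoss d) A fold n N k (u ω) (fun i => x i ω)
      (fun i => y i ω) fun i => yh i ω := by
  simp only [foldEstimator, ppiEstimator_linear]
  have hs : ∀ i, Measurable fun ω => fittedScore (sqLoss d) A fold n k (u ω) (fun i => x i ω)
      (fun i => y i ω) (fun i => yh i ω) (x i ω, yh i ω) := fun i =>
    measurable_fittedScore hA fold n k hu hx hy hyh ((hx i).prodMk (hyh i))
  have hi : Measurable fun ω => initEstimator (sqLoss d) fold n k (fun i => x i ω)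
      (fun i => y i ω) := measurable_xyEstimator hx hy _
  have hg : ∀ i, Measurable fun ω => lossGrad (sqLoss d) (initEstimator (sqLoss d) fold n k
      (fun i => x i ω) (fun i => y i ω)) (x i ω) (y i ω) := fun i => by
    simp only [lossGrad_sqLoss]
    fun_prop
  refine measurable_quadMin (fun a b => ?_) (fun ω => gram_isHermitian _ _) ?_
  · simp only [gram, Matrix.of_apply, avg]
    fun_prop
  · refine (measurable_avg _ fun i => by fun_prop).add (Measurable.fun_const_smul
      (measurable_op_apply (fun a b => ?_)
        ((measurable_avg _ hs).fun_sub (measurable_avg _ hs))) _)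
    simp only [tuningMatrix, Matrix.mul_apply]
    exact Finset.measurable_sum _ fun j _ => (measurable_sampleCov hg hs _ a j).mul
      (measurable_matrix_inv (fun a b => measurable_sampleCov hs hs _ a b) j b)

variable {SX : Matrix (Fin d) (Fin d) ℝ} {SW : Matrix (Fin p) (Fin p) ℝ} {σ : ℝ≥0}
  {P : Measure Ω} [IsProbabilityMeasure P] {Z : ℕ → Ω → Vec d × Vec p × ℝ}
  {𝒰 : Type*} [MeasurableSpace 𝒰]

/-- The linearization of the estimator of one round of cross-fitting. -/
def roundLinearization (SX : Matrix (Fin d) (Fin d) ℝ) (θ : Vec d) (γ : Vec p) (r : ℝ)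
    (D U : Finset ℕ) (n : ℕ) (z : ℕ → Vec d × Vec p × ℝ) : Vec d :=
  op SX⁻¹ (√(n : ℝ) • ((avg D fun i => resid γ (z i))
    - (1 + r)⁻¹ • ((avg D fun i => imputed θ γ 0 (z i)) - avg U fun i => imputed θ γ 0 (z i))))

lemma eventually_mul_inv_card_add_le {fold : ℕ → ℕ → Fin 3} (hfold : ∀ n k k',
      (foldSet fold n k).card ≤ (foldSet fold n k').card + 1) {N : ℕ → ℕ} {r : ℝ}
    (hr : Tendsto (fun n : ℕ => (n : ℝ) / N n) atTop (𝓝 r)) (k : Fin 3) :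
    ∀ᶠ n : ℕ in atTop, (n : ℝ) * (((foldSet fold n k).card : ℝ)⁻¹
      + ((unlabeled n (N n)).card : ℝ)⁻¹) ≤ 5 + (r + 1) := by
  filter_upwards [mul_inv_card_foldSet_le hfold k, hr.eventually (gt_mem_nhds (lt_add_one r))]
    with n h1 h2
  rw [card_unlabeled, mul_add]
  exact add_le_add h1 (by rw [← div_eq_mul_inv]; exact h2.le)

lemma boundedInProb_imputed_foldSet (hZ : IsIID P Z (dataLaw SX SW σ)) {N : ℕ → ℕ}
    (hN : ∀ n, 0 < N n) {r : ℝ} (hr : Tendsto (fun n : ℕ => (n : ℝ) / N n) atTop (𝓝 r))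
    {fold : ℕ → ℕ → Fin 3} (hfold : ∀ n k k',
      (foldSet fold n k).card ≤ (foldSet fold n k').card + 1) (k : Fin 3) :
    BoundedInProb P fun n ω => √(n : ℝ) •
      ((avg (foldSet fold n k) fun i => imputed θ γ 0 (Z i ω))
        - avg (unlabeled n (N n)) fun i => imputed θ γ 0 (Z i ω)) := by
  refine boundedInProb_avg_sub_avg hZ (measurable_imputed θ γ 0)
    (allMoments_imputed 0).memLp_two (fun n => foldSet_disjoint_unlabeled fold n (N n) k) ?_
    (Eventually.of_forall fun n => by simpa [unlabeled] using hN n)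
    (eventually_mul_inv_card_add_le hfold hr k)
  filter_upwards [(tendsto_card_foldSet hfold fun _ => k).eventually_gt_atTop 0] with n hn
  exact Finset.card_pos.1 hn

lemma boundedInProb_roundLinearization (hZ : IsIID P Z (dataLaw SX SW σ)) {N : ℕ → ℕ}
    (hN : ∀ n, 0 < N n) {r : ℝ} (hr : Tendsto (fun n : ℕ => (n : ℝ) / N n) atTop (𝓝 r))
    {fold : ℕ → ℕ → Fin 3} (hfold : ∀ n k k',
      (foldSet fold n k).card ≤ (foldSet fold n k').card + 1) (k : Fin 3) :
    BoundedInProb P fun n ω => roundLinearization SX θ γ r (foldSet fold n k)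
      (unlabeled n (N n)) n fun i => Z i ω := by
  have h1 := boundedInProb_avg hZ (measurable_resid γ) allMoments_resid.memLp_two
    integral_resid_coord (mul_inv_card_foldSet_le hfold k)
  have h2 := boundedInProb_imputed_foldSet (θ := θ) (γ := γ) hZ hN hr hfold k
  have h3 := (h1.sub (h2.const_smul (1 + r)⁻¹)).op_apply (A := SX⁻¹)
  refine h3.mono (Eventually.of_forall fun n ω => le_of_eq (congrArg norm ?_))
  rw [roundLinearization]
  congr 1
  module

/-- The estimators of the rounds of cross-fitting are asymptotically linear. -/
lemma negligible_foldEstimator_sub (hZ : IsIID P Z (dataLaw SX SW σ)) (hSX : SX.PosDef)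
    (hSW : SW.PosSemidef) (hγ : 0 < quadForm SW γ) {N : ℕ → ℕ} (hN : ∀ n, 0 < N n) {r : ℝ}
    (hr : Tendsto (fun n : ℕ => (n : ℝ) / N n) atTop (𝓝 r))
    {fold : ℕ → ℕ → Fin 3} (hfold : ∀ n k k',
      (foldSet fold n k).card ≤ (foldSet fold n k').card + 1)
    {seed : Ω → 𝒰} (hseed : Measurable seed) (hind : IndepFun seed (fun ω i => Z i ω) P)
    {A : Learner d 𝒰} (hA : MeasurableLearner A) (k : Fin 3)
    (hcons : ∀ δ : ℝ≥0∞, 0 < δ → Tendsto (fun n => P {ω | δ ≤ ∫⁻ z,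
        ‖fittedScore (sqLoss d) A fold n k (seed ω) (fun i => (Z i ω).1)
          (fun i => outcome θ γ (Z i ω)) (fun i => prediction γ (Z i ω)) (z.1, prediction γ z)
          - (-2 : ℝ) • imputed θ γ 0 z‖ₑ ^ 2 ∂(dataLaw SX SW σ)}) atTop (𝓝 0)) :
    Negligible P fun n ω => √(n : ℝ) • (foldEstimator (sqLoss d) A fold n (N n) k (seed ω)
        (fun i => (Z i ω).1) (fun i => outcome θ γ (Z i ω)) (fun i => prediction γ (Z i ω)) - θ)
      - roundLinearization SX θ γ r (foldSet fold n (2 - k)) (unlabeled n (N n)) n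
          fun i => Z i ω := by
  have hr0 : 0 ≤ r := ge_of_tendsto' hr fun n => by positivity
  have hZm := hZ.measurable
  have hD : ∀ k, Tendsto (fun n => (foldSet fold n k).card) atTop atTop := fun k =>
    tendsto_card_foldSet hfold fun _ => k
  set S : ℕ → Finset ℕ := fun n => foldSet fold n (-k) ∪ foldSet fold n (1 - k) with hS
  set T : ∀ n, Ω → 𝒰 × (S n → Vec d × Vec p × ℝ) := fun n ω => (seed ω, fun i => Z i ω) with hTdef
  -- `T n` collects all that the learnt function depends on: the seed and the first two folds. `H`
  -- below rewrites the learnt function as a function of `T n`, filling the unread entries with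
  -- zero.
  have hT : ∀ n, Measurable (T n) := fun n =>
    hseed.prodMk (measurable_pi_lambda _ fun i => hZm i)
  set H : ∀ n, 𝒰 × (S n → Vec d × Vec p × ℝ) → Vec d × ℝ → Vec d := fun n t =>
    fittedScore (sqLoss d) A fold n k t.1 (fun i => (extendFamily 0 (S n) t.2 i).1)
      (fun i => outcome θ γ (extendFamily 0 (S n) t.2 i))
      (fun i => prediction γ (extendFamily 0 (S n) t.2 i)) with hH
  set h : ∀ n, 𝒰 × (S n → Vec d × Vec p × ℝ) → Vec d × Vec p × ℝ → Vec d := fun n t z =>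
    H n t (z.1, prediction γ z) - (-2 : ℝ) • imputed θ γ 0 z with hh
  have hHT : ∀ n ω, fittedScore (sqLoss d) A fold n k (seed ω) (fun i => (Z i ω).1)
      (fun i => outcome θ γ (Z i ω)) (fun i => prediction γ (Z i ω)) = H n (T n ω) := fun n ω => by
    refine fittedScore_congr (fun i hi => ?_) (fun i hi => ?_) fun i hi => ?_
    all_goals
      simp only [hTdef]
      rw [extendFamily_of_mem 0 (fun j => Z j ω) hi]
  have hm : ∀ n, Measurable fun q : (𝒰 × (S n → Vec d × Vec p × ℝ)) × (Vec d × Vec p × ℝ) =>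
      h n q.1 q.2 := fun n => by
    have hz : ∀ i, Measurable fun q : (𝒰 × (S n → Vec d × Vec p × ℝ)) × (Vec d × Vec p × ℝ) =>
        extendFamily 0 (S n) q.1.2 i := fun i =>
      (measurable_pi_apply i).comp ((measurable_extendFamily 0 (S n)).comp
        (measurable_snd.comp measurable_fst))
    refine (measurable_fittedScore hA fold n k (measurable_fst.comp measurable_fst)
      (fun i => measurable_fst.comp (hz i)) (fun i => (measurable_outcome θ γ).comp (hz i))
      (fun i => (measurable_prediction γ).comp (hz i))
      ((measurable_fst.comp measurable_snd).prodMk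
        ((measurable_prediction γ).comp measurable_snd))).sub ?_
    exact ((measurable_imputed θ γ 0).comp measurable_snd).const_smul (-2 : ℝ)
  have hI : ∀ δ : ℝ≥0∞, 0 < δ → Tendsto (fun n => P {ω | δ ≤ ∫⁻ z, ‖h n (T n ω) z‖ₑ ^ 2
      ∂(dataLaw SX SW σ)}) atTop (𝓝 0) := by
    simpa only [hHT] using hcons
  have hdisj : ∀ n, Disjoint (S n) (foldSet fold n (2 - k) ∪ unlabeled n (N n)) := fun n => by
    -- Modulo 3, the third fold of a round differs from the two learning folds.
    have hk : ∀ k : Fin 3, -k ≠ 2 - k ∧ 1 - k ≠ 2 - k := by decide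
    simp only [hS, Finset.disjoint_union_left, Finset.disjoint_union_right]
    exact ⟨⟨foldSet_disjoint fold n (hk k).1, foldSet_disjoint fold n (hk k).2⟩,
      foldSet_disjoint_unlabeled _ _ _ _, foldSet_disjoint_unlabeled _ _ _ _⟩
  have hrms := hZ.negligible_rms_of_indepFun 0 hT (D := fun n => foldSet fold n (2 - k))
    (fun n => hZ.indepFun_seed hseed hind ((hdisj n).mono_right Finset.subset_union_left)) hm hI
  have havg := hZ.negligible_avg_sub_avg_of_indepFun 0 hT (D := fun n => foldSet fold n (2 - k))
    (U := fun n => unlabeled n (N n)) (fun n => foldSet_disjoint_unlabeled _ _ _ _)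
    (((hD (2 - k)).eventually_gt_atTop 0).mono fun n hn => Finset.card_pos.1 hn)
    (Eventually.of_forall fun n => by simpa [unlabeled] using hN n) (C := 5 + (r + 1))
    (by positivity) (eventually_mul_inv_card_add_le hfold hr _)
    (fun n => hZ.indepFun_seed hseed hind (hdisj n)) hm hI
  have hinit := negligible_xyEstimator_sub (θ := θ) (γ := γ) hZ hSX (hD (-k))
    (mul_inv_card_foldSet_le hfold (-k))
  have hM := matTendsto_tuningMatrix (θ := θ) hZ hSX hSW hγ (hD (2 - k)) hinit
    (s := fun n ω => H n (T n ω)) hrms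
  have hround := negligible_round_sub hZ hSX hr0 hr (hD (2 - k))
    (mul_inv_card_foldSet_le hfold (2 - k))
    (boundedInProb_imputed_foldSet (θ := θ) (γ := γ) hZ hN hr hfold (2 - k)) hM
    (s := fun n ω => H n (T n ω)) havg
  simpa only [foldEstimator, hHT, initEstimator, roundLinearization] using hround

/-- Asymptotic normality of the recalibrated estimator. -/
theorem isAsympCov_reppiEstimator (hZ : IsIID P Z (dataLaw SX SW σ)) (hSX : SX.PosDef)
    (hSW : SW.PosSemidef) (hγ : 0 < quadForm SW γ) {N : ℕ → ℕ} (hN : ∀ n, 0 < N n) {r : ℝ}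
    (hr : Tendsto (fun n : ℕ => (n : ℝ) / N n) atTop (𝓝 r))
    {fold : ℕ → ℕ → Fin 3} (hfold : ∀ n k k',
      (foldSet fold n k).card ≤ (foldSet fold n k').card + 1)
    {seed : Ω → 𝒰} (hseed : Measurable seed) (hind : IndepFun seed (fun ω i => Z i ω) P)
    {A : Learner d 𝒰} (hA : MeasurableLearner A)
    (hcons : ∀ k : Fin 3, ∀ δ : ℝ≥0∞, 0 < δ → Tendsto (fun n => P {ω | δ ≤ ∫⁻ z,
        ‖fittedScore (sqLoss d) A fold n k (seed ω) (fun i => (Z i ω).1)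
          (fun i => outcome θ γ (Z i ω)) (fun i => prediction γ (Z i ω)) (z.1, prediction γ z)
          - (-2 : ℝ) • imputed θ γ 0 z‖ₑ ^ 2 ∂(dataLaw SX SW σ)}) atTop (𝓝 0)) :
    IsAsympCov P (fun n ω => reppiEstimator (sqLoss d) A fold n (N n) (seed ω)
      (fun i => (Z i ω).1) (fun i => outcome θ γ (Z i ω)) fun i => prediction γ (Z i ω)) θ
      (asympCov SX SW σ θ γ r (1 + r)⁻¹ 0) := by
  have hZm := hZ.measurable
  refine isAsympCov_of_linearization hZ hSX hSW hN hr _ 0 (fun n => ?_) ?_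
  · exact Finset.measurable_sum _ fun k _ => Measurable.fun_const_smul
      (measurable_foldEstimator hA fold n (N n) k hseed (x := fun i ω => (Z i ω).1)
        (fun i => measurable_fst.comp (hZm i)) (fun i => (measurable_outcome θ γ).comp (hZm i))
        fun i => (measurable_prediction γ).comp (hZm i)) _
  -- Round `k` is weighted by the size of fold `k` but computed on fold `2 - k`. The linearizations
  -- are first summed with the matching weight `w n (2 - k)`, and the mismatch is treated separately
  -- in `h2`.
  set w : ℕ → Fin 3 → ℝ := fun n k => ((foldSet fold n k).card : ℝ) / n with hw
  set L : Fin 3 → ℕ → Ω → Vec d := fun k n ω => roundLinearization SX θ γ r (foldSet fold n k)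
    (unlabeled n (N n)) n fun i => Z i ω with hL
  have hwsum : ∀ n, n ≠ 0 → ∑ k, w n k = 1 := fun n hn => by
    rw [← Finset.sum_div, ← Nat.cast_sum, sum_card_foldSet, div_self (by exact_mod_cast hn)]
  have hw1 : ∀ n k, ‖w n k‖ ≤ 1 := fun n k => by
    rw [Real.norm_of_nonneg (by positivity)]
    refine div_le_one_of_le₀ ?_ (by positivity)
    exact_mod_cast (Finset.card_filter_le _ _).trans (card_labeled n).le
  have hflip : ∀ n (f : Fin 3 → Vec d), ∑ k, w n (2 - k) • f (2 - k) = ∑ k, w n k • f k :=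
    fun n f => Equiv.sum_comp (Equiv.subLeft (2 : Fin 3)) fun k => w n k • f k
  -- Fold averages recombine to the average over all labeled points; the unlabeled average is common
  -- to all rounds and is kept because the weights sum to one.
  have hLsum : ∀ n ω, n ≠ 0 → ∑ k, w n k • L k n ω
      = roundLinearization SX θ γ r (labeled n) (unlabeled n (N n)) n fun i => Z i ω := by
    intro n ω hn
    have e : ∀ k, w n k • L k n ω = op SX⁻¹ (√(n : ℝ) •
        ((w n k • avg (foldSet fold n k) fun i => resid γ (Z i ω))
        - (1 + r)⁻¹ • ((w n k • avg (foldSet fold n k) fun i => imputed θ γ 0 (Z i ω))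
          - w n k • avg (unlabeled n (N n)) fun i => imputed θ γ 0 (Z i ω)))) := fun k => by
      simp only [hL, roundLinearization]
      rw [← map_smul]
      congr 1
      module
    simp_rw [e]
    rw [← map_sum, ← Finset.smul_sum, Finset.sum_sub_distrib, ← Finset.smul_sum,
      Finset.sum_sub_distrib, ← Finset.sum_smul, hwsum n hn, one_smul,
      sum_card_smul_avg_foldSet fold n fun i => resid γ (Z i ω),
      sum_card_smul_avg_foldSet fold n fun i => imputed θ γ 0 (Z i ω), roundLinearization]
  have h1 : Negligible P fun n ω => ∑ k, w n k • (√(n : ℝ) • (foldEstimator (sqLoss d) A fold n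
      (N n) k (seed ω) (fun i => (Z i ω).1) (fun i => outcome θ γ (Z i ω))
      (fun i => prediction γ (Z i ω)) - θ) - L (2 - k) n ω) :=
    Negligible.sum _ fun k _ => (negligible_foldEstimator_sub hZ hSX hSW hγ hN hr hfold hseed hind
      hA k (hcons k)).mono (Eventually.of_forall fun n ω => by
        rw [norm_smul]
        exact mul_le_of_le_one_left (norm_nonneg _) (hw1 n k))
  -- Fold sizes differ by at most one, so the weights differ by at most `1 / n`, while the
  -- linearizations are bounded in probability.
  have h2 : Negligible P fun n ω => ∑ k, (w n k - w n (2 - k)) • L (2 - k) n ω := by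
    refine Negligible.sum _ fun k _ => ?_
    refine (negligible_of_tendsto (P := P) (a := fun n => w n k - w n (2 - k)) ?_).of_norm_le_mul
      (boundedInProb_roundLinearization (SX := SX) (θ := θ) (γ := γ) hZ hN hr hfold (2 - k))
      (Eventually.of_forall fun n ω => (norm_smul _ _).le)
    refine squeeze_zero_norm (fun n => ?_) tendsto_inv_atTop_nhds_zero_nat
    rw [hw, ← sub_div, Real.norm_eq_abs, abs_div, Nat.abs_cast, div_eq_mul_inv]
    refine mul_le_of_le_one_left (by positivity) (abs_sub_le_iff.2 ⟨?_, ?_⟩) <;>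
      rw [sub_le_iff_le_add, add_comm] <;> exact_mod_cast hfold n _ _
  refine (h1.add h2).congr ?_
  filter_upwards [eventually_ne_atTop 0] with n hn ω
  rw [← Finset.sum_add_distrib]
  have e : ∀ k, w n k • (√(n : ℝ) • (foldEstimator (sqLoss d) A fold n
      (N n) k (seed ω) (fun i => (Z i ω).1) (fun i => outcome θ γ (Z i ω))
      (fun i => prediction γ (Z i ω)) - θ) - L (2 - k) n ω)
      + (w n k - w n (2 - k)) • L (2 - k) n ω
      = √(n : ℝ) • (w n k • foldEstimator (sqLoss d) A fold n
      (N n) k (seed ω) (fun i => (Z i ω).1) (fun i => outcome θ γ (Z i ω))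
      (fun i => prediction γ (Z i ω)) - w n k • θ) - w n (2 - k) • L (2 - k) n ω := fun k => by
    module
  rw [Finset.sum_congr rfl fun k _ => e k, Finset.sum_sub_distrib, ← Finset.smul_sum,
    Finset.sum_sub_distrib, ← Finset.sum_smul, hwsum n hn, one_smul,
    hflip n fun k => L k n ω, hLsum n ω hn, reppiEstimator, roundLinearization]

end CrossFitting

/-! ### The population risk and the conditional mean of the gradient. -/

section Population

variable {d p : ℕ} {SX : Matrix (Fin d) (Fin d) ℝ} {SW : Matrix (Fin p) (Fin p) ℝ} {σ : ℝ≥0}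
  {θ : Vec d} {γ : Vec p}

/-- The residual is the noise ⟨W, γ⟩ + ε plus ⟨X, θ - ϑ⟩, and the cross term integrates to zero. -/
lemma integral_sq_outcome_sub (hSX : SX.PosSemidef) (hSW : SW.PosSemidef) (ϑ : Vec d) :
    ∫ z, sqLoss d ϑ z.1 (outcome θ γ z) ∂(dataLaw SX SW σ)
      = σ ^ 2 + quadForm SW γ + quadForm SX (θ - ϑ) := by
  have hw : AllMoments (fun z : Vec d × Vec p × ℝ => 1 * inner ℝ z.2.1 γ + 1 * z.2.2)
      (dataLaw SX SW σ) :=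
    ((allMoments_w.inner_const γ).const_mul 1).add (allMoments_eps.const_mul 1)
  have hx : AllMoments (fun z : Vec d × Vec p × ℝ => (inner ℝ z.1 (θ - ϑ) : ℝ))
      (dataLaw SX SW σ) := allMoments_x.inner_const (θ - ϑ)
  have e : ∀ z : Vec d × Vec p × ℝ, sqLoss d ϑ z.1 (outcome θ γ z)
      = (1 * inner ℝ z.2.1 γ + 1 * z.2.2) * (1 * inner ℝ z.2.1 γ + 1 * z.2.2)
        + 2 * (inner ℝ z.1 (θ - ϑ) * (1 * inner ℝ z.2.1 γ + 1 * z.2.2))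
        + inner ℝ z.1 (θ - ϑ) * inner ℝ z.1 (θ - ϑ) := fun z => by
    simp only [sqLoss, outcome, inner_sub_right]
    ring
  have h1 : ∫ z, (1 * inner ℝ z.2.1 γ + 1 * z.2.2) * (1 * inner ℝ z.2.1 γ + 1 * z.2.2)
      ∂(dataLaw SX SW σ) = quadForm SW γ + σ ^ 2 := by
    simp only [← pow_two]
    rw [dataLaw, integral_fun_snd (fun y : Vec p × ℝ => (1 * inner ℝ y.1 γ + 1 * y.2) ^ 2),
      integral_noise_sq hSW]
    simp
  simp_rw [e]
  rw [integral_add ((hw.mul hw).add ((hx.mul hw).const_mul 2)).integrable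
      (hx.mul hx).integrable, integral_add (hw.mul hw).integrable
      ((hx.mul hw).const_mul 2).integrable, integral_const_mul, integral_inner_mul_noise, h1,
    integral_x_coord_mul hSX, quadForm, quadForm]
  ring

lemma quadForm_pos (hSX : SX.PosDef) {v : Vec d} (hv : v ≠ 0) : 0 < quadForm SX v := by
  rw [quadForm, ← inner_op]
  exact (posDef_iff_inner_op hSX.isHermitian).1 hSX v hv

/-- The population risk has the unique minimizer `θ`. -/
lemma forall_integral_sqLoss_le_iff (hSX : SX.PosDef) (hSW : SW.PosSemidef) (ϑ : Vec d) :
    (∀ t, ∫ z, sqLoss d ϑ z.1 (outcome θ γ z) ∂(dataLaw SX SW σ)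
      ≤ ∫ z, sqLoss d t z.1 (outcome θ γ z) ∂(dataLaw SX SW σ)) ↔ ϑ = θ := by
  simp only [integral_sq_outcome_sub hSX.posSemidef hSW, add_le_add_iff_left]
  have h0 : quadForm SX (θ - θ) = 0 := by simp [quadForm]
  constructor
  · intro h
    by_contra hne
    have := quadForm_pos hSX (sub_ne_zero.2 (Ne.symm hne))
    linarith [h θ]
  · rintro rfl t
    rw [h0]
    exact quadForm_nonneg hSX.posSemidef _

/-- The noise is centred given the covariates. -/
lemma integral_eps_smul_eq_zero {v : Vec d → Vec p → Vec d}
    (hv : Integrable (fun z : Vec d × Vec p × ℝ => z.2.2 • v z.1 z.2.1) (dataLaw SX SW σ)) :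
    ∫ z, z.2.2 • v z.1 z.2.1 ∂(dataLaw SX SW σ) = 0 := by
  rw [dataLaw] at hv ⊢
  rw [integral_prod _ hv]
  refine integral_eq_zero_of_ae ?_
  filter_upwards [hv.prod_right_ae] with x hx
  rw [integral_prod _ hx]
  refine integral_eq_zero_of_ae (Eventually.of_forall fun w => ?_)
  simp only [integral_smul_const, integral_id_gaussianReal, zero_smul, Pi.zero_apply]

variable {Ω : Type*} [MeasurableSpace Ω] {P : Measure Ω} [IsProbabilityMeasure P]
  {Z : ℕ → Ω → Vec d × Vec p × ℝ}

/-- The conditional mean of the gradient at the target is `-2 Ŷ X`. -/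
lemma condExp_lossGrad (hZ : IsIID P Z (dataLaw SX SW σ)) :
    (fun ω => (-2 : ℝ) • imputed θ γ 0 (Z 0 ω)) =ᵐ[P]
      P[fun ω => lossGrad (sqLoss d) θ (Z 0 ω).1 (outcome θ γ (Z 0 ω)) |
        MeasurableSpace.comap (fun ω => ((Z 0 ω).1, prediction γ (Z 0 ω))) inferInstance] := by
  have hZm := hZ.measurable 0
  have hV : Measurable fun ω => ((Z 0 ω).1, prediction γ (Z 0 ω)) :=
    (measurable_fst.comp hZm).prodMk ((measurable_prediction γ).comp hZm)
  have hg : ∀ z, lossGrad (sqLoss d) θ z.1 (outcome θ γ z) = (-2 : ℝ) • resid γ z := fun z => by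
    rw [lossGrad_sqLoss, resid, outcome, smul_smul]
    congr 1
    ring
  simp only [hg]
  have hr : Integrable (fun ω => (-2 : ℝ) • resid γ (Z 0 ω)) P :=
    (hZ.memLp_comp 0 (allMoments_resid.const_smul (-2 : ℝ)).memLp_two).integrable (by norm_num)
  have hi : Integrable (fun ω => (-2 : ℝ) • imputed θ γ 0 (Z 0 ω)) P :=
    (hZ.memLp_comp 0 ((allMoments_imputed 0).const_smul (-2 : ℝ)).memLp_two).integrable
      (by norm_num)
  refine ae_eq_condExp_of_forall_setIntegral_eq hV.comap_le hr (fun _ _ _ => hi.integrableOn)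
    (fun s hs _ => ?_) ?_
  · obtain ⟨B, hB, rfl⟩ := hs
    have hBm : MeasurableSet ((fun z : Vec d × Vec p × ℝ => (z.1, prediction γ z)) ⁻¹' B) :=
      (measurable_fst.prodMk (measurable_prediction γ)) hB
    have hs : MeasurableSet ((fun ω => ((Z 0 ω).1, prediction γ (Z 0 ω))) ⁻¹' B) := hV hB
    rw [eq_comm, ← sub_eq_zero, ← integral_sub hr.integrableOn hi.integrableOn]
    -- The gradient minus its claimed conditional mean is -2 ε X. Restricted to an event determined
    -- by (X, Ŷ), it is ε times a function of (X, W), so `integral_eps_smul_eq_zero` applies.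
    set b : Vec d → Vec p → Vec d := fun x w =>
      (B.indicator (fun q : Vec d × ℝ => (-2 : ℝ) • q.1)) (x, inner ℝ w γ) with hb
    have hbm : Measurable fun z : Vec d × Vec p × ℝ => z.2.2 • b z.1 z.2.1 := by
      refine (measurable_snd.comp measurable_snd).smul
        (((measurable_fst.const_smul (-2 : ℝ)).indicator hB).comp
          (measurable_fst.prodMk (measurable_prediction γ)))
    have e : ∀ ω, ((fun ω => ((Z 0 ω).1, prediction γ (Z 0 ω))) ⁻¹' B).indicator
        (fun ω => (-2 : ℝ) • resid γ (Z 0 ω) - (-2 : ℝ) • imputed θ γ 0 (Z 0 ω)) ω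
        = (Z 0 ω).2.2 • b (Z 0 ω).1 (Z 0 ω).2.1 := fun ω => by
      by_cases hω : ((Z 0 ω).1, prediction γ (Z 0 ω)) ∈ B
      · rw [Set.indicator_of_mem (by exact hω), hb]
        simp only
        rw [Set.indicator_of_mem (by exact hω), resid, imputed]
        module
      · rw [Set.indicator_of_notMem (by exact hω), hb]
        simp only
        rw [Set.indicator_of_notMem (by exact hω), smul_zero]
    rw [← integral_indicator hs, integral_congr_ae (Eventually.of_forall e),
      hZ.integral_comp 0 hbm]
    refine integral_eps_smul_eq_zero ?_
    refine ((allMoments_eps.smul (allMoments_x.const_smul (-2 : ℝ))).integrable).mono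
      hbm.aestronglyMeasurable (Eventually.of_forall fun z => ?_)
    rw [norm_smul, norm_smul]
    exact mul_le_mul_of_nonneg_left (norm_indicator_le_norm_self _ _) (norm_nonneg _)
  · refine StronglyMeasurable.aestronglyMeasurable (Measurable.stronglyMeasurable ?_)
    have h : Measurable fun q : Vec d × ℝ => (-2 : ℝ) • (q.2 • q.1) := by fun_prop
    have e : (fun ω => (-2 : ℝ) • imputed θ γ 0 (Z 0 ω))
        = (fun q : Vec d × ℝ => (-2 : ℝ) • (q.2 • q.1))
          ∘ fun ω => ((Z 0 ω).1, prediction γ (Z 0 ω)) := funext fun ω => by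
      simp [imputed, prediction]
    rw [e]
    exact h.comp (comap_measurable _)

/-- Makes XY-only the case λ = 0 of power tuning, so that it needs no separate asymptotic analysis.
-/
lemma xyEstimator_eq_ppiEstimator (L U : Finset ℕ) (x : ℕ → Vec d) (y yh : ℕ → ℝ) :
    xyEstimator L (sqLoss d) x y = ppiEstimator L U (sqLoss d) ((0 : ℝ) • sqLoss d) x y yh := by
  rw [xyEstimator_sqLoss, ppiEstimator_smul_sqLoss]
  simp [ppiGram]

/-- Consistency of the learnt functions, expressed in terms of the law of the data. -/
lemma tendsto_lintegral_fittedScore {𝒰 : Type*} [MeasurableSpace 𝒰]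
    (hZ : IsIID P Z (dataLaw SX SW σ)) {A : Learner d 𝒰} (hA : MeasurableLearner A)
    {fold : ℕ → ℕ → Fin 3} {seed : Ω → 𝒰} {sstar : Vec d × ℝ → Vec d} (hs : Measurable sstar)
    (hsstar : (fun ω => sstar ((Z 0 ω).1, prediction γ (Z 0 ω))) =ᵐ[P]
      P[fun ω => lossGrad (sqLoss d) θ (Z 0 ω).1 (outcome θ γ (Z 0 ω)) |
        MeasurableSpace.comap (fun ω => ((Z 0 ω).1, prediction γ (Z 0 ω))) inferInstance])
    (k : Fin 3) {δ : ℝ≥0∞}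
    (hcons : Tendsto (fun n => P {ω | δ ≤ ∫⁻ z, ‖fittedScore (sqLoss d) A fold n k (seed ω)
          (fun i => (Z i ω).1) (fun i => outcome θ γ (Z i ω)) (fun i => prediction γ (Z i ω)) z
            - sstar z‖ₑ ^ 2 ∂(P.map fun ω => ((Z 0 ω).1, prediction γ (Z 0 ω)))}) atTop (𝓝 0)) :
    Tendsto (fun n => P {ω | δ ≤ ∫⁻ z,
        ‖fittedScore (sqLoss d) A fold n k (seed ω) (fun i => (Z i ω).1)
          (fun i => outcome θ γ (Z i ω)) (fun i => prediction γ (Z i ω)) (z.1, prediction γ z)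
          - (-2 : ℝ) • imputed θ γ 0 z‖ₑ ^ 2 ∂(dataLaw SX SW σ)}) atTop (𝓝 0) := by
  have hV : Measurable fun z : Vec d × Vec p × ℝ => (z.1, prediction γ z) :=
    measurable_fst.prodMk (measurable_prediction γ)
  have hmap : P.map (fun ω => ((Z 0 ω).1, prediction γ (Z 0 ω)))
      = (dataLaw SX SW σ).map fun z => (z.1, prediction γ z) := by
    rw [← hZ.map_eq 0, Measure.map_map hV (hZ.measurable 0)]
    rfl
  -- `sstar` is a version of the conditional expectation, hence almost surely the explicit version
  -- -2 Ŷ X.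
  have hae : ∀ᵐ z ∂(dataLaw SX SW σ), sstar (z.1, prediction γ z)
      = (-2 : ℝ) • imputed θ γ 0 z := by
    have hset : MeasurableSet {z : Vec d × Vec p × ℝ | sstar (z.1, prediction γ z)
        = (-2 : ℝ) • imputed θ γ 0 z} := measurableSet_eq_fun (hs.comp hV)
      ((measurable_imputed θ γ 0).const_smul (-2 : ℝ))
    rw [← hZ.map_eq 0, ae_map_iff (hZ.measurable 0).aemeasurable hset]
    exact hsstar.trans (condExp_lossGrad hZ).symm
  refine hcons.congr fun n => ?_
  congr 1
  ext ω
  rw [Set.mem_ofPred_eq, Set.mem_ofPred_eq, hmap, lintegral_map _ hV]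
  · rw [lintegral_congr_ae]
    filter_upwards [hae] with z hz
    rw [hz]
  · exact ((measurable_fittedScore hA fold n k measurable_const (fun i => measurable_const)
      (fun i => measurable_const) (fun i => measurable_const) measurable_id).sub hs).enorm.pow_const 2

end Population

/-! ### Traces of the asymptotic covariances and their comparison. -/

section Traces

variable {d p : ℕ} {SX : Matrix (Fin d) (Fin d) ℝ} {SW : Matrix (Fin p) (Fin p) ℝ} {σ : ℝ≥0}
  {θ : Vec d} {γ : Vec p} {r : ℝ}

/-- The optimal power tuning parameter. -/
def optimalTuning (SX : Matrix (Fin d) (Fin d) ℝ) (SW : Matrix (Fin p) (Fin p) ℝ)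
    (θ : Vec d) (γ : Vec p) (r : ℝ) : ℝ :=
  quadForm SW γ * SX⁻¹.trace
    / ((1 + r) * ((quadForm SW γ + quadForm SX θ) * SX⁻¹.trace + ‖θ‖ ^ 2))

/-- Completing the square: the trace is quadratic in `lam` with leading coefficient (1 + r) ((γᵀ SW
γ + θᵀ SX θ) Tr SX⁻¹ + ‖θ‖²) and linear coefficient -2 (γᵀ SW γ) Tr SX⁻¹. -/
lemma trace_asympCov_eq_add_sq (hd : 0 < SX⁻¹.trace) (hSX : SX.PosDef)
    (hγ : 0 < quadForm SW γ) (hr : 0 ≤ r) (lam : ℝ) :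
    (asympCov SX SW σ θ γ r lam 1).trace
      = (asympCov SX SW σ θ γ r (optimalTuning SX SW θ γ r) 1).trace
        + (1 + r) * ((quadForm SW γ + quadForm SX θ) * SX⁻¹.trace + ‖θ‖ ^ 2)
          * (lam - optimalTuning SX SW θ γ r) ^ 2 := by
  have ht := quadForm_nonneg hSX.posSemidef θ
  have ha : (1 + r) * ((quadForm SW γ + quadForm SX θ) * SX⁻¹.trace + ‖θ‖ ^ 2) ≠ 0 := by positivity
  have h : optimalTuning SX SW θ γ r
      * ((1 + r) * ((quadForm SW γ + quadForm SX θ) * SX⁻¹.trace + ‖θ‖ ^ 2))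
      = quadForm SW γ * SX⁻¹.trace := div_mul_cancel₀ _ ha
  rw [asympCov_trace, asympCov_trace]
  linear_combination (2 * lam - 2 * optimalTuning SX SW θ γ r) * h

/-- Separates dimension zero, where the trace appearing in denominators vanishes but all matrices
coincide. -/
lemma trace_inv_pos_or_isEmpty (hSX : SX.PosDef) : 0 < SX⁻¹.trace ∨ IsEmpty (Fin d) := by
  rcases isEmpty_or_nonempty (Fin d) with h | h
  · exact Or.inr h
  · exact Or.inl hSX.inv.trace_pos

lemma trace_asympCov_optimalTuning_le (hSX : SX.PosDef) (hγ : 0 < quadForm SW γ) (hr : 0 ≤ r)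
    (lam : ℝ) :
    (asympCov SX SW σ θ γ r (optimalTuning SX SW θ γ r) 1).trace
      ≤ (asympCov SX SW σ θ γ r lam 1).trace := by
  have ht := quadForm_nonneg hSX.posSemidef θ
  rcases trace_inv_pos_or_isEmpty hSX with hd | hd
  · rw [trace_asympCov_eq_add_sq hd hSX hγ hr lam]
    exact le_add_of_nonneg_right (by positivity)
  · exact (congrArg Matrix.trace (Subsingleton.elim _ _)).le

/-- In positive dimension the minimizer is unique. In dimension zero every `lam` is a minimizer, but
the covariance is the same; hence equality of matrices is asserted, not of parameters. -/
lemma asympCov_eq_of_minimizer (hSX : SX.PosDef) (hγ : 0 < quadForm SW γ) (hr : 0 ≤ r) {lam : ℝ}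
    (h : ∀ l, (asympCov SX SW σ θ γ r lam 1).trace ≤ (asympCov SX SW σ θ γ r l 1).trace) :
    asympCov SX SW σ θ γ r lam 1
      = asympCov SX SW σ θ γ r (optimalTuning SX SW θ γ r) 1 := by
  have ht := quadForm_nonneg hSX.posSemidef θ
  rcases trace_inv_pos_or_isEmpty hSX with hd | hd
  · have h1 := h (optimalTuning SX SW θ γ r)
    rw [trace_asympCov_eq_add_sq hd hSX hγ hr lam] at h1
    have ha : 0 < (1 + r) * ((quadForm SW γ + quadForm SX θ) * SX⁻¹.trace + ‖θ‖ ^ 2) := by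
      positivity
    have h2 : (lam - optimalTuning SX SW θ γ r) ^ 2 ≤ 0 := by
      by_contra! hc
      linarith [mul_pos ha hc]
    rw [sub_eq_zero.1 (pow_eq_zero_iff two_ne_zero |>.1 (le_antisymm h2 (sq_nonneg _)))]
  · exact Subsingleton.elim _ _

lemma trace_asympCov_optimalTuning (hSX : SX.PosDef) (hγ : 0 < quadForm SW γ) (hr : 0 ≤ r) :
    (asympCov SX SW σ θ γ r (optimalTuning SX SW θ γ r) 1).trace
      = (σ ^ 2 + (r / (1 + r) + 1 / (1 + r) *
          ((‖θ‖ ^ 2 / SX⁻¹.trace + quadForm SX θ) /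
            (‖θ‖ ^ 2 / SX⁻¹.trace + quadForm SX θ + quadForm SW γ)))
          * quadForm SW γ) * SX⁻¹.trace := by
  have ht := quadForm_nonneg hSX.posSemidef θ
  rcases trace_inv_pos_or_isEmpty hSX with hd | hd
  · rw [asympCov_trace, optimalTuning]
    have h1 : ‖θ‖ ^ 2 / SX⁻¹.trace + quadForm SX θ + quadForm SW γ
        = ((quadForm SW γ + quadForm SX θ) * SX⁻¹.trace + ‖θ‖ ^ 2) / SX⁻¹.trace := by
      field_simp
      ring
    have h2 : 0 < (quadForm SW γ + quadForm SX θ) * SX⁻¹.trace + ‖θ‖ ^ 2 := by positivity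
    rw [h1]
    generalize hT : SX⁻¹.trace = T at *
    generalize quadForm SW γ = q at *
    generalize quadForm SX θ = t at *
    generalize ‖θ‖ ^ 2 = m at *
    have h3 : (1 : ℝ) + r ≠ 0 := by positivity
    -- Renames the common denominator (q + t) T + m to a single variable `a`, so that fractions can
    -- be cleared.
    obtain ⟨a, rfl⟩ : ∃ a, m = a - (q + t) * T := ⟨m + (q + t) * T, by ring⟩
    rw [add_sub_cancel] at h2 ⊢
    field_simp
    ring
  · simp [Matrix.trace, Subsingleton.elim θ 0, quadForm]

/-- With κ = 0 the parameter θ disappears, and λ = 1/(1 + r) gives (1 - λ)² + r λ² = r/(1 + r). -/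
lemma trace_asympCov_recalibrated (hr : 0 ≤ r) :
    (asympCov SX SW σ θ γ r (1 + r)⁻¹ 0).trace
      = (σ ^ 2 + r / (1 + r) * quadForm SW γ) * SX⁻¹.trace := by
  have h3 : (1 : ℝ) + r ≠ 0 := by positivity
  rw [asympCov_trace]
  field_simp
  ring

/-- The closed forms differ only by the summand with b / (b + γᵀ SW γ), which is nonnegative. -/
lemma trace_recalibrated_le (hSX : SX.PosDef) (hγ : 0 < quadForm SW γ) (hr : 0 ≤ r) :
    (asympCov SX SW σ θ γ r (1 + r)⁻¹ 0).trace
      ≤ (asympCov SX SW σ θ γ r (optimalTuning SX SW θ γ r) 1).trace := by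
  have ht := quadForm_nonneg hSX.posSemidef θ
  have hT : 0 ≤ SX⁻¹.trace := hSX.inv.posSemidef.trace_nonneg
  rw [trace_asympCov_recalibrated hr, trace_asympCov_optimalTuning hSX hγ hr]
  gcongr
  exact le_add_of_nonneg_right (by positivity)

end Traces

end RePPI

end

/-! ### The proposition. -/

open RePPI

theorem proposition1
    {Ω : Type*} [MeasurableSpace Ω] (P : Measure Ω) [IsProbabilityMeasure P]
    {d p : ℕ}
    -- parameters of the Gaussian linear model
    (SX : Matrix (Fin d) (Fin d) ℝ) (hSX : SX.PosDef)
    (SW : Matrix (Fin p) (Fin p) ℝ) (hSW : SW.PosSemidef)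
    (σ : ℝ≥0) (θ : RePPI.Vec d) (γ : RePPI.Vec p) (hγ : 0 < RePPI.quadForm SW γ)
    -- an i.i.d. sequence of `(X, W, ε)` with independent centred Gaussian components
    (X : ℕ → Ω → RePPI.Vec d) (W : ℕ → Ω → RePPI.Vec p) (ε : ℕ → Ω → ℝ)
    (hX : ∀ i, Measurable (X i)) (hW : ∀ i, Measurable (W i)) (hε : ∀ i, Measurable (ε i))
    (hlaw : ∀ i, HasLaw (fun ω => (X i ω, W i ω, ε i ω))
      ((multivariateGaussian 0 SX).prod
        ((multivariateGaussian 0 SW).prod (gaussianReal 0 (σ ^ 2)))) P)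
    (hindep : iIndepFun (fun i ω => (X i ω, W i ω, ε i ω)) P)
    -- the outcomes and the predictions
    (Y Yh : ℕ → Ω → ℝ)
    (hY : ∀ i ω, Y i ω = inner ℝ (W i ω) γ + inner ℝ (X i ω) θ + ε i ω)
    (hYh : ∀ i ω, Yh i ω = inner ℝ (W i ω) γ)
    -- `n` labeled and `N n` unlabeled data points, `n / N → r`
    (N : ℕ → ℕ) (hN : ∀ n, 0 < N n) (r : ℝ)
    (hr : Tendsto (fun n : ℕ => (n : ℝ) / N n) atTop (𝓝 r))
    -- RePPI: an even split into three folds, and a black-box regression method with a seed that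
    -- is independent of the data
    (fold : ℕ → ℕ → Fin 3)
    (hfold : ∀ n k k', (RePPI.foldSet fold n k).card ≤ (RePPI.foldSet fold n k').card + 1)
    {𝒰 : Type*} [MeasurableSpace 𝒰] (seed : Ω → 𝒰) (hseed : Measurable seed)
    (hseed_indep : IndepFun seed (fun ω i => (X i ω, W i ω, ε i ω)) P)
    (A : RePPI.Learner d 𝒰) (hA : RePPI.MeasurableLearner A)
    -- `s⋆(X, Ŷ) = E[∇ℓ_θ(X, Y) ∣ X, Ŷ]` is estimated consistently in mean square
    (sstar : RePPI.Vec d × ℝ → RePPI.Vec d) (hsstar_meas : Measurable sstar)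
    (hsstar : (fun ω => sstar (X 0 ω, Yh 0 ω)) =ᵐ[P]
      P[fun ω => RePPI.lossGrad (RePPI.sqLoss d) θ (X 0 ω) (Y 0 ω) |
        MeasurableSpace.comap (fun ω => (X 0 ω, Yh 0 ω)) inferInstance])
    (hcons : ∀ k : Fin 3, ∀ δ : ℝ≥0∞, 0 < δ →
      Tendsto (fun n => P {ω | δ ≤ ∫⁻ z, ‖RePPI.fittedScore (RePPI.sqLoss d) A fold n k (seed ω)
          (fun i => X i ω) (fun i => Y i ω) (fun i => Yh i ω) z - sstar z‖ₑ ^ 2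
            ∂(P.map fun ω => (X 0 ω, Yh 0 ω))}) atTop (𝓝 0)) :
    -- the target, i.e. the minimizer of the population loss, is `θ`
    (∀ ϑ : RePPI.Vec d,
      (∀ t, ∫ ω, RePPI.sqLoss d ϑ (X 0 ω) (Y 0 ω) ∂P ≤ ∫ ω, RePPI.sqLoss d t (X 0 ω) (Y 0 ω) ∂P)
        ↔ ϑ = θ) ∧
    ∃ (SXY SPPI SPPIpp SRePPI : Matrix (Fin d) (Fin d) ℝ) (S : ℝ → Matrix (Fin d) (Fin d) ℝ),
      -- the XY-only estimator
      RePPI.IsAsympCov P (fun n ω => RePPI.xyEstimator (RePPI.labeled n) (RePPI.sqLoss d)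
        (fun i => X i ω) (fun i => Y i ω)) θ SXY ∧
      -- the PPI estimator: imputed loss `g = ℓ`
      RePPI.IsAsympCov P (fun n ω => RePPI.ppiEstimator (RePPI.labeled n)
        (RePPI.unlabeled n (N n)) (RePPI.sqLoss d) (RePPI.sqLoss d)
        (fun i => X i ω) (fun i => Y i ω) (fun i => Yh i ω)) θ SPPI ∧
      -- the estimators with imputed loss `g = lam • ℓ` for a fixed number `lam`
      (∀ lam : ℝ, RePPI.IsAsympCov P (fun n ω => RePPI.ppiEstimator (RePPI.labeled n)
        (RePPI.unlabeled n (N n)) (RePPI.sqLoss d) (lam • RePPI.sqLoss d)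
        (fun i => X i ω) (fun i => Y i ω) (fun i => Yh i ω)) θ (S lam)) ∧
      -- the trace of their asymptotic covariance has a minimizer `lamStar`
      (∃ lamStar : ℝ, ∀ lam, (S lamStar).trace ≤ (S lam).trace) ∧
      -- the PPI++ estimator: imputed loss `g = lamHat • ℓ` with `lamHat` consistent for `lamStar`
      (∀ lamStar : ℝ, (∀ lam, (S lamStar).trace ≤ (S lam).trace) →
        ∀ lamHat : ℕ → Ω → ℝ, (∀ n, Measurable (lamHat n)) →
          TendstoInMeasure P lamHat atTop (fun _ => lamStar) →
          RePPI.IsAsympCov P (fun n ω => RePPI.ppiEstimator (RePPI.labeled n)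
            (RePPI.unlabeled n (N n)) (RePPI.sqLoss d) (lamHat n ω • RePPI.sqLoss d)
            (fun i => X i ω) (fun i => Y i ω) (fun i => Yh i ω)) θ SPPIpp) ∧
      -- the RePPI estimator
      RePPI.IsAsympCov P (fun n ω => RePPI.reppiEstimator (RePPI.sqLoss d) A fold n (N n) (seed ω)
        (fun i => X i ω) (fun i => Y i ω) (fun i => Yh i ω)) θ SRePPI ∧
      -- the traces
      SXY.trace = (σ ^ 2 + RePPI.quadForm SW γ) * SX⁻¹.trace ∧
      SPPI.trace = (σ ^ 2 + (1 + r) * RePPI.quadForm SX θ + r * RePPI.quadForm SW γ) * SX⁻¹.trace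
        + (1 + r) * ‖θ‖ ^ 2 ∧
      SPPIpp.trace = (σ ^ 2 + (r / (1 + r) + 1 / (1 + r) *
          ((‖θ‖ ^ 2 / SX⁻¹.trace + RePPI.quadForm SX θ) /
            (‖θ‖ ^ 2 / SX⁻¹.trace + RePPI.quadForm SX θ + RePPI.quadForm SW γ)))
          * RePPI.quadForm SW γ) * SX⁻¹.trace ∧
      SRePPI.trace = (σ ^ 2 + r / (1 + r) * RePPI.quadForm SW γ) * SX⁻¹.trace ∧
      -- the comparison
      SRePPI.trace ≤ SPPIpp.trace ∧ SPPIpp.trace ≤ min SXY.trace SPPI.trace := by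

  obtain rfl : Y = fun i ω => outcome θ γ (X i ω, W i ω, ε i ω) := by
    funext i ω; rw [hY, outcome]
  obtain rfl : Yh = fun i ω => prediction γ (X i ω, W i ω, ε i ω) := by
    funext i ω; rw [hYh, prediction]
  have hr0 : 0 ≤ r := ge_of_tendsto' hr fun n => by positivity
  have hZ : IsIID P (fun i ω => (X i ω, W i ω, ε i ω)) (dataLaw SX SW σ) :=
    ⟨fun i => (hX i).prodMk ((hW i).prodMk (hε i)), fun i => (hlaw i).map_eq, hindep⟩
  have hppi : ∀ {lam : ℝ} {lamHat : ℕ → Ω → ℝ}, (∀ n, Measurable (lamHat n)) →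
      TendstoInMeasure P lamHat atTop (fun _ => lam) → _ := fun hm h =>
    isAsympCov_ppiEstimator (θ := θ) (γ := γ) hZ hSX hSW hN hr hm h
  have hconst : ∀ lam : ℝ, _ := fun lam : ℝ => hppi (lam := lam) (lamHat := fun _ _ => lam)
    (fun _ => measurable_const) (tendstoInMeasure_const_of_tendsto tendsto_const_nhds)
  -- XY-only and PPI are the members λ = 0 and λ = 1 of the power-tuned family, so the last
  -- inequality is optimality of the tuning evaluated at these two values.
  refine ⟨fun ϑ => ?_, asympCov SX SW σ θ γ r 0 1, asympCov SX SW σ θ γ r 1 1,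
    asympCov SX SW σ θ γ r (optimalTuning SX SW θ γ r) 1, asympCov SX SW σ θ γ r (1 + r)⁻¹ 0,
    fun lam => asympCov SX SW σ θ γ r lam 1, ?_, ?_, hconst,
    ⟨_, trace_asympCov_optimalTuning_le hSX hγ hr0⟩, ?_, ?_, ?_, ?_,
    trace_asympCov_optimalTuning hSX hγ hr0, trace_asympCov_recalibrated hr0,
    trace_recalibrated_le hSX hγ hr0, le_min (trace_asympCov_optimalTuning_le hSX hγ hr0 0)
      (trace_asympCov_optimalTuning_le hSX hγ hr0 1)⟩
  · rw [← forall_integral_sqLoss_le_iff (σ := σ) (θ := θ) (γ := γ) hSX hSW ϑ]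
    have h : ∀ t : Vec d, Measurable fun z : Vec d × Vec p × ℝ => sqLoss d t z.1 (outcome θ γ z) :=
      fun t => by
        have := measurable_outcome θ γ
        unfold sqLoss
        fun_prop
    exact forall_congr' fun t => by
      rw [← hZ.integral_comp 0 (h ϑ), ← hZ.integral_comp 0 (h t)]
  · have h := hconst 0
    simp only [← xyEstimator_eq_ppiEstimator] at h
    exact h
  · simpa only [one_smul] using hconst 1
  · intro lamStar hmin lamHat hm hlam
    rw [← asympCov_eq_of_minimizer hSX hγ hr0 hmin]
    exact hppi hm hlam
  · exact isAsympCov_reppiEstimator hZ hSX hSW hγ hN hr hfold hseed hseed_indep hA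
      fun k δ hδ => tendsto_lintegral_fittedScore hZ hA hsstar_meas hsstar k (hcons k δ hδ)
  · rw [asympCov_trace]; ring
  · rw [asympCov_trace]; ring
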